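/- Write $x=(x',x_5)\in\mathbb R^4\times\mathbb R=\mathbb R^5$, let $S^4\subset\mathbb R^5$ be the unit sphere and $\sigma_4$ its area. Let $S^4_+=\{y\in S^4 : y_5\ge 0\}$ and let $p:S^4_+\to S^4$ be a smooth map (up to the boundary) with $$p(y)=(0',1)\quad\text{and}\quad \frac{\partial p}{\partial y_5}(y)=0\qquad\text{whenever } y_5=0,$$ and of degree one, i.e. $\frac1{\sigma_4}\int_{S^4_+}\det\big(p,\,dp\,\tau_1,\dots,dp\,\tau_4\big)\,d\mathcal H^4=1$, where $(y,\tau_1,\dots,\tau_4)$ is a positively oriented orthonormal basis of $\mathbb R^5$ at each $y\in S^4_+$. For $L>0$ let $\Omega=\Omega_L\subset\mathbb R^5$ be the cylinder with two half balls attached, $$\Omega=\{|x-(0',L)|<1,\ x_5>L\}\ \cup\ \{|x'|<1,\ -L\le x_5\le L\}\ \cup\ \{|x+(0',L)|<1,\ x_5<-L\},$$ and let $\psi:\partial\Omega\to S^4$ be given by $$\psi(x',x_5)=\begin{cases}p(x',x_5-L), & x_5\ge L,\\ (0',1), & -L\le x_5\le L,\\ p(x',-x_5-L), & x_5\le -L.\end{cases}$$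 Let $\Psi:\Omega\to S^4$ be the extension of $\psi$ given by $\Psi(x)=\psi\big((0',\pm L)+\frac{x-(0',\pm L)}{|x-(0',\pm L)|}\big)$ in the upper ($+$) and the lower ($-$) half ball, and $\Psi=(0',1)$ for $|x_5|\le L$. Let $W^{2,2}_\psi(\Omega,S^4)$ be the set of all $u\in W^{2,2}(\Omega,\mathbb R^5)$ with $|u|=1$ a.e. in $\Omega$ and $u-\Psi\in W^{2,2}_0(\Omega,\mathbb R^5)$, i.e. such that $u=\psi$ and $\nabla u=\nabla\Psi$ on $\partial\Omega$ in the trace sense (in particular with zero normal derivative on $\partial\Omega$). Let $\mathbb H(u)=\int_\Omega|\Delta u|^2\,dx$. Then there is an $L_0>0$, which may depend on $p$, such that for every $L\ge L_0$ $$\inf_{u\in W^{2,2}_\psi(\Omega,S^4)}\mathbb H(u)\;<\;\inf_{v\in W^{2,2}_\psi(\Omega,S^4)\cap C^0(\overline\Omega,S^4)}\mathbb H(v).$$ -/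

import Mathlib

open MeasureTheory Set
open scoped ENNReal ContDiff

noncomputable section Sobolev

variable {n : ℕ} {F : Type*} [NormedAddCommGroup F] [NormedSpace ℝ F]

/-- `φ` is a smooth function with compact support contained in `Ω`. -/
structure IsTestFunction {G : Type*} [NormedAddCommGroup G] [NormedSpace ℝ G]
    (Ω : Set (EuclideanSpace ℝ (Fin n))) (φ : EuclideanSpace ℝ (Fin n) → G) : Prop where
  contDiff : ContDiff ℝ ∞ φ
  hasCompactSupport : HasCompactSupport φ
  tsupport_subset : tsupport φ ⊆ Ω

/-- `g` is a weak partial derivative `∂f/∂xᵢ` of `f` in the open set `Ω`: both functions are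
locally integrable in `Ω` and `∫_Ω (∂ᵢφ) f = - ∫_Ω φ g` for every test function `φ`. -/
structure HasWeakPartial (Ω : Set (EuclideanSpace ℝ (Fin n))) (i : Fin n)
    (f g : EuclideanSpace ℝ (Fin n) → F) : Prop where
  locallyIntegrableOn_left : LocallyIntegrableOn f Ω
  locallyIntegrableOn_right : LocallyIntegrableOn g Ω
  integral_eq : ∀ φ : EuclideanSpace ℝ (Fin n) → ℝ, IsTestFunction Ω φ →
    ∫ x in Ω, fderiv ℝ φ x (EuclideanSpace.single i 1) • f x = - ∫ x in Ω, φ x • g x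

open Classical in
/-- A representative of the weak partial derivative `∂f/∂xᵢ` in `Ω`, which is unique up to null
sets (the value is `0` if there is no weak derivative). -/
def weakPartial (Ω : Set (EuclideanSpace ℝ (Fin n))) (i : Fin n)
    (f : EuclideanSpace ℝ (Fin n) → F) : EuclideanSpace ℝ (Fin n) → F :=
  if h : ∃ g, HasWeakPartial Ω i f g then h.choose else 0

/-- The Sobolev space `W^{2,2}(Ω, F)`: `f` is in `L²(Ω)` and has first and second weak partial
derivatives in `L²(Ω)`. -/
def MemW22 (Ω : Set (EuclideanSpace ℝ (Fin n))) (f : EuclideanSpace ℝ (Fin n) → F) : Prop :=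
  MemLp f 2 (volume.restrict Ω) ∧
  ∃ (G : Fin n → EuclideanSpace ℝ (Fin n) → F) (K : Fin n → Fin n → EuclideanSpace ℝ (Fin n) → F),
    (∀ i, MemLp (G i) 2 (volume.restrict Ω) ∧ HasWeakPartial Ω i f (G i)) ∧
    (∀ i j, MemLp (K i j) 2 (volume.restrict Ω) ∧ HasWeakPartial Ω j (G i) (K i j))

/-- The norm of `W^{2,2}(Ω, F)` (the sum of the `L²(Ω)` norms of all weak derivatives of order at
most two), meant for functions `f` with `MemW22 Ω f`. -/
def w22Norm (Ω : Set (EuclideanSpace ℝ (Fin n))) (f : EuclideanSpace ℝ (Fin n) → F) : ℝ≥0∞ :=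
  eLpNorm f 2 (volume.restrict Ω)
    + ∑ i, eLpNorm (weakPartial Ω i f) 2 (volume.restrict Ω)
    + ∑ i, ∑ j, eLpNorm (weakPartial Ω j (weakPartial Ω i f)) 2 (volume.restrict Ω)

/-- The space `W^{2,2}_0(Ω, F)`: the closure of the test functions in `W^{2,2}(Ω, F)`. On a
Lipschitz domain these are the `w` for which `w` and `∇w` have vanishing trace on `∂Ω`. -/
def MemW22Zero (Ω : Set (EuclideanSpace ℝ (Fin n))) (w : EuclideanSpace ℝ (Fin n) → F) : Prop :=
  MemW22 Ω w ∧ ∀ ε : ℝ≥0∞, 0 < ε → ∃ φ : EuclideanSpace ℝ (Fin n) → F,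
    IsTestFunction Ω φ ∧ w22Norm Ω (w - φ) < ε

/-- The weak Laplacian `Δf = ∑ᵢ ∂ᵢ∂ᵢf` in `Ω`. -/
def weakLaplacian (Ω : Set (EuclideanSpace ℝ (Fin n))) (f : EuclideanSpace ℝ (Fin n) → F) :
    EuclideanSpace ℝ (Fin n) → F :=
  fun x => ∑ i, weakPartial Ω i (weakPartial Ω i f) x

/-- The Hessian energy `ℍ(u) = ∫_Ω |Δu|² dx`. -/
def hessianEnergy (Ω : Set (EuclideanSpace ℝ (Fin n))) (u : EuclideanSpace ℝ (Fin n) → F) :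
    ℝ≥0∞ :=
  ∫⁻ x in Ω, ‖weakLaplacian Ω u x‖ₑ ^ 2

/-- `W^{2,2}_{u₀}(Ω, S)`, `S` the unit sphere of `F`: the maps `u` in `W^{2,2}(Ω, F)` with
`|u| = 1` a.e. in `Ω` that have the same trace and the same trace of the gradient on `∂Ω`
as `u₀`. -/
def sphereMapsW22 (Ω : Set (EuclideanSpace ℝ (Fin n))) (u₀ : EuclideanSpace ℝ (Fin n) → F) :
    Set (EuclideanSpace ℝ (Fin n) → F) :=
  {u | MemW22 Ω u ∧ (∀ᵐ x ∂(volume.restrict Ω), ‖u x‖ = 1) ∧ MemW22Zero Ω (u - u₀)}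

end Sobolev

noncomputable section Capsule

/-- The point `(0', 1)` of `ℝ⁵ = ℝ⁴ × ℝ`, which is also the north pole of `S⁴`. The coordinate
`x₅` of `x` is `x 4`. -/
def northPole : EuclideanSpace ℝ (Fin 5) := EuclideanSpace.single 4 1

/-- The part `x' ∈ ℝ⁴` of the point `x = (x', x₅)` of `ℝ⁵`. -/
def horizontalPart (x : EuclideanSpace ℝ (Fin 5)) : EuclideanSpace ℝ (Fin 4) :=
  WithLp.toLp 2 fun i => x i.castSucc

/-- The reflection `(x', x₅) ↦ (x', -x₅)`. -/
def reflectLast (x : EuclideanSpace ℝ (Fin 5)) : EuclideanSpace ℝ (Fin 5) :=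
  x - (2 * x 4) • northPole

/-- The radial projection `x ↦ x / |x|`. -/
def radialProj (x : EuclideanSpace ℝ (Fin 5)) : EuclideanSpace ℝ (Fin 5) := ‖x‖⁻¹ • x

/-- The domain `Ω = B₁⁺((0', L)) ∪ (B₁⁴ × [-L, L]) ∪ B₁⁻((0', -L))` in `ℝ⁵`. -/
def capsule (L : ℝ) : Set (EuclideanSpace ℝ (Fin 5)) :=
  {x | ‖x - L • northPole‖ < 1 ∧ L < x 4} ∪
  {x | ‖horizontalPart x‖ < 1 ∧ x 4 ∈ Icc (-L) L} ∪
  {x | ‖x + L • northPole‖ < 1 ∧ x 4 < -L}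

/-- The degree of a smooth map `p` from the closed upper unit hemisphere of `ℝ⁵` to `S⁴` that is
constant on the equator: the integral over the hemisphere of the pull-back under `p` of the
volume form of `S⁴`, divided by the area of `S⁴`.
The linear map in the integrand sends `y` to `p y` and each tangent vector `τ` of the sphere at
`y` to `dp_y τ`, so that its determinant is `det (p, dp τ₁, dp τ₂, dp τ₃, dp τ₄)` for
each positively oriented orthonormal basis `(y, τ₁, τ₂, τ₃, τ₄)` of `ℝ⁵`. -/
def hemisphereDegree (p : EuclideanSpace ℝ (Fin 5) → EuclideanSpace ℝ (Fin 5)) : ℝ :=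
  ((volume : Measure (EuclideanSpace ℝ (Fin 5))).toSphere.real univ)⁻¹ *
    ∫ y in {y : Metric.sphere (0 : EuclideanSpace ℝ (Fin 5)) 1 |
        0 < (y : EuclideanSpace ℝ (Fin 5)) 4},
      (fderiv ℝ (p ∘ radialProj) (y : EuclideanSpace ℝ (Fin 5))
        + (innerSL ℝ (y : EuclideanSpace ℝ (Fin 5))).smulRight (p y)).det
      ∂(volume : Measure (EuclideanSpace ℝ (Fin 5))).toSphere

/-- The boundary map `ψ : ∂Ω → S⁴`: it is `ψ⁺(x) = p (x - (0', L))` for `x₅ ≥ L`, it is `(0', 1)`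
for `-L ≤ x₅ ≤ L`, and it is `ψ⁺(x', -x₅)` for `x₅ ≤ -L`. -/
def boundaryMap (p : EuclideanSpace ℝ (Fin 5) → EuclideanSpace ℝ (Fin 5)) (L : ℝ)
    (x : EuclideanSpace ℝ (Fin 5)) : EuclideanSpace ℝ (Fin 5) :=
  if L ≤ x 4 then p (x - L • northPole)
  else if x 4 ≤ -L then p (reflectLast x - L • northPole)
  else northPole

/-- The extension of `ψ` to `Ω` that is constant along the radii of the two half balls and along
the horizontal radii of the cylinder. It has trace `ψ` on `∂Ω`, and its normal derivative on `∂Ω`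
vanishes. -/
def radialExtension (p : EuclideanSpace ℝ (Fin 5) → EuclideanSpace ℝ (Fin 5)) (L : ℝ)
    (x : EuclideanSpace ℝ (Fin 5)) : EuclideanSpace ℝ (Fin 5) :=
  if L < x 4 then boundaryMap p L (L • northPole + radialProj (x - L • northPole))
  else if x 4 < -L then boundaryMap p L (-(L • northPole) + radialProj (x + L • northPole))
  else northPole

/-- The class `W^{2,2}_ψ(Ω, S⁴)` of maps with boundary data `ψ` on `∂Ω`. -/
def capsuleMaps (p : EuclideanSpace ℝ (Fin 5) → EuclideanSpace ℝ (Fin 5)) (L : ℝ) :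
    Set (EuclideanSpace ℝ (Fin 5) → EuclideanSpace ℝ (Fin 5)) :=
  sphereMapsW22 (capsule L) (radialExtension p L)

end Capsule

set_option linter.unusedSectionVars false

/-! The first infimum is bounded independently of `L`, while the second grows at least linearly in
`L`.

Upper bound. The radial extension `Ψ` is constant in the cylinder and homogeneous of degree zero
about the centre of each half ball. Its Hessian is `O(|x|⁻²)` there, which is square integrable in
dimension five, so `Ψ` is admissible and its energy is at most twice an energy on the unit ball
(`hessianEnergy_radialExtension_le`). Its two centres are point singularities of opposite degree.

Lower bound. Without singularities, the flux that leaves through the upper cap has to travel along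
the whole cylinder, and that is expensive. Let `v` be a continuous competitor of finite energy and
`u` its continuation by `Ψ` to all of `ℝ⁵` (`exists_continuous_extension`). Differentiating `|u|² =
1` twice gives `|∇u|² = -⟨u, Δu⟩ ≤ |Δu|`, so the energy bounds `∫_Ω |∇u|⁴`. This is the
integrability that the pull-back of the volume form of `S⁴` requires: the dual vector field `D` has
the components `Dⱼ = det (∂₁u, …, u, …, ∂₅u)`, with `u` in slot `j`, and `|Dⱼ| ≤ ∑ |∂ᵢu|⁴`.

For continuous `u` the field `D` is divergence free in the sense of distributions
(`sum_integral_current_eq_zero`). Indeed the mollifications of `u` stay away from zero on compact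
sets, so they can be projected to the sphere, where the pulled-back form is closed; the bound on `D`
lets the mollification parameter tend to zero.

Test `div D = 0` with a product of an axial cut-off, rising from 0 to 1 for `-L ≤ x₅ ≤ L`, and a
radial cut-off about `(0', L)` that equals one on the capsule. The derivative of the radial factor
only sees the region outside the capsule, where `u = Ψ`; polar coordinates and the degree hypothesis
evaluate this term as minus the area `σ₄` (`integral_flux_hemiMap`). The derivative of the axial
factor is at most `C / (2L)`. Hence `σ₄ ≤ C / (2L) · ℍ(v)` (`ofReal_area_le_hessianEnergy`), and
`L₀` is chosen to make this exceed the upper bound.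

Two analytic points support this. The gluing of `v` to `Ψ` keeps two weak derivatives because
elements of `W^{2,2}_0` extend by zero (`MemW22Zero.hasWeakPartial_indicator`), and it is continuous
because an element of `W^{2,2}_0` that has a limit at a boundary point has the limit zero
(`MemW22Zero.eq_zero_of_tendsto`). -/

/-- The Euclidean space `ℝⁿ`. -/
abbrev Eucl (n : ℕ) := EuclideanSpace ℝ (Fin n)

/-- The standard basis vectors of `ℝⁿ`. -/
noncomputable abbrev stdVec {n : ℕ} (i : Fin n) : Eucl n := EuclideanSpace.single i 1

/-! ### Calculus of weak partial derivatives -/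

section WeakPartialBasics

open Filter Topology

variable {n : ℕ} {F : Type*} [NormedAddCommGroup F] [NormedSpace ℝ F]
  {G : Type*} [NormedAddCommGroup G] [NormedSpace ℝ G]
  {Ω Ω' : Set (Eucl n)} {i j : Fin n}

theorem IsTestFunction.mono {φ : Eucl n → G} (h : IsTestFunction Ω φ) (hΩ : Ω ⊆ Ω') :
    IsTestFunction Ω' φ :=
  ⟨h.contDiff, h.hasCompactSupport, h.tsupport_subset.trans hΩ⟩

theorem IsTestFunction.eq_zero {φ : Eucl n → G} (h : IsTestFunction Ω φ) {x : Eucl n}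
    (hx : x ∉ Ω) : φ x = 0 :=
  image_eq_zero_of_notMem_tsupport fun h' => hx (h.tsupport_subset h')

theorem IsTestFunction.continuous {φ : Eucl n → G} (h : IsTestFunction Ω φ) : Continuous φ :=
  h.contDiff.continuous

theorem IsTestFunction.differentiable {φ : Eucl n → G} (h : IsTestFunction Ω φ) :
    Differentiable ℝ φ :=
  h.contDiff.differentiable (by simp)

theorem ContDiff.fderiv_apply_const {φ : Eucl n → G} (h : ContDiff ℝ ∞ φ) (v : Eucl n) :
    ContDiff ℝ ∞ fun x => fderiv ℝ φ x v :=
  (h.fderiv_right (m := ∞) (by simp)).clm_apply contDiff_const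

theorem IsTestFunction.fderiv_apply {φ : Eucl n → G} (h : IsTestFunction Ω φ) (v : Eucl n) :
    IsTestFunction Ω fun x => fderiv ℝ φ x v :=
  ⟨h.contDiff.fderiv_apply_const v, h.hasCompactSupport.fderiv_apply (𝕜 := ℝ) v,
    (tsupport_fderiv_apply_subset ℝ v).trans h.tsupport_subset⟩

theorem IsTestFunction.mul_contDiff {φ f : Eucl n → ℝ} (h : IsTestFunction Ω φ)
    (hf : ContDiff ℝ ∞ f) : IsTestFunction Ω fun x => φ x * f x :=
  ⟨h.contDiff.mul hf, h.hasCompactSupport.mul_right,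
    (tsupport_mul_subset_left).trans h.tsupport_subset⟩

/-- Locally integrable functions are integrable against continuous functions with compact support
in the domain. -/
theorem LocallyIntegrableOn.integrableOn_smul {f : Eucl n → F} (hf : LocallyIntegrableOn f Ω)
    {φ : Eucl n → ℝ} (hφ : Continuous φ) (hc : HasCompactSupport φ) (hs : tsupport φ ⊆ Ω) :
    IntegrableOn (fun x => φ x • f x) Ω := by
  have h1 : IntegrableOn f (tsupport φ) := hf.integrableOn_compact_subset hs hc
  have h2 : IntegrableOn (fun x => φ x • f x) (tsupport φ) :=
    h1.continuousOn_smul hφ.continuousOn hc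
  have h3 : Function.support (fun x => φ x • f x) ⊆ tsupport φ :=
    (Function.support_smul_subset_left _ _).trans subset_closure
  exact ((integrableOn_iff_integrable_of_support_subset h3).1 h2).integrableOn

theorem HasWeakPartial.integrableOn_left {f g : Eucl n → F} (h : HasWeakPartial Ω i f g)
    {φ : Eucl n → ℝ} (hφ : IsTestFunction Ω φ) (v : Eucl n) :
    IntegrableOn (fun x => fderiv ℝ φ x v • f x) Ω :=
  LocallyIntegrableOn.integrableOn_smul h.locallyIntegrableOn_left (hφ.fderiv_apply v).continuous
    (hφ.fderiv_apply v).hasCompactSupport (hφ.fderiv_apply v).tsupport_subset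

theorem HasWeakPartial.integrableOn_right {f g : Eucl n → F} (h : HasWeakPartial Ω i f g)
    {φ : Eucl n → ℝ} (hφ : IsTestFunction Ω φ) :
    IntegrableOn (fun x => φ x • g x) Ω :=
  LocallyIntegrableOn.integrableOn_smul h.locallyIntegrableOn_right hφ.continuous
    hφ.hasCompactSupport hφ.tsupport_subset

/-- Weak partial derivatives are unique up to null sets. -/
theorem HasWeakPartial.ae_eq [CompleteSpace F] {f g g' : Eucl n → F} (hΩ : IsOpen Ω)
    (h : HasWeakPartial Ω i f g) (h' : HasWeakPartial Ω i f g') :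
    g =ᵐ[volume.restrict Ω] g' := by
  have key := hΩ.ae_eq_zero_of_integral_contDiff_smul_eq_zero (μ := volume)
    (h.locallyIntegrableOn_right.sub h'.locallyIntegrableOn_right) (fun φ h1 h2 h3 => ?_)
  · rw [Filter.EventuallyEq, ae_restrict_iff' hΩ.measurableSet]
    filter_upwards [key] with x hx hxΩ
    exact sub_eq_zero.1 (hx hxΩ)
  · have hφ : IsTestFunction Ω φ := ⟨h1, h2, h3⟩
    rw [← setIntegral_eq_integral_of_forall_compl_eq_zero (s := Ω)
      (fun x hx => by rw [hφ.eq_zero hx, zero_smul])]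
    simp only [Pi.sub_apply, smul_sub]
    rw [integral_sub (h.integrableOn_right hφ) (h'.integrableOn_right hφ), sub_eq_zero]
    have := (h.integral_eq φ hφ).symm.trans (h'.integral_eq φ hφ)
    exact neg_injective this

theorem HasWeakPartial.congr {f f' g g' : Eucl n → F} (h : HasWeakPartial Ω i f g)
    (hf : f =ᵐ[volume.restrict Ω] f') (hg : g =ᵐ[volume.restrict Ω] g') :
    HasWeakPartial Ω i f' g' where
  locallyIntegrableOn_left := h.locallyIntegrableOn_left.congr hf
  locallyIntegrableOn_right := h.locallyIntegrableOn_right.congr hg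
  integral_eq φ hφ := by
    have e1 : ∫ x in Ω, fderiv ℝ φ x (stdVec i) • f' x = ∫ x in Ω, fderiv ℝ φ x (stdVec i) • f x :=
      integral_congr_ae (by filter_upwards [hf] with x hx; rw [hx])
    have e2 : ∫ x in Ω, φ x • g' x = ∫ x in Ω, φ x • g x :=
      integral_congr_ae (by filter_upwards [hg] with x hx; rw [hx])
    rw [e1, e2, h.integral_eq φ hφ]

theorem HasWeakPartial.add {f f' g g' : Eucl n → F} (h : HasWeakPartial Ω i f g)
    (h' : HasWeakPartial Ω i f' g') :
    HasWeakPartial Ω i (fun x => f x + f' x) (fun x => g x + g' x) where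
  locallyIntegrableOn_left := h.locallyIntegrableOn_left.add h'.locallyIntegrableOn_left
  locallyIntegrableOn_right := h.locallyIntegrableOn_right.add h'.locallyIntegrableOn_right
  integral_eq φ hφ := by
    simp only [smul_add]
    rw [integral_add (h.integrableOn_left hφ _) (h'.integrableOn_left hφ _),
      integral_add (h.integrableOn_right hφ) (h'.integrableOn_right hφ), h.integral_eq φ hφ,
      h'.integral_eq φ hφ, neg_add]

theorem LocallyIntegrableOn.clm_comp {f : Eucl n → F} (hf : LocallyIntegrableOn f Ω)
    (T : F →L[ℝ] G) : LocallyIntegrableOn (fun x => T (f x)) Ω := by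
  intro x hx
  obtain ⟨s, hs, h⟩ := hf x hx
  exact ⟨s, hs, T.integrable_comp h⟩

theorem HasWeakPartial.clm_comp [CompleteSpace F] [CompleteSpace G] {f g : Eucl n → F}
    (h : HasWeakPartial Ω i f g) (T : F →L[ℝ] G) :
    HasWeakPartial Ω i (fun x => T (f x)) (fun x => T (g x)) where
  locallyIntegrableOn_left := LocallyIntegrableOn.clm_comp h.locallyIntegrableOn_left T
  locallyIntegrableOn_right := LocallyIntegrableOn.clm_comp h.locallyIntegrableOn_right T
  integral_eq φ hφ := by
    simp only [← map_smul]
    rw [T.integral_comp_comm (h.integrableOn_left hφ _),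
      T.integral_comp_comm (h.integrableOn_right hφ), h.integral_eq φ hφ, map_neg]

theorem HasWeakPartial.sub [CompleteSpace F] {f f' g g' : Eucl n → F} (h : HasWeakPartial Ω i f g)
    (h' : HasWeakPartial Ω i f' g') :
    HasWeakPartial Ω i (fun x => f x - f' x) (fun x => g x - g' x) := by
  simpa [sub_eq_add_neg] using h.add (h'.clm_comp (-ContinuousLinearMap.id ℝ F))

theorem HasWeakPartial.mono {f g : Eucl n → F} (h : HasWeakPartial Ω' i f g) (hΩ : Ω ⊆ Ω') :
    HasWeakPartial Ω i f g where
  locallyIntegrableOn_left := h.locallyIntegrableOn_left.mono_set hΩ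
  locallyIntegrableOn_right := h.locallyIntegrableOn_right.mono_set hΩ
  integral_eq φ hφ := by
    have h1 := h.integral_eq φ (hφ.mono hΩ)
    have e1 (S : Set (Eucl n)) (hS : Ω ⊆ S) :
        ∫ x in S, φ x • g x = ∫ x, φ x • g x :=
      setIntegral_eq_integral_of_forall_compl_eq_zero fun x hx => by
        rw [hφ.eq_zero fun h => hx (hS h), zero_smul]
    have e2 (S : Set (Eucl n)) (hS : Ω ⊆ S) :
        ∫ x in S, fderiv ℝ φ x (stdVec i) • f x = ∫ x, fderiv ℝ φ x (stdVec i) • f x :=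
      setIntegral_eq_integral_of_forall_compl_eq_zero fun x hx => by
        rw [(hφ.fderiv_apply _).eq_zero fun h => hx (hS h), zero_smul]
    rw [e1 _ hΩ, e2 _ hΩ] at h1
    rw [e1 _ subset_rfl, e2 _ subset_rfl, h1]

theorem ContDiff.hasWeakPartial {f : Eucl n → F} (hf : ContDiff ℝ 1 f) (Ω : Set (Eucl n))
    (i : Fin n) : HasWeakPartial Ω i f fun x => fderiv ℝ f x (stdVec i) := by
  have hf' : Continuous fun x => fderiv ℝ f x (stdVec i) :=
    (hf.continuous_fderiv (by simp)).clm_apply continuous_const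
  refine HasWeakPartial.mono (Ω' := univ) ?_ (subset_univ _)
  refine ⟨hf.continuous.locallyIntegrable.locallyIntegrableOn _,
    hf'.locallyIntegrable.locallyIntegrableOn _, fun φ hφ => ?_⟩
  rw [setIntegral_univ, setIntegral_univ, eq_comm, neg_eq_iff_eq_neg]
  apply integral_smul_fderiv_eq_neg_fderiv_smul_of_integrable
  · exact ((hφ.fderiv_apply _).continuous.smul hf.continuous).integrable_of_hasCompactSupport
      (hφ.fderiv_apply _).hasCompactSupport.smul_right
  · exact (hφ.continuous.smul hf').integrable_of_hasCompactSupport hφ.hasCompactSupport.smul_right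
  · exact (hφ.continuous.smul hf.continuous).integrable_of_hasCompactSupport
      hφ.hasCompactSupport.smul_right
  · exact fun x _ => hφ.differentiable x
  · exact fun x _ => hf.differentiable (by simp) x

theorem hasWeakPartial_const (c : F) (Ω : Set (Eucl n)) (i : Fin n) :
    HasWeakPartial Ω i (fun _ => c) fun _ => 0 := by
  simpa using (contDiff_const (𝕜 := ℝ) (n := 1) (c := c)).hasWeakPartial Ω i

theorem HasWeakPartial.hasWeakPartial_weakPartial {f g : Eucl n → F} (h : HasWeakPartial Ω i f g) :
    HasWeakPartial Ω i f (weakPartial Ω i f) := by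
  have h' : ∃ g, HasWeakPartial Ω i f g := ⟨g, h⟩
  rw [weakPartial, dif_pos h']
  exact h'.choose_spec

theorem HasWeakPartial.weakPartial_ae_eq [CompleteSpace F] {f g : Eucl n → F} (hΩ : IsOpen Ω)
    (h : HasWeakPartial Ω i f g) : weakPartial Ω i f =ᵐ[volume.restrict Ω] g :=
  h.hasWeakPartial_weakPartial.ae_eq hΩ h

theorem HasWeakPartial.weakPartial_weakPartial_ae_eq [CompleteSpace F] {f g k : Eucl n → F}
    (hΩ : IsOpen Ω) (h : HasWeakPartial Ω i f g) (h' : HasWeakPartial Ω j g k) :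
    weakPartial Ω j (weakPartial Ω i f) =ᵐ[volume.restrict Ω] k :=
  (h'.congr (h.weakPartial_ae_eq hΩ).symm (ae_eq_refl _)).weakPartial_ae_eq hΩ

/-- Uniqueness of weak derivatives up to null sets allows the chosen representatives inside
`weakLaplacian` to be traded for explicit ones. Both energy estimates, from above and from below,
start from this. -/
theorem hessianEnergy_eq [CompleteSpace F] {u : Eucl n → F} {g : Fin n → Eucl n → F}
    {k : Fin n → Eucl n → F} (hΩ : IsOpen Ω) (h : ∀ i, HasWeakPartial Ω i u (g i))
    (h' : ∀ i, HasWeakPartial Ω i (g i) (k i)) :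
    hessianEnergy Ω u = ∫⁻ x in Ω, ‖∑ i, k i x‖ₑ ^ 2 := by
  apply lintegral_congr_ae
  have := ae_all_iff.2 fun i => (h i).weakPartial_weakPartial_ae_eq hΩ (h' i)
  filter_upwards [this] with x hx
  simp only [weakLaplacian, hx]

end WeakPartialBasics

/-! ### Extension by zero of functions in `W^{2,2}_0` -/

section ExtensionByZero

open Filter Topology

variable {n : ℕ} {F : Type*} [NormedAddCommGroup F] [NormedSpace ℝ F] [CompleteSpace F]
  {Ω : Set (Eucl n)} {i j : Fin n}

theorem IsTestFunction.hasWeakPartial {φ : Eucl n → F} (hφ : IsTestFunction Ω φ)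
    (Ω' : Set (Eucl n)) (i : Fin n) :
    HasWeakPartial Ω' i φ fun x => fderiv ℝ φ x (stdVec i) :=
  (hφ.contDiff.of_le (by simp)).hasWeakPartial Ω' i

/-- Every summand of `w22Norm` is at most the whole sum, and inside it the chosen representatives
may be replaced by `G`, `K` and the classical derivatives of `φ`. One test function thus serves all
orders at once. -/
theorem MemW22Zero.exists_approx {w : Eucl n → F} {G : Fin n → Eucl n → F}
    {K : Fin n → Fin n → Eucl n → F} (hΩ : IsOpen Ω) (hw : MemW22Zero Ω w)
    (hG : ∀ i, HasWeakPartial Ω i w (G i)) (hK : ∀ i j, HasWeakPartial Ω j (G i) (K i j))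
    {ε : ℝ≥0∞} (hε : 0 < ε) : ∃ φ : Eucl n → F, IsTestFunction Ω φ ∧
      eLpNorm (fun x => w x - φ x) 2 (volume.restrict Ω) < ε ∧
      (∀ i, eLpNorm (fun x => G i x - fderiv ℝ φ x (stdVec i)) 2 (volume.restrict Ω) < ε) ∧
      (∀ i j, eLpNorm (fun x => K i j x -
        fderiv ℝ (fun y => fderiv ℝ φ y (stdVec i)) x (stdVec j)) 2 (volume.restrict Ω) < ε) := by
  obtain ⟨φ, hφ, hlt⟩ := hw.2 ε hε
  have h1 (i : Fin n) := (hG i).sub (hφ.hasWeakPartial Ω i)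
  have h2 (i j : Fin n) := (hK i j).sub ((hφ.fderiv_apply (stdVec i)).hasWeakPartial Ω j)
  have e1 (i : Fin n) := eLpNorm_congr_ae (p := 2) ((h1 i).weakPartial_ae_eq hΩ)
  have e2 (i j : Fin n) :=
    eLpNorm_congr_ae (p := 2) ((h1 i).weakPartial_weakPartial_ae_eq hΩ (h2 i j))
  have e0 : (w - φ) = fun x => w x - φ x := rfl
  rw [w22Norm, e0] at hlt
  simp only [e1, e2] at hlt
  refine ⟨φ, hφ, lt_of_le_of_lt ?_ hlt, fun i => lt_of_le_of_lt ?_ hlt,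
    fun i j => lt_of_le_of_lt ?_ hlt⟩
  · exact le_self_add.trans le_self_add
  · exact ((Finset.single_le_sum (f := fun i => eLpNorm (fun x => G i x - fderiv ℝ φ x (stdVec i)) 2
      (volume.restrict Ω)) (fun _ _ => zero_le) (Finset.mem_univ i)).trans le_add_self).trans
      le_self_add
  · refine ((Finset.single_le_sum (f := fun j => eLpNorm (fun x => K i j x -
        fderiv ℝ (fun y => fderiv ℝ φ y (stdVec i)) x (stdVec j)) 2 (volume.restrict Ω))
        (fun _ _ => zero_le) (Finset.mem_univ j)).trans ?_).trans le_add_self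
    exact Finset.single_le_sum (f := fun i => ∑ j, eLpNorm (fun x => K i j x -
        fderiv ℝ (fun y => fderiv ℝ φ y (stdVec i)) x (stdVec j)) 2 (volume.restrict Ω))
        (fun _ _ => zero_le) (Finset.mem_univ i)

/-- The Cauchy–Schwarz inequality. -/
theorem enorm_integral_smul_le {μ : Measure (Eucl n)} {φ : Eucl n → ℝ} {f : Eucl n → F}
    (hφ : AEStronglyMeasurable φ μ) (hf : AEStronglyMeasurable f μ) :
    ‖∫ x, φ x • f x ∂μ‖ₑ ≤ eLpNorm φ 2 μ * eLpNorm f 2 μ := by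
  refine (enorm_integral_le_lintegral_enorm _).trans ?_
  rw [← eLpNorm_one_eq_lintegral_enorm]
  exact eLpNorm_smul_le_mul_eLpNorm (p := 2) (q := 2) (r := 1) hf hφ

/-- If `(f, g)` is an `L²` limit of pairs `(φ, ∂ᵢφ)`, `φ` a test function in `Ω`, then
the extensions by zero of `f` and `g` satisfy `∂ᵢf = g` weakly in the whole space. -/
theorem hasWeakPartial_indicator_of_approx {f g : Eucl n → F} (hΩ : IsOpen Ω)
    (hf : MemLp f 2 (volume.restrict Ω)) (hg : MemLp g 2 (volume.restrict Ω))
    (h : ∀ ε : ℝ≥0∞, 0 < ε → ∃ φ : Eucl n → F, IsTestFunction Ω φ ∧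
      eLpNorm (fun x => f x - φ x) 2 (volume.restrict Ω) < ε ∧
      eLpNorm (fun x => g x - fderiv ℝ φ x (stdVec i)) 2 (volume.restrict Ω) < ε) :
    HasWeakPartial univ i (Ω.indicator f) (Ω.indicator g) := by
  have hm := hΩ.measurableSet
  have hloc {f : Eucl n → F} (hf : MemLp f 2 (volume.restrict Ω)) :
      LocallyIntegrable (Ω.indicator f) :=
    ((memLp_indicator_iff_restrict hm).2 hf).locallyIntegrable (by norm_num)
  refine ⟨(hloc hf).locallyIntegrableOn _, (hloc hg).locallyIntegrableOn _, fun η hη => ?_⟩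
  have hind (ζ : Eucl n → ℝ) (f : Eucl n → F) :
      ∫ x in univ, ζ x • Ω.indicator f x = ∫ x in Ω, ζ x • f x := by
    rw [setIntegral_univ, ← integral_indicator hm]
    congr 1 with x
    by_cases hx : x ∈ Ω <;> simp [hx]
  rw [hind (fun x => fderiv ℝ η x (EuclideanSpace.single i 1)), hind]
  have hint (ζ : Eucl n → ℝ) (hζ : IsTestFunction univ ζ) {f : Eucl n → F}
      (hf : MemLp f 2 (volume.restrict Ω)) : Integrable (fun x => ζ x • f x) (volume.restrict Ω) := by
    have h2 : MemLp ζ 2 (volume.restrict Ω) :=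
      (hζ.continuous.memLp_of_hasCompactSupport hζ.hasCompactSupport).restrict _
    exact memLp_one_iff_integrable.1 (MemLp.smul (p := 2) (q := 2) (r := 1) hf h2)
  set η' : Eucl n → ℝ := fun x => fderiv ℝ η x (stdVec i)
  have hη' : IsTestFunction univ η' := hη.fderiv_apply _
  rw [← sub_eq_zero, sub_neg_eq_add, ← enorm_eq_zero, ← nonpos_iff_eq_zero]
  set A := eLpNorm η' 2 (volume.restrict Ω)
  set B := eLpNorm η 2 (volume.restrict Ω)
  have hA : A ≠ ⊤ :=
    ((hη'.continuous.memLp_of_hasCompactSupport hη'.hasCompactSupport).restrict _).eLpNorm_ne_top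
  have hB : B ≠ ⊤ :=
    ((hη.continuous.memLp_of_hasCompactSupport hη.hasCompactSupport).restrict _).eLpNorm_ne_top
  -- For the approximating `φ` the integration by parts against `η` is exact, although `η` need not
  -- vanish on the boundary of `Ω`, because `φ` does. The defect for the pair `(f, g)` is therefore
  -- linear in the error.
  have key (ε : ℝ≥0∞) (hε : 0 < ε) :
      ‖(∫ x in Ω, η' x • f x) + ∫ x in Ω, η x • g x‖ₑ ≤ (A + B) * ε := by
    obtain ⟨φ, hφ, h1, h2⟩ := h ε hε
    have mφ (F' : Eucl n → F) (hF' : IsTestFunction Ω F') : MemLp F' 2 (volume.restrict Ω) :=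
      (hF'.continuous.memLp_of_hasCompactSupport hF'.hasCompactSupport).restrict _
    have m1 := mφ φ hφ
    have m2 := mφ _ (hφ.fderiv_apply (stdVec i))
    have hz : (∫ x in Ω, η' x • φ x) + ∫ x in Ω, η x • fderiv ℝ φ x (stdVec i) = 0 := by
      have h0 := (hφ.hasWeakPartial univ i).integral_eq η hη
      have e1 : ∫ x in Ω, η' x • φ x = ∫ x, η' x • φ x :=
        setIntegral_eq_integral_of_forall_compl_eq_zero fun x hx => by
          rw [hφ.eq_zero hx, smul_zero]
      have e2 : ∫ x in Ω, η x • fderiv ℝ φ x (stdVec i) =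
          ∫ x, η x • fderiv ℝ φ x (stdVec i) :=
        setIntegral_eq_integral_of_forall_compl_eq_zero fun x hx => by
          rw [(hφ.fderiv_apply (stdVec i)).eq_zero hx, smul_zero]
      rw [setIntegral_univ, setIntegral_univ] at h0
      rw [e1, e2]
      exact add_eq_zero_iff_eq_neg.2 h0
    have e : (∫ x in Ω, η' x • f x) + ∫ x in Ω, η x • g x =
        (∫ x in Ω, η' x • (f x - φ x)) +
          ∫ x in Ω, η x • (g x - fderiv ℝ φ x (stdVec i)) := by
      simp only [smul_sub]
      rw [integral_sub (hint _ hη' hf) (hint _ hη' m1), integral_sub (hint _ hη hg) (hint _ hη m2)]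
      rw [sub_add_sub_comm, hz, sub_zero]
    rw [e]
    refine (enorm_add_le _ _).trans ?_
    rw [add_mul]
    gcongr
    · refine (enorm_integral_smul_le hη'.continuous.aestronglyMeasurable (hf.1.sub m1.1)).trans ?_
      exact mul_le_mul_right h1.le _
    · refine (enorm_integral_smul_le hη.continuous.aestronglyMeasurable (hg.1.sub m2.1)).trans ?_
      exact mul_le_mul_right h2.le _
  have hAB : A + B ≠ ⊤ := ENNReal.add_ne_top.2 ⟨hA, hB⟩
  have ht : Tendsto (fun ε : ℝ≥0∞ => (A + B) * ε) (𝓝[>] 0) (𝓝 0) := by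
    have : Tendsto (fun ε : ℝ≥0∞ => (A + B) * ε) (𝓝 0) (𝓝 ((A + B) * 0)) :=
      ENNReal.Tendsto.const_mul tendsto_id (Or.inr hAB)
    rw [mul_zero] at this
    exact this.mono_left nhdsWithin_le_nhds
  exact ge_of_tendsto ht (by filter_upwards [self_mem_nhdsWithin] with ε hε using key ε hε)

/-- This is what permits gluing: adding the extension by zero to a function with two weak
derivatives in the whole space creates no singular part on the boundary of `Ω`, neither in the
gradient nor in the Hessian. -/
theorem MemW22Zero.hasWeakPartial_indicator {w : Eucl n → F} {G : Fin n → Eucl n → F}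
    {K : Fin n → Fin n → Eucl n → F} (hΩ : IsOpen Ω) (hw : MemW22Zero Ω w)
    (hG : ∀ i, MemLp (G i) 2 (volume.restrict Ω) ∧ HasWeakPartial Ω i w (G i))
    (hK : ∀ i j, MemLp (K i j) 2 (volume.restrict Ω) ∧ HasWeakPartial Ω j (G i) (K i j)) :
    (∀ i, HasWeakPartial univ i (Ω.indicator w) (Ω.indicator (G i))) ∧
      ∀ i j, HasWeakPartial univ j (Ω.indicator (G i)) (Ω.indicator (K i j)) := by
  refine ⟨fun i => ?_, fun i j => ?_⟩
  · refine hasWeakPartial_indicator_of_approx hΩ hw.1.1 (hG i).1 fun ε hε => ?_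
    obtain ⟨φ, hφ, h0, h1, -⟩ :=
      hw.exists_approx hΩ (fun i => (hG i).2) (fun i j => (hK i j).2) hε
    exact ⟨φ, hφ, h0, h1 i⟩
  · refine hasWeakPartial_indicator_of_approx hΩ (hG i).1 (hK i j).1 fun ε hε => ?_
    obtain ⟨φ, hφ, -, h1, h2⟩ :=
      hw.exists_approx hΩ (fun i => (hG i).2) (fun i j => (hK i j).2) hε
    exact ⟨_, hφ.fderiv_apply _, h1 i, h2 i j⟩

theorem memW22Zero_zero (hΩ : IsOpen Ω) : MemW22Zero Ω (0 : Eucl n → F) := by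
  have h0 (i : Fin n) : HasWeakPartial Ω i (0 : Eucl n → F) 0 := hasWeakPartial_const 0 Ω i
  refine ⟨⟨MemLp.zero, fun _ => 0, fun _ _ => 0, fun i => ⟨MemLp.zero, h0 i⟩,
    fun i j => ⟨MemLp.zero, h0 j⟩⟩, fun ε hε => ⟨0, ⟨contDiff_const, HasCompactSupport.zero,
      by simp [tsupport_zero]⟩, ?_⟩⟩
  have e1 (i : Fin n) := eLpNorm_congr_ae (p := 2) ((h0 i).weakPartial_ae_eq hΩ)
  have e2 (i j : Fin n) :=
    eLpNorm_congr_ae (p := 2) ((h0 i).weakPartial_weakPartial_ae_eq hΩ (h0 j))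
  rw [w22Norm, sub_zero]
  simpa only [e1, e2, eLpNorm_zero, Finset.sum_const_zero, add_zero] using hε

end ExtensionByZero

/-! ### Mollification and passage to the limit under moving majorants -/

section Mollification

open Filter Topology
open scoped Convolution

/-- Dominated convergence with varying integrable bounds. -/
theorem tendsto_integral_of_varying_bound {α F : Type*} [MeasurableSpace α] {μ : Measure α}
    [NormedAddCommGroup F] [NormedSpace ℝ F] {f : ℕ → α → F} {f₀ : α → F} {g : ℕ → α → ℝ}
    {g₀ : α → ℝ} (hfm : ∀ k, AEStronglyMeasurable (f k) μ) (hgi : ∀ k, Integrable (g k) μ)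
    (hg₀ : Integrable g₀ μ) (hf : ∀ᵐ x ∂μ, Tendsto (fun k => f k x) atTop (𝓝 (f₀ x)))
    (hg : ∀ᵐ x ∂μ, Tendsto (fun k => g k x) atTop (𝓝 (g₀ x)))
    (hgint : Tendsto (fun k => ∫ x, g k x ∂μ) atTop (𝓝 (∫ x, g₀ x ∂μ)))
    (hfg : ∀ k, ∀ᵐ x ∂μ, ‖f k x‖ ≤ g k x) :
    Tendsto (fun k => ∫ x, f k x ∂μ) atTop (𝓝 (∫ x, f₀ x ∂μ)) := by
  have hfg' := ae_all_iff.2 hfg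
  have hfm₀ : AEStronglyMeasurable f₀ μ := aestronglyMeasurable_of_tendsto_ae atTop hfm hf
  have hle₀ : ∀ᵐ x ∂μ, ‖f₀ x‖ ≤ g₀ x := by
    filter_upwards [hf, hg, hfg'] with x h1 h2 h3
    exact le_of_tendsto_of_tendsto' h1.norm h2 h3
  have hfi (k : ℕ) : Integrable (f k) μ := (hgi k).mono' (hfm k) (hfg k)
  have hfi₀ : Integrable f₀ μ := hg₀.mono' hfm₀ hle₀
  -- Scheffé's argument: the positive part of `g₀ - gₖ` is dominated by `g₀`, and the convergence of
  -- the integrals then also sends the integral of the positive part of `gₖ - g₀` to zero.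
  have hpos : Tendsto (fun k => ∫ x, max (g₀ x - g k x) 0 ∂μ) atTop (𝓝 0) := by
    have := tendsto_integral_of_dominated_convergence (μ := μ) (f := fun _ => (0 : ℝ))
      (F := fun k x => max (g₀ x - g k x) 0) g₀
      (fun k => ((hg₀.sub (hgi k)).pos_part).aestronglyMeasurable) hg₀ ?_ ?_
    · simpa using this
    · intro k
      filter_upwards [hfg k, hle₀] with x h1 h2
      have := (norm_nonneg _).trans h1
      have h3 := (norm_nonneg _).trans h2
      rw [Real.norm_of_nonneg (le_max_right _ _)]
      exact max_le (by linarith) h3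
    · filter_upwards [hg] with x hx
      have : Tendsto (fun k => max (g₀ x - g k x) 0) atTop (𝓝 (max (g₀ x - g₀ x) 0)) :=
        (tendsto_const_nhds.sub hx).max tendsto_const_nhds
      simpa using this
  have hneg : Tendsto (fun k => ∫ x, max (g k x - g₀ x) 0 ∂μ) atTop (𝓝 0) := by
    have e (k : ℕ) : ∫ x, max (g k x - g₀ x) 0 ∂μ =
        (∫ x, g k x ∂μ) - (∫ x, g₀ x ∂μ) + ∫ x, max (g₀ x - g k x) 0 ∂μ := by
      have hp : Integrable (fun x => max (g₀ x - g k x) 0) μ := (hg₀.sub (hgi k)).pos_part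
      rw [← integral_sub (hgi k) hg₀, ← integral_add (f := fun x => g k x - g₀ x)
        ((hgi k).sub hg₀) hp]
      congr 1 with x
      rcases le_total (g k x) (g₀ x) with h | h
      · rw [max_eq_right (by linarith), max_eq_left (by linarith)]; ring
      · rw [max_eq_left (by linarith), max_eq_right (by linarith)]; ring
    simp only [e]
    simpa using (hgint.sub_const (∫ x, g₀ x ∂μ)).add hpos
  -- Truncation at `2 * g₀` makes dominated convergence applicable. Since `‖fₖ - f₀‖ ≤ gₖ + g₀`,
  -- what the truncation cuts off is at most the positive part of `gₖ - g₀`.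
  have hmin : Tendsto (fun k => ∫ x, min ‖f k x - f₀ x‖ (2 * g₀ x) ∂μ) atTop (𝓝 0) := by
    have := tendsto_integral_of_dominated_convergence (μ := μ) (f := fun _ => (0 : ℝ))
      (F := fun k x => min ‖f k x - f₀ x‖ (2 * g₀ x)) (fun x => 2 * g₀ x)
      (fun k => ((hfm k).sub hfm₀).norm.inf (hg₀.const_mul 2).aestronglyMeasurable)
      (hg₀.const_mul 2) ?_ ?_
    · simpa using this
    · intro k
      filter_upwards [hle₀] with x h2
      have h3 := (norm_nonneg _).trans h2
      rw [Real.norm_of_nonneg (le_min (norm_nonneg _) (by linarith))]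
      exact min_le_right _ _
    · filter_upwards [hf, hle₀] with x hx h2
      have h3 := (norm_nonneg _).trans h2
      have : Tendsto (fun k => min ‖f k x - f₀ x‖ (2 * g₀ x)) atTop
          (𝓝 (min ‖f₀ x - f₀ x‖ (2 * g₀ x))) :=
        (hx.sub tendsto_const_nhds).norm.min tendsto_const_nhds
      simpa [h3] using this
  rw [tendsto_iff_norm_sub_tendsto_zero]
  refine squeeze_zero (fun _ => norm_nonneg _) (fun k => ?_) (by simpa using hmin.add hneg)
  have hmi : Integrable (fun x => min ‖f k x - f₀ x‖ (2 * g₀ x)) μ :=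
    ((hfi k).sub hfi₀).norm.inf (hg₀.const_mul 2)
  have hpi : Integrable (fun x => max (g k x - g₀ x) 0) μ := ((hgi k).sub hg₀).pos_part
  rw [← integral_sub (hfi k) hfi₀, ← integral_add hmi hpi]
  refine (norm_integral_le_integral_norm _).trans
    (integral_mono_ae ((hfi k).sub hfi₀).norm (hmi.add hpi) ?_)
  filter_upwards [hfg k, hle₀] with x h1 h2
  have h4 : ‖f k x - f₀ x‖ ≤ g k x + g₀ x := (norm_sub_le _ _).trans (add_le_add h1 h2)
  change ‖f k x - f₀ x‖ ≤ min ‖f k x - f₀ x‖ (2 * g₀ x) + max (g k x - g₀ x) 0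
  rcases le_total ‖f k x - f₀ x‖ (2 * g₀ x) with h | h
  · rw [min_eq_left h]; linarith [le_max_right (g k x - g₀ x) 0]
  · rw [min_eq_right h]; linarith [le_max_left (g k x - g₀ x) 0]

/-- A sequence of bump functions whose supports shrink to the origin. -/
noncomputable def mollBump (n k : ℕ) : ContDiffBump (0 : Eucl n) where
  rIn := 1 / (k + 1) / 2
  rOut := 1 / (k + 1)
  rIn_pos := by positivity
  rIn_lt_rOut := half_lt_self (by positivity)

/-- The mollification of `f` at scale `1 / (k + 1)`. -/
noncomputable def moll {n : ℕ} {F : Type*} [NormedAddCommGroup F] [NormedSpace ℝ F] (k : ℕ)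
    (f : Eucl n → F) : Eucl n → F :=
  (mollBump n k).normed volume ⋆[ContinuousLinearMap.lsmul ℝ ℝ, volume] f

variable {n : ℕ} {F : Type*} [NormedAddCommGroup F] [NormedSpace ℝ F] [CompleteSpace F]
  {f g : Eucl n → F} {i : Fin n}

theorem tendsto_mollBump_rOut : Tendsto (fun k => (mollBump n k).rOut) atTop (𝓝 0) :=
  tendsto_one_div_add_atTop_nhds_zero_nat

theorem moll_apply (k : ℕ) (f : Eucl n → F) (x : Eucl n) :
    moll k f x = ∫ y, (mollBump n k).normed volume (x - y) • f y :=
  convolution_eq_swap _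

theorem continuous_mollBump (k : ℕ) : Continuous ((mollBump n k).normed volume) :=
  (mollBump n k).continuous_normed

theorem integrable_mollBump_smul (hf : LocallyIntegrable f) (k : ℕ) (x : Eucl n) :
    Integrable fun y => (mollBump n k).normed volume (x - y) • f y := by
  apply hf.integrable_smul_left_of_hasCompactSupport
  · exact (continuous_mollBump k).comp (continuous_const.sub continuous_id)
  · exact (mollBump n k).hasCompactSupport_normed.comp_homeomorph (Homeomorph.subLeft x)

theorem contDiff_moll (hf : LocallyIntegrable f) (k : ℕ) : ContDiff ℝ ∞ (moll k f) :=
  (mollBump n k).hasCompactSupport_normed.contDiff_convolution_left _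
    (mollBump n k).contDiff_normed hf

theorem ae_tendsto_moll (hf : LocallyIntegrable f) :
    ∀ᵐ x, Tendsto (fun k => moll k f x) atTop (𝓝 (f x)) :=
  ContDiffBump.ae_convolution_tendsto_right_of_locallyIntegrable (K := 2) tendsto_mollBump_rOut
    (Eventually.of_forall fun k => by simp only [mollBump]; linarith) hf

/-- The convergence is joint in the scale and the point, so that compactness can make it uniform in
`eventually_half_lt_norm_moll`. -/
theorem tendsto_moll_of_continuous (hf : Continuous f) (x : Eucl n) :
    Tendsto (fun z : ℕ × Eucl n => moll z.1 f z.2) (atTop ×ˢ 𝓝 x) (𝓝 (f x)) :=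
  ContDiffBump.convolution_tendsto_right (φ := fun z : ℕ × Eucl n => mollBump n z.1)
    (g := fun _ => f) (k := Prod.snd)
    (tendsto_mollBump_rOut.comp tendsto_fst) (Eventually.of_forall fun _ =>
      hf.aestronglyMeasurable) ((hf.tendsto x).comp tendsto_snd) tendsto_snd

theorem tendsto_moll_apply_of_continuous (hf : Continuous f) (x : Eucl n) :
    Tendsto (fun k => moll k f x) atTop (𝓝 (f x)) := by
  have h : Tendsto (fun k : ℕ => (k, x)) atTop (atTop ×ˢ 𝓝 x) :=
    tendsto_id.prodMk tendsto_const_nhds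
  have h' := (tendsto_moll_of_continuous hf x).comp h
  simpa only [Function.comp_def] using h'

theorem integral_mollBump (k : ℕ) (x : Eucl n) :
    ∫ y, (mollBump n k).normed volume (x - y) = 1 := by
  rw [integral_sub_left_eq_self (fun y => (mollBump n k).normed volume y)]
  exact (mollBump n k).integral_normed

/-- The derivative of a mollification is the mollification of the weak derivative. -/
theorem HasWeakPartial.fderiv_moll (h : HasWeakPartial univ i f g) (k : ℕ) (x : Eucl n) :
    fderiv ℝ (moll k f) x (stdVec i) = moll k g x := by
  have hf : LocallyIntegrable f := locallyIntegrableOn_univ.1 h.locallyIntegrableOn_left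
  set ρ := (mollBump n k).normed (volume : Measure (Eucl n)) with hρ
  have hρs : ContDiff ℝ ∞ ρ := (mollBump n k).contDiff_normed
  have hρc : HasCompactSupport ρ := (mollBump n k).hasCompactSupport_normed
  have hd := hρc.hasFDerivAt_convolution_left (ContinuousLinearMap.lsmul ℝ ℝ)
    (hρs.of_le (by simp)) hf x
  have htest : IsTestFunction univ fun y => ρ (x - y) :=
    ⟨hρs.comp (contDiff_const.sub contDiff_id), hρc.comp_homeomorph (Homeomorph.subLeft x),
      subset_univ _⟩
  have hder (y : Eucl n) : fderiv ℝ (fun y => ρ (x - y)) y (stdVec i) =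
      -fderiv ℝ ρ (x - y) (stdVec i) := by
    have h1 : HasFDerivAt (fun y => ρ (x - y))
        ((fderiv ℝ ρ (x - y)).comp (-ContinuousLinearMap.id ℝ (Eucl n))) y :=
      ((hρs.differentiable (by simp) (x - y)).hasFDerivAt).comp y
        ((hasFDerivAt_id y).const_sub x)
    rw [h1.fderiv]
    simp
  have h2 := h.integral_eq _ htest
  have hex := (hρc.fderiv (𝕜 := ℝ)).convolutionExists_left
    (ContinuousLinearMap.precompL (Eucl n) (ContinuousLinearMap.lsmul ℝ ℝ)) 
    (hρs.continuous_fderiv (by simp)) hf x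
  rw [moll, hd.fderiv, moll_apply, convolution_eq_swap,
    ContinuousLinearMap.integral_apply hex.integrable_swap]
  have h3 : ∫ y, (fderiv ℝ (fun y => ρ (x - y)) y) (stdVec i) • f y =
      -∫ y, ρ (x - y) • g y := by
    simpa only [setIntegral_univ] using h2
  simp only [hder, neg_smul, integral_neg, neg_inj] at h3
  exact h3

/-- Jensen's inequality for the probability density `ρ`: the variance of `‖f‖` about its mean `m` is
nonnegative. -/
theorem norm_moll_sq_le (hf : LocallyIntegrable f) (hf2 : LocallyIntegrable fun x => ‖f x‖ ^ 2)
    (k : ℕ) (x : Eucl n) : ‖moll k f x‖ ^ 2 ≤ moll k (fun y => ‖f y‖ ^ 2) x := by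
  set ρ := fun y => (mollBump n k).normed (volume : Measure (Eucl n)) (x - y) with hρ
  have hρ0 (y : Eucl n) : 0 ≤ ρ y := (mollBump n k).nonneg_normed _
  have i1 : Integrable fun y => ρ y * ‖f y‖ := 
    integrable_mollBump_smul (fun z => (hf z).norm) k x
  have i2 : Integrable fun y => ρ y * ‖f y‖ ^ 2 := integrable_mollBump_smul hf2 k x
  have i0 : Integrable ρ := by
    simpa using integrable_mollBump_smul (locallyIntegrable_const (1 : ℝ)) k x
  set m := ∫ y, ρ y * ‖f y‖ with hm
  have hle : ‖moll k f x‖ ≤ m := by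
    rw [moll_apply]
    refine (norm_integral_le_integral_norm _).trans_eq ?_
    congr 1 with y
    rw [norm_smul, Real.norm_of_nonneg (hρ0 y)]
  have hvar : 0 ≤ ∫ y, ρ y * (‖f y‖ - m) ^ 2 :=
    integral_nonneg fun y => mul_nonneg (hρ0 y) (sq_nonneg _)
  have e : ∫ y, ρ y * (‖f y‖ - m) ^ 2 = (∫ y, ρ y * ‖f y‖ ^ 2) - 2 * m * m + m ^ 2 := by
    have e1 : (fun y => ρ y * (‖f y‖ - m) ^ 2) =
        fun y => (ρ y * ‖f y‖ ^ 2 - 2 * m * (ρ y * ‖f y‖)) + m ^ 2 * ρ y := by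
      ext y; ring
    rw [e1, integral_add (f := fun y => ρ y * ‖f y‖ ^ 2 - 2 * m * (ρ y * ‖f y‖))
      (i2.sub (i1.const_mul _)) (i0.const_mul _),
      integral_sub i2 (i1.const_mul _), integral_const_mul, integral_const_mul,
      integral_mollBump, mul_one]
  rw [moll_apply k fun y => ‖f y‖ ^ 2]
  calc ‖moll k f x‖ ^ 2 ≤ m ^ 2 := by gcongr
    _ ≤ ∫ y, ρ y * ‖f y‖ ^ 2 := by rw [e] at hvar; linarith

theorem LocallyIntegrable.of_norm_sq (hf : AEStronglyMeasurable f)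
    (hf2 : LocallyIntegrable fun x => ‖f x‖ ^ 2) : LocallyIntegrable f := by
  refine (hf2.add (locallyIntegrable_const (1 : ℝ))).mono hf (Eventually.of_forall fun x => ?_)
  rw [Real.norm_of_nonneg (by simp only [Pi.add_apply]; positivity)]
  simp only [Pi.add_apply]
  nlinarith [sq_nonneg (‖f x‖ - 1)]

/-- Jensen's inequality for squares, applied first to `f` and then to `‖f‖ ^ 2`. -/
theorem norm_moll_pow_four_le (hf : AEStronglyMeasurable f)
    (hf4 : LocallyIntegrable fun x => ‖f x‖ ^ 4) (k : ℕ) (x : Eucl n) :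
    ‖moll k f x‖ ^ 4 ≤ moll k (fun y => ‖f y‖ ^ 4) x := by
  have e4 : (fun y => ‖‖f y‖ ^ 2‖ ^ 2) = fun y => ‖f y‖ ^ 4 := by
    ext y; rw [Real.norm_of_nonneg (by positivity)]; ring
  have hf2 : LocallyIntegrable fun x => ‖f x‖ ^ 2 :=
    LocallyIntegrable.of_norm_sq (hf.norm.pow 2) (by rwa [e4])
  have h1 := norm_moll_sq_le (LocallyIntegrable.of_norm_sq hf hf2) hf2 k x
  have h2 := norm_moll_sq_le hf2 (by rwa [e4]) k x
  rw [e4] at h2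
  calc ‖moll k f x‖ ^ 4 = (‖moll k f x‖ ^ 2) ^ 2 := by ring
    _ ≤ (moll k (fun y => ‖f y‖ ^ 2) x) ^ 2 := by gcongr
    _ = ‖moll k (fun y => ‖f y‖ ^ 2) x‖ ^ 2 := by rw [Real.norm_eq_abs, sq_abs]
    _ ≤ _ := h2

/-- Mollification is symmetric. -/
theorem integral_mul_moll {H χ : Eucl n → ℝ} (hH : LocallyIntegrable H) (hχ : Continuous χ)
    (hχc : HasCompactSupport χ) (k : ℕ) :
    ∫ x, χ x * moll k H x = ∫ y, H y * moll k χ y := by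
  set ρ := (mollBump n k).normed (volume : Measure (Eucl n)) with hρ
  have hρc : HasCompactSupport ρ := (mollBump n k).hasCompactSupport_normed
  have hρcont : Continuous ρ := continuous_mollBump k
  have hsymm (x y : Eucl n) : ρ (x - y) = ρ (y - x) := by
    rw [hρ, ← neg_sub, ContDiffBump.normed_neg]
  simp only [moll_apply, smul_eq_mul, ← integral_const_mul]
  set S := Metric.cthickening 1 (tsupport χ)
  have hS : IsCompact S := IsCompact.cthickening hχc
  have hzero (x y : Eucl n) (hy : y ∉ S) : χ x * ρ (x - y) = 0 := by
    by_contra hne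
    apply hy
    have hx : x ∈ tsupport χ := subset_closure (left_ne_zero_of_mul hne)
    have h1 : x - y ∈ Function.support ρ := right_ne_zero_of_mul hne
    rw [hρ, ContDiffBump.support_normed_eq, mem_ball_zero_iff] at h1
    refine Metric.mem_cthickening_of_dist_le y x 1 _ hx ?_
    rw [dist_comm, dist_eq_norm]
    refine h1.le.trans ?_
    simp only [mollBump]
    rw [div_le_one (by positivity)]
    have : (0 : ℝ) ≤ k := Nat.cast_nonneg k
    linarith
  have hHS : Integrable (S.indicator H) :=
    (integrable_indicator_iff hS.measurableSet).2 (hH.integrableOn_isCompact hS)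
  obtain ⟨M, hM⟩ := hρcont.bounded_above_of_compact_support hρc
  have hprod : Integrable (fun z : Eucl n × Eucl n => ρ (z.1 - z.2) * (χ z.1 * S.indicator H z.2))
      (volume.prod volume) :=
    ((hχ.integrable_of_hasCompactSupport hχc).mul_prod hHS).bdd_mul (c := M)
      (hρcont.comp (continuous_fst.sub continuous_snd)).aestronglyMeasurable
      (Eventually.of_forall fun z => hM _)
  have e (x y : Eucl n) : χ x * (ρ (x - y) * H y) =
      ρ (x - y) * (χ x * S.indicator H y) := by
    by_cases hy : y ∈ S
    · rw [indicator_of_mem hy]; ring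
    · rw [← mul_assoc, hzero x y hy, indicator_of_notMem hy]; ring
  change ∫ x, ∫ y, χ x * (ρ (x - y) * H y) = ∫ y, ∫ x, H y * (ρ (y - x) * χ x)
  simp only [e]
  rw [integral_integral_swap hprod]
  congr 1 with y
  congr 1 with x
  rw [← e, hsymm]
  ring

theorem moll_eq_zero {χ : Eucl n → ℝ} (k : ℕ) {y : Eucl n}
    (hy : y ∉ Metric.cthickening 1 (tsupport χ)) : moll k χ y = 0 := by
  rw [moll_apply]
  refine integral_eq_zero_of_ae (Eventually.of_forall fun x => ?_)
  by_contra hne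
  apply hy
  have hx : x ∈ tsupport χ := subset_closure (right_ne_zero_of_mul hne)
  have h1 : y - x ∈ Function.support ((mollBump n k).normed (volume : Measure (Eucl n))) :=
    left_ne_zero_of_mul hne
  rw [ContDiffBump.support_normed_eq, mem_ball_zero_iff] at h1
  refine Metric.mem_cthickening_of_dist_le y x 1 _ hx ?_
  rw [dist_eq_norm]
  refine h1.le.trans ?_
  simp only [mollBump]
  rw [div_le_one (by positivity)]
  have : (0 : ℝ) ≤ k := Nat.cast_nonneg k
  linarith

theorem norm_moll_le {χ : Eucl n → F} {M : ℝ} (hM : ∀ x, ‖χ x‖ ≤ M)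
    (k : ℕ) (x : Eucl n) : ‖moll k χ x‖ ≤ M := by
  rw [moll_apply]
  have i0 : Integrable fun y => (mollBump n k).normed volume (x - y) := by
    simpa using integrable_mollBump_smul (locallyIntegrable_const (1 : ℝ)) k x
  calc _ ≤ ∫ y, (mollBump n k).normed volume (x - y) * M := by
        refine norm_integral_le_of_norm_le (i0.mul_const M) (Eventually.of_forall fun y => ?_)
        rw [norm_smul, Real.norm_of_nonneg ((mollBump n k).nonneg_normed _)]
        exact mul_le_mul_of_nonneg_left (hM y) ((mollBump n k).nonneg_normed _)
    _ = M := by rw [integral_mul_const, integral_mollBump, one_mul]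

theorem tendsto_integral_mul_moll {H χ : Eucl n → ℝ} (hH : LocallyIntegrable H)
    (hχ : Continuous χ) (hχc : HasCompactSupport χ) :
    Tendsto (fun k => ∫ x, χ x * moll k H x) atTop (𝓝 (∫ x, χ x * H x)) := by
  simp only [integral_mul_moll hH hχ hχc]
  obtain ⟨M, hM⟩ := hχ.bounded_above_of_compact_support hχc
  set S := Metric.cthickening 1 (tsupport χ)
  have hS : IsCompact S := IsCompact.cthickening hχc
  have hHS : Integrable (S.indicator H) :=
    (integrable_indicator_iff hS.measurableSet).2 (hH.integrableOn_isCompact hS)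
  have : (fun x => χ x * H x) = fun x => H x * χ x := by ext; ring
  rw [this]
  refine tendsto_integral_of_dominated_convergence (fun y => ‖S.indicator H y‖ * M)
    (fun k => hH.aestronglyMeasurable.mul
      (contDiff_moll hχ.locallyIntegrable k).continuous.aestronglyMeasurable)
    (hHS.norm.mul_const M) (fun k => Eventually.of_forall fun y => ?_)
    (Eventually.of_forall fun y => ?_)
  · by_cases hy : y ∈ S
    · rw [indicator_of_mem hy, norm_mul]
      exact mul_le_mul_of_nonneg_left (norm_moll_le hM k y) (norm_nonneg _)
    · rw [moll_eq_zero k hy, indicator_of_notMem hy]; simp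
  · exact (tendsto_moll_apply_of_continuous hχ y).const_mul _

/-- The majorants depend on `k`, but their integrals converge because mollification can be moved
from `H`, which is only locally integrable, to the continuous `χ`. This handles products at the
critical integrability, where no fixed majorant is at hand. -/
theorem tendsto_integral_of_le_moll {h : ℕ → Eucl n → F} {h₀ : Eucl n → F} {H χ : Eucl n → ℝ}
    (hH : LocallyIntegrable H) (hχ : Continuous χ) (hχc : HasCompactSupport χ)
    (hm : ∀ k, AEStronglyMeasurable (h k))
    (hlim : ∀ᵐ x, Tendsto (fun k => h k x) atTop (𝓝 (h₀ x)))
    (hle : ∀ k, ∀ᵐ x, ‖h k x‖ ≤ χ x * (moll k H x + H x)) :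
    Tendsto (fun k => ∫ x, h k x) atTop (𝓝 (∫ x, h₀ x)) := by
  have i1 (k : ℕ) : Integrable fun x => χ x * moll k H x :=
    (hχ.mul (contDiff_moll hH k).continuous).integrable_of_hasCompactSupport hχc.mul_right
  have i2 : Integrable fun x => χ x * H x := hH.integrable_smul_left_of_hasCompactSupport hχ hχc
  refine tendsto_integral_of_varying_bound (g := fun k x => χ x * moll k H x + χ x * H x)
    (g₀ := fun x => χ x * H x + χ x * H x) hm (fun k => (i1 k).add i2) (i2.add i2) hlim ?_ ?_ ?_
  · filter_upwards [ae_tendsto_moll hH] with x hx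
    exact (hx.const_mul _).add_const _
  · have e (k : ℕ) : ∫ x, χ x * moll k H x + χ x * H x =
        (∫ x, χ x * moll k H x) + ∫ x, χ x * H x := integral_add (i1 k) i2
    simp only [e]
    rw [integral_add i2 i2]
    exact (tendsto_integral_mul_moll hH hχ hχc).add_const _
  · intro k
    filter_upwards [hle k] with x hx
    rwa [← mul_add]

end Mollification

/-! ### The product rule for weak derivatives, and sphere-valued maps -/

section ProductRule

open Filter Topology

variable {n m : ℕ} {i : Fin n}

/-- The majorant for the mollified product rule, in the shape that `tendsto_integral_of_le_moll`
needs. In the application `A` and `B` are the mollifications of `f` and `f'`, the `Mᵢ` are those of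
`f²`, `f'²`, `g²`, `g'²`, and `c`, `c'` are a test function and its derivative. -/
theorem abs_product_rule_le (c' c A B f f' g g' : ℝ) {M₁ M₂ M₃ M₄ : ℝ} (h₁ : A ^ 2 ≤ M₁)
    (h₂ : B ^ 2 ≤ M₂) (h₃ : 0 ≤ M₃) (h₄ : 0 ≤ M₄) :
    |(c' * A + c * B) * g + c * A * g'| ≤
      (|c'| + |c|) * (M₁ + M₂ + M₃ + M₄ + (f ^ 2 + f' ^ 2 + g ^ 2 + g' ^ 2)) := by
  have q (a b : ℝ) : |a * b| ≤ (a ^ 2 + b ^ 2) / 2 := by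
    rw [abs_le]; constructor <;> nlinarith [sq_nonneg (a + b), sq_nonneg (a - b)]
  have s1 := sq_nonneg f
  have s2 := sq_nonneg f'
  have s3 := sq_nonneg g
  have s4 := sq_nonneg g'
  have s5 := sq_nonneg A
  have s6 := sq_nonneg B
  calc |(c' * A + c * B) * g + c * A * g'|
      = |c' * (A * g) + c * (B * g + A * g')| := by ring_nf
    _ ≤ |c'| * |A * g| + |c| * |B * g + A * g'| := by
        refine (abs_add_le _ _).trans_eq ?_
        rw [abs_mul c', abs_mul c]
    _ ≤ |c'| * (M₁ + M₂ + M₃ + M₄ + (f ^ 2 + f' ^ 2 + g ^ 2 + g' ^ 2)) +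
        |c| * (M₁ + M₂ + M₃ + M₄ + (f ^ 2 + f' ^ 2 + g ^ 2 + g' ^ 2)) := by
        refine add_le_add (mul_le_mul_of_nonneg_left ?_ (abs_nonneg _))
          (mul_le_mul_of_nonneg_left ?_ (abs_nonneg _))
        · linarith [q A g]
        · linarith [q B g, q A g', abs_add_le (B * g) (A * g')]
    _ = _ := by ring

set_option maxHeartbeats 400000 in
/-- The product rule for weak derivatives of locally square integrable functions. -/
theorem HasWeakPartial.mul {f f' g g' : Eucl n → ℝ} (hf : HasWeakPartial univ i f f')
    (hg : HasWeakPartial univ i g g') (hf2 : LocallyIntegrable fun x => f x ^ 2)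
    (hf2' : LocallyIntegrable fun x => f' x ^ 2) (hg2 : LocallyIntegrable fun x => g x ^ 2)
    (hg2' : LocallyIntegrable fun x => g' x ^ 2) :
    HasWeakPartial univ i (fun x => f x * g x) (fun x => f' x * g x + f x * g' x) := by
  have lf : LocallyIntegrable f := locallyIntegrableOn_univ.1 hf.locallyIntegrableOn_left
  have lf' : LocallyIntegrable f' := locallyIntegrableOn_univ.1 hf.locallyIntegrableOn_right
  have lg : LocallyIntegrable g := locallyIntegrableOn_univ.1 hg.locallyIntegrableOn_left
  have lg' : LocallyIntegrable g' := locallyIntegrableOn_univ.1 hg.locallyIntegrableOn_right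
  have hmul {a b : Eucl n → ℝ} (ha : LocallyIntegrable a) (hb : LocallyIntegrable b)
      (ha2 : LocallyIntegrable fun x => a x ^ 2) (hb2 : LocallyIntegrable fun x => b x ^ 2) :
      LocallyIntegrable fun x => a x * b x := by
    refine (ha2.add hb2).mono (ha.aestronglyMeasurable.mul hb.aestronglyMeasurable)
      (Eventually.of_forall fun x => ?_)
    change ‖a x * b x‖ ≤ ‖a x ^ 2 + b x ^ 2‖
    rw [Real.norm_of_nonneg (by positivity : 0 ≤ a x ^ 2 + b x ^ 2), Real.norm_eq_abs, abs_mul]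
    nlinarith [sq_nonneg (|a x| - |b x|), sq_abs (a x), sq_abs (b x)]
  have lfg := hmul lf lg hf2 hg2
  have lfg1 := hmul lf' lg hf2' hg2
  have lfg2 := hmul lf lg' hf2 hg2'
  refine ⟨lfg.locallyIntegrableOn _, (lfg1.add lfg2).locallyIntegrableOn _, fun η hη => ?_⟩
  simp only [setIntegral_univ, smul_eq_mul]
  set η' : Eucl n → ℝ := fun x => fderiv ℝ η x (stdVec i)
  have hη' : IsTestFunction univ η' := hη.fderiv_apply _
  -- Only `f` is mollified. Then `η * moll k f` is itself a test function for the weak derivative of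
  -- `g`, so the integral of `h k` is exactly zero.
  set h : ℕ → Eucl n → ℝ := fun k x =>
    (η' x * moll k f x + η x * moll k f' x) * g x + η x * moll k f x * g' x
  have hk (k : ℕ) : ∫ x, h k x = 0 := by
    have ht : IsTestFunction univ fun x => η x * moll k f x := hη.mul_contDiff (contDiff_moll lf k)
    have hd (x : Eucl n) : fderiv ℝ (fun x => η x * moll k f x) x (stdVec i) =
        η' x * moll k f x + η x * moll k f' x := by
      rw [fderiv_fun_mul (hη.differentiable x)
        ((contDiff_moll lf k).differentiable (by simp) x)]
      simp only [add_apply, smul_apply, smul_eq_mul, hf.fderiv_moll]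
      ring
    have h1 := hg.integral_eq _ ht
    have i1 := hg.integrableOn_left ht (stdVec i)
    have i2 := hg.integrableOn_right ht
    simp only [hd, smul_eq_mul, setIntegral_univ, integrableOn_univ] at h1 i1 i2
    rw [integral_add i1 i2, h1, neg_add_cancel]
  have hlim : Tendsto (fun k => ∫ x, h k x) atTop
      (𝓝 (∫ x, (η' x * f x + η x * f' x) * g x + η x * f x * g' x)) := by
    refine tendsto_integral_of_le_moll (H := fun x => f x ^ 2 + f' x ^ 2 + g x ^ 2 + g' x ^ 2)
      (χ := fun x => |η' x| + |η x|) (((hf2.add hf2').add hg2).add hg2')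
      (hη'.continuous.abs.add hη.continuous.abs)
      ((hη'.hasCompactSupport.comp_left abs_zero).add (hη.hasCompactSupport.comp_left abs_zero))
      (fun k => ?_) ?_ (fun k => Eventually.of_forall fun x => ?_)
    · have c1 := (contDiff_moll lf k).continuous.aestronglyMeasurable (μ := volume)
      have c2 := (contDiff_moll lf' k).continuous.aestronglyMeasurable (μ := volume)
      have c3 := hη.continuous.aestronglyMeasurable (μ := volume)
      have c4 := hη'.continuous.aestronglyMeasurable (μ := volume)
      exact (((c4.mul c1).add (c3.mul c2)).mul lg.aestronglyMeasurable).add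
        ((c3.mul c1).mul lg'.aestronglyMeasurable)
    · filter_upwards [ae_tendsto_moll lf, ae_tendsto_moll lf'] with x h1 h2
      exact (((h1.const_mul _).add (h2.const_mul _)).mul_const _).add
        ((h1.const_mul _).mul_const _)
    · have lsum : moll k (fun x => f x ^ 2 + f' x ^ 2 + g x ^ 2 + g' x ^ 2) x =
          moll k (fun x => f x ^ 2) x + moll k (fun x => f' x ^ 2) x +
          moll k (fun x => g x ^ 2) x + moll k (fun x => g' x ^ 2) x := by
        have j1 := integrable_mollBump_smul hf2 k x
        have j2 := integrable_mollBump_smul hf2' k x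
        have j3 := integrable_mollBump_smul hg2 k x
        have j4 := integrable_mollBump_smul hg2' k x
        simp only [moll_apply, smul_add]
        have a1 := integral_add j1 j2
        have a2 := integral_add (j1.add j2) j3
        have a3 := integral_add ((j1.add j2).add j3) j4
        simp only [Pi.add_apply] at a1 a2 a3
        rw [a3, a2, a1]
      have p1 := norm_moll_sq_le lf (by simpa using hf2) k x
      have p2 := norm_moll_sq_le lf' (by simpa using hf2') k x
      have p3 : 0 ≤ moll k (fun x => g x ^ 2) x := by
        rw [moll_apply]
        exact integral_nonneg fun y => mul_nonneg ((mollBump n k).nonneg_normed _) (sq_nonneg _)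
      have p4 : 0 ≤ moll k (fun x => g' x ^ 2) x := by
        rw [moll_apply]
        exact integral_nonneg fun y => mul_nonneg ((mollBump n k).nonneg_normed _) (sq_nonneg _)
      simp only [Real.norm_eq_abs, sq_abs] at p1 p2
      rw [lsum, Real.norm_eq_abs]
      exact abs_product_rule_le _ _ _ _ _ _ _ _ p1 p2 p3 p4
  simp only [hk] at hlim
  have h0 := tendsto_nhds_unique hlim tendsto_const_nhds
  have j1 : Integrable fun x => η' x * (f x * g x) :=
    lfg.integrable_smul_left_of_hasCompactSupport hη'.continuous hη'.hasCompactSupport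
  have j2 : Integrable fun x => η x * (f' x * g x + f x * g' x) :=
    (lfg1.add lfg2).integrable_smul_left_of_hasCompactSupport hη.continuous hη.hasCompactSupport
  rw [← add_eq_zero_iff_eq_neg, ← integral_add j1 j2, ← h0]
  congr 1 with x
  ring

theorem HasWeakPartial.sum {ι F : Type*} [NormedAddCommGroup F] [NormedSpace ℝ F]
    {Ω : Set (Eucl n)} (s : Finset ι) {f g : ι → Eucl n → F}
    (h : ∀ a ∈ s, HasWeakPartial Ω i (f a) (g a)) :
    HasWeakPartial Ω i (fun x => ∑ a ∈ s, f a x) (fun x => ∑ a ∈ s, g a x) := by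
  classical
  induction s using Finset.induction_on with
  | empty => simpa using hasWeakPartial_const (0 : F) Ω i
  | insert a s ha ih =>
    simp only [Finset.sum_insert ha]
    exact (h a (Finset.mem_insert_self a s)).add
      (ih fun b hb => h b (Finset.mem_insert_of_mem hb))

/-- `f` is locally square integrable. -/
def LocSqIntegrable (f : Eucl n → Eucl m) : Prop :=
  AEStronglyMeasurable f ∧ LocallyIntegrable fun x => ‖f x‖ ^ 2

theorem LocSqIntegrable.coord {f : Eucl n → Eucl m} (hf : LocSqIntegrable f) (a : Fin m) :
    LocallyIntegrable fun x => f x a ^ 2 := by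
  have hm : AEStronglyMeasurable fun x => f x a :=
    (EuclideanSpace.proj (𝕜 := ℝ) a).continuous.comp_aestronglyMeasurable hf.1
  refine hf.2.mono (hm.pow 2) (Eventually.of_forall fun x => ?_)
  rw [norm_pow, norm_pow, norm_norm]
  gcongr
  exact PiLp.norm_apply_le _ _

theorem HasWeakPartial.inner {f f' g g' : Eucl n → Eucl m} (hf : HasWeakPartial univ i f f')
    (hg : HasWeakPartial univ i g g') (hf2 : LocSqIntegrable f) (hf2' : LocSqIntegrable f')
    (hg2 : LocSqIntegrable g) (hg2' : LocSqIntegrable g') :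
    HasWeakPartial univ i (fun x => inner ℝ (f x) (g x))
      (fun x => inner ℝ (f' x) (g x) + inner ℝ (f x) (g' x)) := by
  have h := HasWeakPartial.sum Finset.univ fun a (_ : a ∈ Finset.univ) =>
    (hf.clm_comp (EuclideanSpace.proj (𝕜 := ℝ) a)).mul
    (hg.clm_comp (EuclideanSpace.proj (𝕜 := ℝ) a)) (hf2.coord a) (hf2'.coord a) (hg2.coord a)
    (hg2'.coord a)
  convert! h using 2
  · simp [PiLp.inner_apply, mul_comm]
  · simp [PiLp.inner_apply, mul_comm, Finset.sum_add_distrib]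

/-- A map to the unit sphere satisfies `|∇u|² = -⟨u, Δu⟩`. -/
theorem norm_sq_gradient_eq_of_norm_eq_one {u : Eucl n → Eucl m} {G K : Fin n → Eucl n → Eucl m}
    (hu : ∀ᵐ x, ‖u x‖ = 1) (hG : ∀ i, HasWeakPartial univ i u (G i))
    (hK : ∀ i, HasWeakPartial univ i (G i) (K i)) (hu2 : LocSqIntegrable u)
    (hG2 : ∀ i, LocSqIntegrable (G i)) (hK2 : ∀ i, LocSqIntegrable (K i)) :
    ∀ᵐ x, ∑ i, ‖G i x‖ ^ 2 = -inner ℝ (u x) (∑ i, K i x) := by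
  -- The derivative of `⟨u, u⟩ = 1` gives `⟨u, Gᵢ⟩ = 0`, and the derivative of that gives the claim.
  -- Both times the product rule is compared with the derivative of a constant.
  have key (i : Fin n) : ∀ᵐ x, ‖G i x‖ ^ 2 = -inner ℝ (u x) (K i x) := by
    have h1 := (hG i).inner (hG i) hu2 (hG2 i) hu2 (hG2 i)
    have e1 : (fun x => inner ℝ (u x) (u x)) =ᵐ[volume.restrict univ] fun _ => (1 : ℝ) := by
      rw [Measure.restrict_univ]
      filter_upwards [hu] with x hx
      rw [real_inner_self_eq_norm_sq, hx, one_pow]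
    have h2 := (h1.congr e1 (ae_eq_refl _)).ae_eq isOpen_univ (hasWeakPartial_const 1 univ i)
    have h3 := (hG i).inner (hK i) hu2 (hG2 i) (hG2 i) (hK2 i)
    have e2 : (fun x => inner ℝ (u x) (G i x)) =ᵐ[volume.restrict univ] fun _ => (0 : ℝ) := by
      filter_upwards [h2] with x hx
      rw [real_inner_comm] at hx
      linarith
    have h4 := (h3.congr e2 (ae_eq_refl _)).ae_eq isOpen_univ (hasWeakPartial_const 0 univ i)
    rw [Measure.restrict_univ] at h4
    filter_upwards [h4] with x hx
    rw [real_inner_self_eq_norm_sq] at hx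
    linarith
  filter_upwards [ae_all_iff.2 key] with x hx
  simp only [hx, inner_sum, Finset.sum_neg_distrib]

end ProductRule

/-! ### Determinants and the divergence of the current of a smooth map -/

section Determinant

variable {n : ℕ}

/-- The determinant of `n` vectors of `ℝⁿ`. -/
noncomputable def detForm (n : ℕ) : Eucl n [⋀^Fin n]→ₗ[ℝ] ℝ :=
  (EuclideanSpace.basisFun (Fin n) ℝ).toBasis.det

theorem detForm_eq_det (v : Fin n → Eucl n) :
    detForm n v = Matrix.det (Matrix.of fun i j => v j i) := by
  rw [detForm, Module.Basis.det_apply]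
  congr 1

/-- Hadamard's inequality. -/
theorem abs_detForm_le (v : Fin n → Eucl n) : |detForm n v| ≤ ∏ i, ‖v i‖ := by
  have : Fact (Module.finrank ℝ (Eucl n) = n) := ⟨by simp⟩
  set b := EuclideanSpace.basisFun (Fin n) ℝ
  have h := b.toBasis.orientation.abs_volumeForm_apply_le v
  rwa [b.toBasis.orientation.volumeForm_robust b rfl] at h

/-- The determinant as a continuous multilinear map. -/
noncomputable def detMap (n : ℕ) : ContinuousMultilinearMap ℝ (fun _ : Fin n => Eucl n) ℝ :=
  (detForm n).toMultilinearMap.mkContinuous 1 fun v => by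
    rw [one_mul]; exact abs_detForm_le v

theorem detMap_apply (v : Fin n → Eucl n) : detMap n v = detForm n v := rfl

/-- Cramer's rule. -/
theorem sum_detForm_update_smul (v : Fin n → Eucl n) (w : Eucl n) :
    ∑ j, detForm n (Function.update v j w) • v j = detForm n v • w := by
  have h := Matrix.mulVec_cramer (Matrix.of fun i j => v j i) (fun i => w i)
  ext i
  have hi := congr_fun h i
  have e (j : Fin n) : detForm n (Function.update v j w) =
      (Matrix.of fun i j => v j i).cramer (fun i => w i) j := by
    rw [Matrix.cramer_apply, detForm_eq_det]
    congr 1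
    ext a b
    rw [Matrix.updateCol_apply, Matrix.of_apply]
    by_cases hb : b = j
    · subst hb; simp
    · simp [hb]
  simp only [Matrix.mulVec, dotProduct, Matrix.of_apply, Pi.smul_apply, smul_eq_mul] at hi
  simp only [e, detForm_eq_det v, PiLp.smul_apply, smul_eq_mul, WithLp.ofLp_sum,
    WithLp.ofLp_smul, Finset.sum_apply, Pi.smul_apply]
  rw [← hi]
  exact Finset.sum_congr rfl fun j _ => mul_comm _ _

/-- The antisymmetry behind the Piola identity. -/
theorem sum_sum_detForm_update_update (v : Fin n → Eucl n) (w : Eucl n)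
    (s : Fin n → Fin n → Eucl n) (hs : ∀ j k, s j k = s k j) :
    ∑ j, ∑ k ∈ Finset.univ.erase j,
      detForm n (Function.update (Function.update v j w) k (s j k)) = 0 := by
  set A : Fin n → Fin n → ℝ := fun j k =>
    if k = j then 0 else detForm n (Function.update (Function.update v j w) k (s j k)) with hA
  -- Exchanging the slots `j` and `k` carries one family of vectors to the other, because `s` is
  -- symmetric.
  have hAs (j k : Fin n) : A j k = -A k j := by
    by_cases hjk : k = j
    · simp [hA, hjk]
    · have hkj : ¬ j = k := fun h => hjk h.symm
      simp only [hA, if_neg hjk, if_neg hkj]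
      have h := (detForm n).map_swap (Function.update (Function.update v k w) j (s k j)) hkj
      rw [← h]
      congr 1
      ext a : 1
      by_cases ha : a = j
      · subst ha; simp [Function.update_of_ne hjk, Function.update_of_ne hkj]
      · by_cases hb : a = k
        · subst hb; simp [hs]
        · simp [Function.update_of_ne, ha, hb, Equiv.swap_apply_of_ne_of_ne]
  have e (j : Fin n) : ∑ k ∈ Finset.univ.erase j,
      detForm n (Function.update (Function.update v j w) k (s j k)) = ∑ k, A j k := by
    rw [← Finset.add_sum_erase _ _ (Finset.mem_univ j)]
    have : A j j = 0 := by simp [hA]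
    rw [this, zero_add]
    refine Finset.sum_congr rfl fun k hk => ?_
    simp [hA, (Finset.mem_erase.1 hk).1]
  simp only [e]
  have h1 : ∑ j, ∑ k, A j k = -∑ j, ∑ k, A j k := by
    conv_lhs => rw [Finset.sum_comm]
    simp only [← Finset.sum_neg_distrib]
    exact Finset.sum_congr rfl fun j _ => Finset.sum_congr rfl fun k _ => hAs _ _
  linarith

/-- The components of the vector field dual to the pull-back of the volume form of the sphere. -/
noncomputable def current (u : Eucl n → Eucl n) (G : Fin n → Eucl n → Eucl n) (j : Fin n)
    (x : Eucl n) : ℝ :=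
  detForm n (Function.update (fun i => G i x) j (u x))

theorem fderiv_fderiv_apply_comm {U : Eucl n → Eucl n} (hU : ContDiff ℝ ∞ U) (x v w : Eucl n) :
    fderiv ℝ (fun y => fderiv ℝ U y v) x w = fderiv ℝ (fun y => fderiv ℝ U y w) x v := by
  have hd : DifferentiableAt ℝ (fderiv ℝ U) x :=
    (hU.fderiv_right (m := ∞) (by simp)).differentiable (by simp) x
  have e (a b : Eucl n) : fderiv ℝ (fun y => fderiv ℝ U y a) x b =
      fderiv ℝ (fderiv ℝ U) x b a := by
    rw [fderiv_clm_apply hd (differentiableAt_const a)]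
    simp
  rw [e, e]
  have hsymm : IsSymmSndFDerivAt ℝ U x :=
    hU.contDiffAt.isSymmSndFDerivAt (by simp; exact WithTop.coe_le_coe.2 (le_top : (2 : ℕ∞) ≤ ⊤))
  exact hsymm w v

theorem contDiff_current {U : Eucl n → Eucl n} (hU : ContDiff ℝ ∞ U) (j : Fin n) :
    ContDiff ℝ ∞ (current U (fun i x => fderiv ℝ U x (stdVec i)) j) := by
  have : ContDiff ℝ ∞ fun x : Eucl n =>
      Function.update (fun i => fderiv ℝ U x (stdVec i)) j (U x) := by
    rw [contDiff_pi]
    intro k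
    by_cases hk : k = j
    · subst hk; simpa using hU
    · simpa [Function.update_of_ne hk] using hU.fderiv_apply_const (stdVec k)
  exact (detMap n).contDiff.comp this

/-- The divergence of the current of a smooth map is a multiple of its Jacobian. -/
theorem sum_fderiv_current {U : Eucl n → Eucl n} (hU : ContDiff ℝ ∞ U) (x : Eucl n) :
    ∑ j, fderiv ℝ (current U (fun i x => fderiv ℝ U x (stdVec i)) j) x (stdVec j) =
      n * detForm n (fun i => fderiv ℝ U x (stdVec i)) := by
  set v : Fin n → Eucl n := fun i => fderiv ℝ U x (stdVec i)
  -- Leibniz rule over the slots. Differentiating slot `j` puts `∂ⱼU` back in its place and gives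
  -- the Jacobian, once for each `j`; the other slots give mixed second derivatives, which cancel in
  -- pairs.
  have hd (j : Fin n) : fderiv ℝ (current U (fun i x => fderiv ℝ U x (stdVec i)) j) x (stdVec j) =
      detForm n v + ∑ k ∈ Finset.univ.erase j, detForm n (Function.update
        (Function.update v j (U x)) k (fderiv ℝ (fun y => fderiv ℝ U y (stdVec k)) x
          (stdVec j))) := by
    have hg (k : Fin n) : HasFDerivAt
        (fun y => Function.update (fun i => fderiv ℝ U y (stdVec i)) j (U y) k)
        (if k = j then fderiv ℝ U x else fderiv ℝ (fun y => fderiv ℝ U y (stdVec k)) x) x := by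
      by_cases hk : k = j
      · subst hk
        simpa using (hU.differentiable (by simp) x).hasFDerivAt
      · simpa [Function.update_of_ne hk, hk] using
          ((hU.fderiv_apply_const (stdVec k)).differentiable (by simp) x).hasFDerivAt
    have h := HasFDerivAt.multilinear_comp (f := detMap n) hg
    have h' : HasFDerivAt (current U (fun i x => fderiv ℝ U x (stdVec i)) j) _ x := h
    rw [h'.fderiv, sum_apply, ← Finset.add_sum_erase _ _ (Finset.mem_univ j)]
    congr 1
    · simp only [ContinuousLinearMap.comp_apply, if_true,
        ContinuousMultilinearMap.toContinuousLinearMap_apply, detMap_apply]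
      congr 1
      ext a : 1
      by_cases ha : a = j
      · subst ha; simp [v]
      · simp [Function.update_of_ne ha, v]
    · refine Finset.sum_congr rfl fun k hk => ?_
      rw [if_neg (Finset.mem_erase.1 hk).1]
      rfl
  simp only [hd, Finset.sum_add_distrib]
  rw [sum_sum_detForm_update_update v (U x)
    (fun j k => fderiv ℝ (fun y => fderiv ℝ U y (stdVec k)) x (stdVec j))
    fun j k => fderiv_fderiv_apply_comm hU x _ _]
  simp

end Determinant

/-! ### The current of a continuous sphere-valued map is divergence free -/

section ClosedCurrent

open Filter Topology

variable {n : ℕ}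

/-- A bump function used to cut off a neighbourhood of the origin. -/
noncomputable def originBump (n : ℕ) : ContDiffBump (0 : Eucl n) where
  rIn := 1 / 4
  rOut := 1 / 2
  rIn_pos := by norm_num
  rIn_lt_rOut := by norm_num

/-- A smooth function which is equal to `|y|⁻ⁿ` for `|y| > 1 / 2`. -/
noncomputable def negPowCutoff (n : ℕ) (y : Eucl n) : ℝ :=
  (1 - originBump n y) * (‖y‖ ^ n)⁻¹

theorem contDiff_negPowCutoff : ContDiff ℝ ∞ (negPowCutoff n) := by
  rw [contDiff_iff_contDiffAt]
  intro y
  by_cases hy : y = 0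
  · subst hy
    have : negPowCutoff n =ᶠ[𝓝 0] fun _ => 0 := by
      filter_upwards [(originBump n).eventuallyEq_one] with z hz
      simp [negPowCutoff, hz]
    exact contDiffAt_const.congr_of_eventuallyEq this
  · exact (contDiffAt_const.sub (originBump n).contDiffAt).mul
      (((contDiffAt_norm ℝ hy).pow n).inv (pow_ne_zero _ (norm_ne_zero_iff.2 hy)))

theorem negPowCutoff_eq {y : Eucl n} (hy : 1 / 2 < ‖y‖) : negPowCutoff n y = (‖y‖ ^ n)⁻¹ := by
  rw [negPowCutoff, (originBump n).zero_of_le_dist (by simpa [originBump] using hy.le)]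
  ring

theorem abs_negPowCutoff_le (y : Eucl n) : |negPowCutoff n y| ≤ 4 ^ n := by
  by_cases hy : ‖y‖ ≤ 1 / 4
  · have h1 : originBump n y = 1 :=
      (originBump n).one_of_mem_closedBall (by simpa [originBump] using hy)
    rw [negPowCutoff, h1]
    simp
  · have h0 := (originBump n).nonneg (x := y)
    have h1 := (originBump n).le_one (x := y)
    push Not at hy
    have hpos : 0 < ‖y‖ := lt_trans (by norm_num) hy
    rw [negPowCutoff, abs_mul, abs_of_nonneg (by linarith), abs_of_nonneg (by positivity)]
    have h2 : (‖y‖ ^ n)⁻¹ ≤ 4 ^ n := by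
      rw [← inv_pow]
      gcongr
      rw [inv_le_comm₀ hpos (by norm_num)]
      linarith
    calc _ ≤ 1 * (‖y‖ ^ n)⁻¹ := by gcongr; linarith
      _ ≤ 4 ^ n := by linarith

/-- Euler's identity for degree `-n`. The factor `-n` is made to cancel the factor `n` in
`sum_fderiv_current`. -/
theorem fderiv_negPowCutoff_self {y : Eucl n} (hy : 1 / 2 < ‖y‖) :
    fderiv ℝ (negPowCutoff n) y y = -n * negPowCutoff n y := by
  have hpos : 0 < ‖y‖ := lt_trans (by norm_num) hy
  have h1 : HasDerivAt (fun s : ℝ => negPowCutoff n (s • y)) (fderiv ℝ (negPowCutoff n) y y) 1 := by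
    have hd : HasFDerivAt (negPowCutoff n) (fderiv ℝ (negPowCutoff n) y) ((1 : ℝ) • y) := by
      rw [one_smul]
      exact (contDiff_negPowCutoff.differentiable (by simp) y).hasFDerivAt
    have hs : HasDerivAt (fun s : ℝ => s • y) y 1 := by
      simpa using (hasDerivAt_id (1 : ℝ)).smul_const y
    exact hd.comp_hasDerivAt (1 : ℝ) hs
  have h2 : HasDerivAt (fun s : ℝ => (s ^ n)⁻¹ * negPowCutoff n y) (-n * negPowCutoff n y) 1 := by
    have := ((hasDerivAt_pow n (1 : ℝ)).inv (by simp)).mul_const (negPowCutoff n y)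
    simpa using this
  refine h1.unique (h2.congr_of_eventuallyEq ?_)
  have hc : ContinuousAt (fun s : ℝ => ‖s • y‖) 1 := by fun_prop
  have hc' : ∀ᶠ s : ℝ in 𝓝 1, 1 / 2 < ‖s • y‖ :=
    hc.eventually (lt_mem_nhds (by simpa using hy))
  filter_upwards [hc', lt_mem_nhds (zero_lt_one' ℝ)] with s hs hs0
  rw [negPowCutoff_eq hs, negPowCutoff_eq hy, norm_smul, mul_pow, mul_inv,
    Real.norm_of_nonneg hs0.le]

/-- The pull-back of the volume form of the sphere by the radial projection is closed. -/
theorem sum_fderiv_negPowCutoff_mul_current {U : Eucl n → Eucl n} (hU : ContDiff ℝ ∞ U)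
    {x : Eucl n} (hx : 1 / 2 < ‖U x‖) :
    ∑ j, fderiv ℝ (fun y => negPowCutoff n (U y) *
      current U (fun i x => fderiv ℝ U x (stdVec i)) j y) x (stdVec j) = 0 := by
  have hh : DifferentiableAt ℝ (negPowCutoff n) (U x) :=
    contDiff_negPowCutoff.differentiable (by simp) _
  have hUx : DifferentiableAt ℝ U x := hU.differentiable (by simp) x
  have hd (j : Fin n) : fderiv ℝ (fun y => negPowCutoff n (U y) *
      current U (fun i x => fderiv ℝ U x (stdVec i)) j y) x (stdVec j) =
      negPowCutoff n (U x) *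
        fderiv ℝ (current U (fun i x => fderiv ℝ U x (stdVec i)) j) x (stdVec j) +
      fderiv ℝ (negPowCutoff n) (U x)
        (current U (fun i x => fderiv ℝ U x (stdVec i)) j x • fderiv ℝ U x (stdVec j)) := by
    have h1 := (hh.hasFDerivAt.comp x hUx.hasFDerivAt).mul
      ((contDiff_current hU j).differentiable (by simp) x).hasFDerivAt
    have h2 : HasFDerivAt (fun y => negPowCutoff n (U y) *
      current U (fun i x => fderiv ℝ U x (stdVec i)) j y) _ x := h1
    rw [h2.fderiv]
    simp
  simp only [hd, Finset.sum_add_distrib, ← Finset.mul_sum, ← map_sum]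
  -- By Cramer's rule the sum of the `∂ⱼU`, weighted with the components of the current, is the
  -- Jacobian times `U`. The gradient of the weight is thus needed in the radial direction only.
  have hc : ∑ j, current U (fun i x => fderiv ℝ U x (stdVec i)) j x • fderiv ℝ U x (stdVec j) =
      detForm n (fun i => fderiv ℝ U x (stdVec i)) • U x :=
    sum_detForm_update_smul (fun i => fderiv ℝ U x (stdVec i)) (U x)
  rw [hc, sum_fderiv_current hU, map_smul, smul_eq_mul, fderiv_negPowCutoff_self hx]
  ring

theorem sum_integral_smooth_current {U : Eucl n → Eucl n} (hU : ContDiff ℝ ∞ U) {η : Eucl n → ℝ}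
    (hη : IsTestFunction univ η) (hx : ∀ x ∈ tsupport η, 1 / 2 < ‖U x‖) :
    ∑ j, ∫ x, fderiv ℝ η x (stdVec j) * (negPowCutoff n (U x) *
      current U (fun i x => fderiv ℝ U x (stdVec i)) j x) = 0 := by
  set V : Fin n → Eucl n → ℝ := fun j x => negPowCutoff n (U x) *
      current U (fun i x => fderiv ℝ U x (stdVec i)) j x with hV
  have hVs (j : Fin n) : ContDiff ℝ ∞ (V j) :=
    (contDiff_negPowCutoff.comp hU).mul (contDiff_current hU j)
  have h1 (j : Fin n) : ∫ x, fderiv ℝ η x (stdVec j) * V j x =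
      -∫ x, η x * fderiv ℝ (V j) x (stdVec j) := by
    have := (((hVs j).of_le (by simp)).hasWeakPartial univ j).integral_eq η hη
    simpa only [setIntegral_univ, smul_eq_mul] using this
  have hi (j : Fin n) : Integrable fun x => η x * fderiv ℝ (V j) x (stdVec j) :=
    (hη.continuous.mul ((hVs j).fderiv_apply_const _).continuous).integrable_of_hasCompactSupport
      hη.hasCompactSupport.mul_right
  change ∑ j, ∫ x, fderiv ℝ η x (stdVec j) * V j x = 0
  simp only [h1, Finset.sum_neg_distrib]
  rw [← integral_finsetSum _ fun j _ => hi j, neg_eq_zero]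
  refine integral_eq_zero_of_ae (Eventually.of_forall fun x => ?_)
  change ∑ j, η x * fderiv ℝ (V j) x (stdVec j) = 0
  rw [← Finset.mul_sum]
  by_cases hxs : x ∈ tsupport η
  · rw [hV, sum_fderiv_negPowCutoff_mul_current hU (hx x hxs), mul_zero]
  · rw [image_eq_zero_of_notMem_tsupport hxs, zero_mul]

theorem abs_current_le (u : Eucl n → Eucl n) (G : Fin n → Eucl n → Eucl n) (j : Fin n)
    (x : Eucl n) : |current u G j x| ≤ ‖u x‖ * ∏ i ∈ Finset.univ.erase j, ‖G i x‖ := by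
  refine (abs_detForm_le _).trans_eq ?_
  rw [← Finset.mul_prod_erase _ _ (Finset.mem_univ j)]
  congr 1
  · simp
  · refine Finset.prod_congr rfl fun i hi => ?_
    rw [Function.update_of_ne (Finset.mem_erase.1 hi).1]

theorem prod_le_sum_pow {ι : Type*} (s t : Finset ι) (hst : s ⊆ t) (hs : s.Nonempty) (a : ι → ℝ)
    (ha : ∀ i, 0 ≤ a i) : ∏ i ∈ s, a i ≤ ∑ i ∈ t, a i ^ s.card := by
  obtain ⟨i₀, hi₀, hmax⟩ := s.exists_max_image a hs
  calc ∏ i ∈ s, a i ≤ ∏ _i ∈ s, a i₀ := Finset.prod_le_prod (fun i _ => ha i) hmax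
    _ = a i₀ ^ s.card := by simp
    _ ≤ _ := Finset.single_le_sum (f := fun i => a i ^ s.card)
      (fun i _ => pow_nonneg (ha i) _) (hst hi₀)

/-- Hadamard's inequality leaves the four gradient factors outside slot `j`, and their product is at
most the fourth power of the largest. The exponent four is the one that the Hessian energy controls.
-/
theorem abs_current_le_sum {u : Eucl 5 → Eucl 5} (G : Fin 5 → Eucl 5 → Eucl 5) (j : Fin 5)
    {x : Eucl 5} (hu : ‖u x‖ ≤ 1) : |current u G j x| ≤ ∑ i, ‖G i x‖ ^ 4 := by
  have hcard : (Finset.univ.erase j).card = 4 := by simp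
  have h1 := prod_le_sum_pow (Finset.univ.erase j) Finset.univ (Finset.erase_subset _ _)
    (Finset.card_pos.1 (by rw [hcard]; norm_num)) (fun i => ‖G i x‖) fun _ => norm_nonneg _
  rw [hcard] at h1
  have h0 : 0 ≤ ∏ i ∈ Finset.univ.erase j, ‖G i x‖ := Finset.prod_nonneg fun _ _ => norm_nonneg _
  calc _ ≤ _ := abs_current_le u G j x
    _ ≤ 1 * ∏ i ∈ Finset.univ.erase j, ‖G i x‖ := by gcongr
    _ ≤ _ := by rw [one_mul]; exact h1

/-- Here continuity is indispensable: for `x / |x|`, which has a point singularity, every symmetric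
mollification vanishes at the origin. -/
theorem eventually_half_lt_norm_moll {u : Eucl n → Eucl n} (hu : Continuous u)
    (hu1 : ∀ x, ‖u x‖ = 1) {S : Set (Eucl n)} (hS : IsCompact S) :
    ∀ᶠ k in atTop, ∀ x ∈ S, 1 / 2 < ‖moll k u x‖ := by
  have hloc (x : Eucl n) : ∃ t ∈ 𝓝 x, ∀ᶠ k in atTop, ∀ y ∈ t, 1 / 2 < ‖moll k u y‖ := by
    have h := (tendsto_moll_of_continuous hu x).norm.eventually
      (lt_mem_nhds (show 1 / 2 < ‖u x‖ by rw [hu1]; norm_num))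
    obtain ⟨p, hp, q, hq, hpq⟩ := eventually_prod_iff.1 h
    exact ⟨{y | q y}, hq, hp.mono fun k hk y hy => hpq hk hy⟩
  choose t ht hev using hloc
  obtain ⟨I, -, hI⟩ := hS.elim_nhds_subcover t fun x _ => ht x
  have := (Finset.eventually_all I).2 fun x _ => hev x
  filter_upwards [this] with k hk x hx
  obtain ⟨y, hy, hxy⟩ := mem_iUnion₂.1 (hI hx)
  exact hk y hy x hxy

/-- For a continuous map to the unit sphere of `ℝ⁵` with gradient in `L⁴_loc`, the pull-back of
the volume form is closed in the sense of distributions. -/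
theorem sum_integral_current_eq_zero {u : Eucl 5 → Eucl 5} {G : Fin 5 → Eucl 5 → Eucl 5}
    (hu : Continuous u) (hu1 : ∀ x, ‖u x‖ = 1) (hG : ∀ i, HasWeakPartial univ i u (G i))
    (hG4 : ∀ i, LocallyIntegrable fun x => ‖G i x‖ ^ 4) {η : Eucl 5 → ℝ}
    (hη : IsTestFunction univ η) :
    ∑ j, ∫ x, fderiv ℝ η x (stdVec j) * current u G j x = 0 := by
  have lG (i : Fin 5) : LocallyIntegrable (G i) :=
    locallyIntegrableOn_univ.1 (hG i).locallyIntegrableOn_right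
  have hs (k : ℕ) : ContDiff ℝ ∞ (moll k u) := contDiff_moll hu.locallyIntegrable k
  have hcur (k : ℕ) (j : Fin 5) : current (moll k u) (fun i x => fderiv ℝ (moll k u) x (stdVec i)) j
      = current (moll k u) (fun i => moll k (G i)) j := by
    ext x
    simp only [current, (hG _).fderiv_moll]
  have hcont (k : ℕ) (j : Fin 5) : Continuous (current (moll k u) (fun i => moll k (G i)) j) := by
    have := (contDiff_current (hs k) j).continuous
    rwa [hcur] at this
  obtain ⟨C, hC⟩ : ∃ C : ℝ, ∀ y : Eucl 5, |negPowCutoff 5 y| ≤ C := ⟨_, abs_negPowCutoff_le⟩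
  have hC0 : 0 ≤ C := (abs_nonneg _).trans (hC 0)
  -- The weight tends to one since `|u| = 1`. The majorant comes from the bound `C` on the weight,
  -- from `|moll k u| ≤ 1` and from Jensen's inequality for fourth powers.
  have hlim (j : Fin 5) : Tendsto (fun k => ∫ x, fderiv ℝ η x (stdVec j) *
      (negPowCutoff 5 (moll k u x) * current (moll k u) (fun i => moll k (G i)) j x)) atTop
      (𝓝 (∫ x, fderiv ℝ η x (stdVec j) * current u G j x)) := by
    have hη' := hη.fderiv_apply (stdVec j)
    refine tendsto_integral_of_le_moll (H := fun x => ∑ i, ‖G i x‖ ^ 4)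
      (χ := fun x => |fderiv ℝ η x (stdVec j)| * C)
      (locallyIntegrable_finsetSum _ fun i _ => hG4 i) (hη'.continuous.abs.mul continuous_const)
      ((hη'.hasCompactSupport.comp_left abs_zero).mul_right) (fun k => ?_) ?_
      (fun k => Eventually.of_forall fun x => ?_)
    · have c1 : Continuous fun x => negPowCutoff 5 (moll k u x) :=
        contDiff_negPowCutoff.continuous.comp (hs k).continuous
      exact (hη'.continuous.mul (c1.mul (hcont k j))).aestronglyMeasurable
    · filter_upwards [ae_all_iff.2 fun i => ae_tendsto_moll (lG i)] with x hx
      have hux := tendsto_moll_apply_of_continuous hu x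
      have h1 : Tendsto (fun k => negPowCutoff 5 (moll k u x)) atTop (𝓝 1) := by
        have := (contDiff_negPowCutoff (n := 5)).continuous.continuousAt.tendsto.comp hux
        rwa [negPowCutoff_eq (by rw [hu1]; norm_num), hu1, one_pow, inv_one] at this
      have h2 : Tendsto (fun k => Function.update (fun i => moll k (G i) x) j (moll k u x)) atTop
          (𝓝 (Function.update (fun i => G i x) j (u x))) := by
        rw [tendsto_pi_nhds]
        intro i
        by_cases hi : i = j
        · subst hi; simpa using hux
        · simpa [Function.update_of_ne hi] using hx i
      have h3 : Tendsto (fun k => current (moll k u) (fun i => moll k (G i)) j x) atTop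
          (𝓝 (current u G j x)) := ((detMap 5).cont.tendsto _).comp h2
      simpa using (h1.mul h3).const_mul (fderiv ℝ η x (stdVec j))
    · have hm1 : ‖moll k u x‖ ≤ 1 := norm_moll_le (fun x => (hu1 x).le) k x
      have hb := abs_current_le_sum (fun i => moll k (G i)) j hm1
      have hsum : ∑ i, ‖moll k (G i) x‖ ^ 4 ≤ moll k (fun x => ∑ i, ‖G i x‖ ^ 4) x := by
        have e : moll k (fun x => ∑ i, ‖G i x‖ ^ 4) x = ∑ i, moll k (fun x => ‖G i x‖ ^ 4) x := by
          simp only [moll_apply, Finset.smul_sum]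
          exact integral_finsetSum _ fun i _ => integrable_mollBump_smul (hG4 i) k x
        rw [e]
        exact Finset.sum_le_sum fun i _ =>
          norm_moll_pow_four_le (lG i).aestronglyMeasurable (hG4 i) k x
      have hp : 0 ≤ ∑ i, ‖G i x‖ ^ 4 := Finset.sum_nonneg fun _ _ => by positivity
      rw [Real.norm_eq_abs, abs_mul, abs_mul, mul_assoc]
      refine mul_le_mul_of_nonneg_left ?_ (abs_nonneg _)
      exact mul_le_mul (hC _) (by linarith) (abs_nonneg _) hC0
  have hlim' := tendsto_finsetSum Finset.univ fun j _ => hlim j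
  refine tendsto_nhds_unique hlim' (tendsto_const_nhds.congr' ?_)
  filter_upwards [eventually_half_lt_norm_moll hu hu1 hη.hasCompactSupport.isCompact] with k hk
  have := sum_integral_smooth_current (hs k) hη hk
  simp only [hcur] at this
  exact this.symm

end ClosedCurrent

/-! ### Weak derivatives from absolute continuity on lines, and under isometries -/

section AbsolutelyContinuousOnLines

open Filter Topology

variable {n : ℕ} {F : Type*} [NormedAddCommGroup F] [NormedSpace ℝ F] [CompleteSpace F]
  {i : Fin n}

/-- The shear `(s, x) ↦ (s, x + s • e)` preserves the product measure. -/
theorem integrable_prod_comp_add_smul {h : Eucl n → F} (hh : Integrable h) (e : Eucl n) :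
    Integrable (fun q : ℝ × Eucl n => h (q.2 + q.1 • e))
      ((volume.restrict (Ioc (0 : ℝ) 1)).prod volume) := by
  have hmp : MeasurePreserving (fun q : ℝ × Eucl n => (q.1, q.2 + q.1 • e))
      ((volume.restrict (Ioc (0 : ℝ) 1)).prod volume)
      ((volume.restrict (Ioc (0 : ℝ) 1)).prod volume) :=
    (MeasurePreserving.id _).skew_product (g := fun s x => x + s • e)
      (by fun_prop) (Eventually.of_forall fun s => map_add_right_eq_self _ _)
  exact hmp.integrable_comp_of_integrable (g := fun q : ℝ × Eucl n => h q.2) (hh.comp_snd _)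

/-- If `H` is the primitive of `h` along almost every line in direction `e`, then `∫ h = 0`. -/
theorem integral_eq_zero_of_line_primitive {H h : Eucl n → F} (hH : Integrable H)
    (hh : Integrable h) (e : Eucl n)
    (hprim : ∀ᵐ x, IntegrableOn (fun s : ℝ => h (x + s • e)) (Ioc 0 1) →
      ∫ s in Ioc (0 : ℝ) 1, h (x + s • e) = H (x + e) - H x) :
    ∫ x, h x = 0 := by
  have hint := integrable_prod_comp_add_smul hh e
  -- By translation invariance each slice `s` contributes `∫ h`, so this double integral is `∫ h`.
  -- Integrating along the unit segments first leaves `H (x + e) - H x`, which has integral zero. No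
  -- splitting of `ℝⁿ` into coordinates is needed.
  have h1 : ∫ x, ∫ s in Ioc (0 : ℝ) 1, h (x + s • e) = 0 := by
    have : ∫ x, ∫ s in Ioc (0 : ℝ) 1, h (x + s • e) = ∫ x, (H (x + e) - H x) := by
      apply integral_congr_ae
      filter_upwards [hprim, hint.prod_left_ae] with x h2 h3
      exact h2 h3
    rw [this, integral_sub (hH.comp_add_right e) hH, integral_add_right_eq_self H e, sub_self]
  have h2 : ∫ s in Ioc (0 : ℝ) 1, ∫ x, h (x + s • e) = ∫ x, h x := by
    simp only [integral_add_right_eq_self h]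
    simp
  rw [← h2, ← h1]
  exact integral_integral_swap hint

/-- A function which is continuous on almost every line in direction `eᵢ`, and differentiable
there except at countably many points, has the pointwise derivative as a weak derivative if that
is locally integrable. -/
theorem hasWeakPartial_of_ae_line {f g : Eucl n → F} (hf : LocallyIntegrable f)
    (hg : LocallyIntegrable g)
    (hc : ∀ᵐ x : Eucl n, Continuous fun s : ℝ => f (x + s • stdVec i))
    (hd : ∀ᵐ x : Eucl n, ∃ C : Set ℝ, C.Countable ∧ ∀ s ∉ C,
      HasDerivAt (fun s : ℝ => f (x + s • stdVec i)) (g (x + s • stdVec i)) s) :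
    HasWeakPartial univ i f g := by
  refine ⟨hf.locallyIntegrableOn _, hg.locallyIntegrableOn _, fun φ hφ => ?_⟩
  rw [setIntegral_univ, setIntegral_univ]
  have hφ' := hφ.fderiv_apply (stdVec i)
  have i1 : Integrable fun x => fderiv ℝ φ x (stdVec i) • f x :=
    hf.integrable_smul_left_of_hasCompactSupport hφ'.continuous hφ'.hasCompactSupport
  have i2 : Integrable fun x => φ x • g x :=
    hg.integrable_smul_left_of_hasCompactSupport hφ.continuous hφ.hasCompactSupport
  have i3 : Integrable fun x => φ x • f x :=
    hf.integrable_smul_left_of_hasCompactSupport hφ.continuous hφ.hasCompactSupport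
  have key := integral_eq_zero_of_line_primitive i3 (i1.add i2) (stdVec i) ?_
  · simp only [Pi.add_apply] at key
    rw [integral_add i1 i2] at key
    exact add_eq_zero_iff_eq_neg.1 key
  · filter_upwards [hc, hd] with x hcx ⟨C, hC, hdx⟩ hint
    have hφd (s : ℝ) : HasDerivAt (fun s : ℝ => φ (x + s • stdVec i))
        (fderiv ℝ φ (x + s • stdVec i) (stdVec i)) s := by
      have h1 : HasDerivAt (fun s : ℝ => x + s • (stdVec i : Eucl n)) (stdVec i) s := by
        simpa using ((hasDerivAt_id s).smul_const (stdVec i : Eucl n)).const_add x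
      exact (hφ.differentiable _).hasFDerivAt.comp_hasDerivAt s h1
    have hFTC := integral_eq_of_hasDerivAt_off_countable_of_le
      (fun s : ℝ => φ (x + s • stdVec i) • f (x + s • stdVec i))
      (fun s : ℝ => fderiv ℝ φ (x + s • stdVec i) (stdVec i) • f (x + s • stdVec i) +
        φ (x + s • stdVec i) • g (x + s • stdVec i)) zero_le_one hC
      ((hφ.continuous.comp (by fun_prop)).smul hcx).continuousOn
      (fun s hs => by
        have := (hφd s).smul (hdx s hs.2)
        rwa [add_comm] at this)
      ((intervalIntegrable_iff_integrableOn_Ioc_of_le zero_le_one).2 hint)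
    rw [intervalIntegral.integral_of_le zero_le_one] at hFTC
    simpa using hFTC

/-- Almost every line in a given direction misses a given point. -/
theorem ae_forall_add_smul_ne (hn : 1 < n) (e z : Eucl n) : ∀ᵐ x : Eucl n, ∀ s : ℝ, x + s • e ≠ z := by
  have hlt : Submodule.span ℝ {e} ≠ ⊤ := by
    intro h
    have h1 := finrank_span_le_card (R := ℝ) ({e} : Set (Eucl n))
    rw [h, finrank_top, finrank_euclideanSpace_fin] at h1
    simp at h1
    omega
  have h0 : volume ((fun x => x - z) ⁻¹' (Submodule.span ℝ {e} : Set (Eucl n))) = 0 := by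
    rw [(measurePreserving_sub_right volume z).measure_preimage
      (Submodule.closed_of_finiteDimensional _).measurableSet.nullMeasurableSet]
    exact Measure.addHaar_submodule _ _ hlt
  rw [ae_iff]
  refine measure_mono_null (fun x hx => ?_) h0
  simp only [ne_eq, not_forall, not_not, mem_ofPred_eq] at hx
  obtain ⟨s, hs⟩ := hx
  rw [mem_preimage, SetLike.mem_coe, Submodule.mem_span_singleton]
  exact ⟨-s, by rw [← hs]; simp⟩

/-- Weak derivatives under isometries which preserve the coordinate directions. -/
theorem HasWeakPartial.comp_isometry {f g : Eucl n → F} (h : HasWeakPartial univ i f g)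
    (B : Eucl n ≃ₗᵢ[ℝ] Eucl n) (b : Eucl n) {σ : ℝ} (hB : B (stdVec i) = σ • stdVec i)
    (hσ : σ * σ = 1) :
    HasWeakPartial univ i (fun x => f (B x + b)) (fun x => σ • g (B x + b)) := by
  set A : Eucl n ≃ₜ Eucl n := B.toHomeomorph.trans (Homeomorph.addRight b) with hA
  have hAap (x : Eucl n) : A x = B x + b := rfl
  have hAs (y : Eucl n) : A.symm y = B.symm (y - b) := by
    rw [Homeomorph.symm_apply_eq, hAap, LinearIsometryEquiv.apply_symm_apply, sub_add_cancel]
  have hmp : MeasurePreserving A := by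
    have := (measurePreserving_add_right (volume : Measure (Eucl n)) b).comp B.measurePreserving
    exact this
  have hloc {f : Eucl n → F} (hf : LocallyIntegrable f) :
      LocallyIntegrable fun x => f (B x + b) := by
    have := (locallyIntegrable_map_homeomorph A (f := f) (μ := volume)).1 (by rwa [hmp.map_eq])
    exact this
  have hf := locallyIntegrableOn_univ.1 h.locallyIntegrableOn_left
  have hg := locallyIntegrableOn_univ.1 h.locallyIntegrableOn_right
  refine ⟨(hloc hf).locallyIntegrableOn _, ((hloc hg).smul σ).locallyIntegrableOn _,
    fun φ hφ => ?_⟩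
  have hBs : B.symm (stdVec i) = σ • stdVec i := by
    rw [LinearIsometryEquiv.symm_apply_eq, map_smul, hB, smul_smul, hσ, one_smul]
  have hφs : IsTestFunction univ fun y => φ (A.symm y) := by
    refine ⟨?_, hφ.hasCompactSupport.comp_homeomorph A.symm, subset_univ _⟩
    simp only [hAs]
    exact hφ.contDiff.comp (B.symm.contDiff.comp (contDiff_id.sub contDiff_const))
  have hder (y : Eucl n) : fderiv ℝ (fun y => φ (A.symm y)) y (stdVec i) =
      σ * fderiv ℝ φ (A.symm y) (stdVec i) := by
    simp only [hAs]
    have h1 : HasFDerivAt (fun y => B.symm (y - b))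
        (B.symm.toContinuousLinearEquiv : Eucl n →L[ℝ] Eucl n) y := by
      have := (B.symm.toContinuousLinearEquiv : Eucl n →L[ℝ] Eucl n).hasFDerivAt.comp y
        ((hasFDerivAt_id y).sub_const b)
      rw [ContinuousLinearMap.comp_id] at this
      exact this
    have h2 := (hφ.differentiable (B.symm (y - b))).hasFDerivAt.comp y h1
    have h3 : HasFDerivAt (fun y => φ (B.symm (y - b))) _ y := h2
    rw [h3.fderiv]
    simp only [ContinuousLinearMap.comp_apply]
    have h4 : (B.symm.toContinuousLinearEquiv : Eucl n →L[ℝ] Eucl n) (stdVec i) =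
      σ • stdVec i := hBs
    rw [h4, map_smul, smul_eq_mul]
  have key := h.integral_eq _ hφs
  simp only [setIntegral_univ] at key ⊢
  have e1 : ∫ x, fderiv ℝ φ x (stdVec i) • f (B x + b) =
      ∫ y, fderiv ℝ φ (A.symm y) (stdVec i) • f y := by
    rw [← hmp.integral_comp A.measurableEmbedding fun y =>
      fderiv ℝ φ (A.symm y) (stdVec i) • f y]
    simp only [A.symm_apply_apply]
    rfl
  have e2 : ∫ x, φ x • σ • g (B x + b) = ∫ y, φ (A.symm y) • σ • g y := by
    rw [← hmp.integral_comp A.measurableEmbedding fun y => φ (A.symm y) • σ • g y]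
    simp only [A.symm_apply_apply]
    rfl
  have e3 : ∫ y, φ (A.symm y) • σ • g y = σ • ∫ y, φ (A.symm y) • g y := by
    rw [← integral_smul]
    simp only [smul_comm σ]
  have e4 : ∫ y, fderiv ℝ φ (A.symm y) (stdVec i) • f y =
      σ • ∫ y, fderiv ℝ (fun y => φ (A.symm y)) y (stdVec i) • f y := by
    rw [← integral_smul]
    congr 1 with y
    rw [hder, smul_smul, ← mul_assoc, hσ, one_mul]
  rw [e1, e2, e3, e4, key, smul_neg]

end AbsolutelyContinuousOnLines

/-! ### Homogeneous functions and their integrability at the origin -/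

section Homogeneous

open Filter Topology

variable {n : ℕ} {F : Type*} [NormedAddCommGroup F] [NormedSpace ℝ F]

/-- `f` is positively homogeneous of degree `-d`. -/
def IsNegHomogeneous (d : ℕ) (f : Eucl n → F) : Prop :=
  ∀ r : ℝ, 0 < r → ∀ x, f (r • x) = (r ^ d)⁻¹ • f x

theorem IsNegHomogeneous.fderiv_apply {d : ℕ} {f : Eucl n → F} (h : IsNegHomogeneous d f)
    (v : Eucl n) : IsNegHomogeneous (d + 1) fun x => fderiv ℝ f x v := by
  intro r hr x
  have h1 : (fun x => f (r • x)) = fun x => (r ^ d)⁻¹ • f x := funext (h r hr)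
  have h2 : fderiv ℝ (fun x => f (r • x)) x = r • fderiv ℝ f (r • x) := fderiv_comp_smul r
  have h3 : fderiv ℝ (fun x => (r ^ d)⁻¹ • f x) x = (r ^ d)⁻¹ • fderiv ℝ f x :=
    congr_fun (fderiv_const_smul_field (r ^ d)⁻¹) x
  rw [h1, h3] at h2
  have h4 := congrArg (fun T : Eucl n →L[ℝ] F => r⁻¹ • T v) h2
  simp only [smul_apply, smul_smul] at h4
  rw [inv_mul_cancel₀ hr.ne', one_smul] at h4
  change fderiv ℝ f (r • x) v = (r ^ (d + 1))⁻¹ • fderiv ℝ f x v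
  rw [← h4, pow_succ, mul_inv, mul_comm]

theorem IsNegHomogeneous.exists_bound {d : ℕ} {f : Eucl n → F} (h : IsNegHomogeneous d f)
    (hc : ContinuousOn f {0}ᶜ) : ∃ C : ℝ, ∀ x ≠ 0, ‖f x‖ ≤ C * (‖x‖ ^ d)⁻¹ := by
  obtain ⟨C, hC⟩ := (isCompact_sphere (0 : Eucl n) 1).exists_bound_of_continuousOn
    (hc.mono fun x hx => by
      rintro rfl
      simp at hx)
  refine ⟨C, fun x hx => ?_⟩
  have hpos : 0 < ‖x‖ := norm_pos_iff.2 hx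
  have h1 := hC (‖x‖⁻¹ • x) (by simp [norm_smul, hpos.ne'])
  have h2 := h ‖x‖ hpos (‖x‖⁻¹ • x)
  rw [smul_smul, mul_inv_cancel₀ hpos.ne', one_smul] at h2
  rw [h2, norm_smul, Real.norm_of_nonneg (by positivity), mul_comm]
  gcongr

/-- In polar coordinates the integrand becomes `r ^ (n - 1 - d)`. In `ℝ⁵` the exponent `d = 4` is
still allowed, which covers the fourth power of a gradient of order `|x|⁻¹` and the square of a
Hessian of order `|x|⁻²`. -/
theorem locallyIntegrable_norm_pow_inv {d : ℕ} (hd : d < n) :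
    LocallyIntegrable fun x : Eucl n => (‖x‖ ^ d)⁻¹ := by
  have : Nontrivial (Eucl n) :=
    Module.nontrivial_of_finrank_pos (R := ℝ) (by rw [finrank_euclideanSpace_fin]; omega)
  rw [locallyIntegrable_iff]
  intro k hk
  obtain ⟨R, hR⟩ := hk.isBounded.subset_ball 0
  refine IntegrableOn.mono_set ?_ hR
  rw [integrableOn_fun_norm_addHaar (μ := (volume : Measure (Eucl n))) (f := fun y => (y ^ d)⁻¹),
    finrank_euclideanSpace_fin]
  have hc : IntegrableOn (fun y : ℝ => y ^ (n - 1 - d)) (Ioo 0 R) :=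
    ((continuous_pow _).integrableOn_Icc (a := 0) (b := R)).mono_set Ioo_subset_Icc_self
  refine hc.congr_fun (fun y hy => ?_) measurableSet_Ioo
  simp only [smul_eq_mul]
  rw [← div_eq_mul_inv, eq_div_iff (pow_ne_zero _ hy.1.ne'), ← pow_add]
  congr 1
  omega

end Homogeneous

/-! ### Gluing to a constant across a hyperplane -/

section HalfSpace

open Filter Topology

variable {F : Type*} [NormedAddCommGroup F] [NormedSpace ℝ F]

/-- The function which equals `a` in the upper half space and `c` in the lower one. -/
noncomputable def halfGlue (a : Eucl 5 → F) (c : F) (x : Eucl 5) : F :=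
  if x 4 ≤ 0 then c else a x

theorem measurableSet_lowerHalf : MeasurableSet {x : Eucl 5 | x 4 ≤ 0} :=
  (isClosed_le (EuclideanSpace.proj (𝕜 := ℝ) (4 : Fin 5)).continuous
    continuous_const).measurableSet

theorem stronglyMeasurable_halfGlue {a : Eucl 5 → F} (ha : StronglyMeasurable a) (c : F) :
    StronglyMeasurable (halfGlue a c) :=
  StronglyMeasurable.ite measurableSet_lowerHalf stronglyMeasurable_const ha

theorem ae_ne_zero : ∀ᵐ x : Eucl 5, x ≠ 0 := Measure.ae_ne volume 0

theorem locallyIntegrable_of_bound {g : Eucl 5 → F} (hg : AEStronglyMeasurable g) {A C : ℝ}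
    {d : ℕ} (hd : d < 5) (hb : ∀ x ≠ 0, ‖g x‖ ≤ A + C * (‖x‖ ^ d)⁻¹) : LocallyIntegrable g := by
  have h1 : LocallyIntegrable fun x : Eucl 5 => A + C * (‖x‖ ^ d)⁻¹ :=
    (locallyIntegrable_const A).add ((locallyIntegrable_norm_pow_inv hd).smul C)
  refine h1.mono hg ?_
  filter_upwards [ae_ne_zero] with x hx
  exact (hb x hx).trans (le_abs_self _)

theorem norm_halfGlue_le {a : Eucl 5 → F} {c : F} {C : ℝ} {d : ℕ}
    (hb : ∀ x ≠ 0, ‖a x‖ ≤ C * (‖x‖ ^ d)⁻¹) {x : Eucl 5} (hx : x ≠ 0) :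
    ‖halfGlue a c x‖ ≤ ‖c‖ + |C| * (‖x‖ ^ d)⁻¹ := by
  have h0 : 0 ≤ |C| * (‖x‖ ^ d)⁻¹ := by positivity
  have h1 : C * (‖x‖ ^ d)⁻¹ ≤ |C| * (‖x‖ ^ d)⁻¹ := by gcongr; exact le_abs_self _
  rw [halfGlue]
  split_ifs
  · linarith
  · linarith [hb x hx, norm_nonneg c]

/-- Almost every line misses the origin. On such a line the glued function is continuous, as the
values agree on the hyperplane, and it is differentiable except possibly where it crosses the
hyperplane. -/
theorem hasWeakPartial_halfGlue [CompleteSpace F] {a : Eucl 5 → F} {c : F} {j : Fin 5}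
    (ha : ∀ x ≠ 0, DifferentiableAt ℝ a x) (hac : ∀ x : Eucl 5, x ≠ 0 → x 4 = 0 → a x = c)
    (hl : LocallyIntegrable (halfGlue a c))
    (hl' : LocallyIntegrable (halfGlue (fun x => fderiv ℝ a x (stdVec j)) 0)) :
    HasWeakPartial univ j (halfGlue a c) (halfGlue (fun x => fderiv ℝ a x (stdVec j)) 0) := by
  have hda (x : Eucl 5) (hx : ∀ s : ℝ, x + s • stdVec j ≠ 0) (s : ℝ) :
      HasDerivAt (fun s : ℝ => a (x + s • stdVec j)) (fderiv ℝ a (x + s • stdVec j) (stdVec j)) s := by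
    have h1 : HasDerivAt (fun s : ℝ => x + s • (stdVec j : Eucl 5)) (stdVec j) s := by
      simpa using ((hasDerivAt_id s).smul_const (stdVec j : Eucl 5)).const_add x
    exact (ha _ (hx s)).hasFDerivAt.comp_hasDerivAt s h1
  have hcoord (x : Eucl 5) : Continuous fun s : ℝ => (x + s • stdVec j : Eucl 5) 4 :=
    (EuclideanSpace.proj (𝕜 := ℝ) (4 : Fin 5)).continuous.comp
      (continuous_const.add (continuous_id.smul continuous_const))
  refine hasWeakPartial_of_ae_line hl hl' ?_ ?_
  · filter_upwards [ae_forall_add_smul_ne (by norm_num) (stdVec j) 0] with x hx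
    simp only [halfGlue]
    refine Continuous.if_le continuous_const ?_ (hcoord x) continuous_const fun s hs => ?_
    · exact continuous_iff_continuousAt.2 fun s => (hda x hx s).continuousAt
    · exact (hac _ (hx s) hs).symm
  · filter_upwards [ae_forall_add_smul_ne (by norm_num) (stdVec j) 0] with x hx
    -- Only a vertical line crosses the hyperplane, at one parameter. A horizontal line that meets
    -- it lies in it, and there the glued function is constant.
    refine ⟨{s | j = 4 ∧ x 4 + s = 0}, Set.Subsingleton.countable ?_, fun s hs => ?_⟩
    · rintro s ⟨-, h1⟩ t ⟨-, h2⟩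
      linarith
    · rcases lt_trichotomy ((x + s • stdVec j : Eucl 5) 4) 0 with h | h | h
      · have e : (fun s : ℝ => halfGlue a c (x + s • stdVec j)) =ᶠ[𝓝 s] fun _ => c := by
          filter_upwards [(hcoord x).continuousAt.eventually (gt_mem_nhds h)] with t ht
          rw [halfGlue, if_pos (le_of_lt ht)]
        rw [halfGlue, if_pos h.le]
        exact (hasDerivAt_const s c).congr_of_eventuallyEq e
      · have hj : j ≠ 4 := by
          rintro rfl
          exact hs ⟨rfl, by simpa using h⟩
        have h4 (t : ℝ) : (x + t • stdVec j : Eucl 5) 4 = x 4 := by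
          simp [hj.symm]
        have e : (fun s : ℝ => halfGlue a c (x + s • stdVec j)) = fun _ => c := by
          ext t
          rw [halfGlue, if_pos (by rw [h4, ← h4 s, h])]
        rw [halfGlue, if_pos h.le, e]
        exact hasDerivAt_const s c
      · have e : (fun s : ℝ => halfGlue a c (x + s • stdVec j)) =ᶠ[𝓝 s]
            fun s => a (x + s • stdVec j) := by
          filter_upwards [(hcoord x).continuousAt.eventually (lt_mem_nhds h)] with t ht
          rw [halfGlue, if_neg (not_le.2 ht)]
        rw [halfGlue, if_neg (not_le.2 h)]
        exact (hda x hx s).congr_of_eventuallyEq e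

end HalfSpace

/-! ### The homogeneous extension of `p` and its derivatives -/

section HemisphereMap

open Filter Topology

variable {p : Eucl 5 → Eucl 5}

theorem contDiffAt_radialProj {x : Eucl 5} (hx : x ≠ 0) : ContDiffAt ℝ ∞ radialProj x :=
  ((contDiffAt_norm ℝ hx).inv (norm_ne_zero_iff.2 hx)).smul contDiffAt_id

theorem measurable_radialProj : Measurable radialProj :=
  (measurable_norm.inv).smul measurable_id

theorem norm_radialProj {x : Eucl 5} (hx : x ≠ 0) : ‖radialProj x‖ = 1 := by
  rw [radialProj, norm_smul, norm_inv, norm_norm, inv_mul_cancel₀ (norm_ne_zero_iff.2 hx)]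

theorem radialProj_last (x : Eucl 5) : radialProj x 4 = ‖x‖⁻¹ * x 4 := rfl

theorem radialProj_smul {r : ℝ} (hr : 0 < r) (x : Eucl 5) : radialProj (r • x) = radialProj x := by
  rw [radialProj, radialProj, norm_smul, Real.norm_of_nonneg hr.le, smul_smul, mul_inv,
    mul_right_comm, inv_mul_cancel₀ hr.ne', one_mul]

/-- The partial derivatives of `p (x / |x|)`. -/
noncomputable def radialGrad (p : Eucl 5 → Eucl 5) (i : Fin 5) (x : Eucl 5) : Eucl 5 :=
  fderiv ℝ (p ∘ radialProj) x (stdVec i)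

/-- The second partial derivatives of `p (x / |x|)`. -/
noncomputable def radialHess (p : Eucl 5 → Eucl 5) (i j : Fin 5) (x : Eucl 5) : Eucl 5 :=
  fderiv ℝ (radialGrad p i) x (stdVec j)

theorem isNegHomogeneous_comp_radialProj : IsNegHomogeneous 0 (p ∘ radialProj) := fun r hr x => by
  simp [radialProj_smul hr]

theorem isNegHomogeneous_radialGrad (i : Fin 5) : IsNegHomogeneous 1 (radialGrad p i) :=
  isNegHomogeneous_comp_radialProj.fderiv_apply _

theorem isNegHomogeneous_radialHess (i j : Fin 5) : IsNegHomogeneous 2 (radialHess p i j) :=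
  (isNegHomogeneous_radialGrad i).fderiv_apply _

theorem contDiffAt_comp_radialProj (hp : ContDiff ℝ ∞ p) {x : Eucl 5} (hx : x ≠ 0) :
    ContDiffAt ℝ ∞ (p ∘ radialProj) x :=
  hp.contDiffAt.comp x (contDiffAt_radialProj hx)

theorem contDiffAt_radialGrad (hp : ContDiff ℝ ∞ p) (i : Fin 5) {x : Eucl 5} (hx : x ≠ 0) :
    ContDiffAt ℝ ∞ (radialGrad p i) x :=
  ((contDiffAt_comp_radialProj hp hx).fderiv_right (m := ∞) (by simp)).clm_apply contDiffAt_const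

theorem contDiffAt_radialHess (hp : ContDiff ℝ ∞ p) (i j : Fin 5) {x : Eucl 5} (hx : x ≠ 0) :
    ContDiffAt ℝ ∞ (radialHess p i j) x :=
  ((contDiffAt_radialGrad hp i hx).fderiv_right (m := ∞) (by simp)).clm_apply contDiffAt_const

theorem stronglyMeasurable_comp_radialProj (hp : ContDiff ℝ ∞ p) :
    StronglyMeasurable (p ∘ radialProj) :=
  (hp.continuous.measurable.comp measurable_radialProj).stronglyMeasurable

theorem stronglyMeasurable_radialGrad (i : Fin 5) : StronglyMeasurable (radialGrad p i) :=
  (measurable_fderiv_apply_const ℝ _ _).stronglyMeasurable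

theorem stronglyMeasurable_radialHess (i j : Fin 5) : StronglyMeasurable (radialHess p i j) :=
  (measurable_fderiv_apply_const ℝ _ _).stronglyMeasurable

theorem exists_bound_radialGrad (hp : ContDiff ℝ ∞ p) (i : Fin 5) :
    ∃ C : ℝ, ∀ x ≠ 0, ‖radialGrad p i x‖ ≤ C * (‖x‖ ^ 1)⁻¹ :=
  (isNegHomogeneous_radialGrad i).exists_bound fun _ hx =>
    (contDiffAt_radialGrad hp i hx).continuousAt.continuousWithinAt

theorem exists_bound_radialHess (hp : ContDiff ℝ ∞ p) (i j : Fin 5) :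
    ∃ C : ℝ, ∀ x ≠ 0, ‖radialHess p i j x‖ ≤ C * (‖x‖ ^ 2)⁻¹ :=
  (isNegHomogeneous_radialHess i j).exists_bound fun _ hx =>
    (contDiffAt_radialHess hp i j hx).continuousAt.continuousWithinAt

theorem exists_bound_comp_radialProj (hp : ContDiff ℝ ∞ p) :
    ∃ C : ℝ, ∀ x ≠ 0, ‖(p ∘ radialProj) x‖ ≤ C * (‖x‖ ^ 0)⁻¹ :=
  isNegHomogeneous_comp_radialProj.exists_bound fun _ hx =>
    (contDiffAt_comp_radialProj hp hx).continuousAt.continuousWithinAt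

/-- The boundary conditions on `p` make `p (x / |x|)` constant to first order on the equatorial
hyperplane. -/
theorem radialGrad_eq_zero (hp : ContDiff ℝ ∞ p)
    (hp_equator : ∀ y : Eucl 5, ‖y‖ = 1 → y 4 = 0 → p y = northPole)
    (hp_deriv : ∀ y : Eucl 5, ‖y‖ = 1 → y 4 = 0 → fderiv ℝ p y northPole = 0) (i : Fin 5)
    {x : Eucl 5} (hx : x ≠ 0) (hx4 : x 4 = 0) : radialGrad p i x = 0 := by
  have hline : HasDerivAt (fun s : ℝ => x + s • (stdVec i : Eucl 5)) (stdVec i) 0 := by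
    simpa using ((hasDerivAt_id (0 : ℝ)).smul_const (stdVec i : Eucl 5)).const_add x
  have h1 : HasDerivAt (fun s : ℝ => (p ∘ radialProj) (x + s • stdVec i)) (radialGrad p i x) 0 := by
    have hd : HasFDerivAt (p ∘ radialProj) (fderiv ℝ (p ∘ radialProj) x)
        (x + (0 : ℝ) • (stdVec i : Eucl 5)) := by
      rw [zero_smul, add_zero]
      exact ((contDiffAt_comp_radialProj hp hx).differentiableAt (by simp)).hasFDerivAt
    exact HasFDerivAt.comp_hasDerivAt (l := p ∘ radialProj) (0 : ℝ) hd hline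
  have hxs : ∀ᶠ s : ℝ in 𝓝 0, x + s • (stdVec i : Eucl 5) ≠ 0 :=
    hline.continuousAt.eventually_ne (by simpa using hx)
  by_cases hi : i = 4
  · subst hi
    -- At a point of the equatorial hyperplane `‖x + s • e₅‖` is stationary, so the radial
    -- projection moves vertically to first order, and the condition on the vertical derivative of
    -- `p` applies.
    have hr : HasDerivAt (fun s : ℝ => radialProj (x + s • (stdVec 4 : Eucl 5)))
        (‖x‖⁻¹ • stdVec 4) 0 := by
      have hsq : HasDerivAt (fun s : ℝ => ‖x + s • (stdVec 4 : Eucl 5)‖ ^ 2) 0 0 := by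
        have := hline.norm_sq
        simpa [PiLp.inner_apply, PiLp.single_apply, hx4] using this
      have hn : HasDerivAt (fun s : ℝ => ‖x + s • (stdVec 4 : Eucl 5)‖) 0 0 := by
        have := hsq.sqrt (by simpa using hx)
        simpa [Real.sqrt_sq (norm_nonneg _)] using this
      have hinv := (hn.inv (by simpa using hx)).smul hline
      have e : (fun s : ℝ => radialProj (x + s • (stdVec 4 : Eucl 5))) =
          (fun s : ℝ => ‖x + s • (stdVec 4 : Eucl 5)‖)⁻¹ •
            fun s : ℝ => x + s • (stdVec 4 : Eucl 5) := rfl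
      rw [e]
      simpa only [zero_smul, add_zero, neg_zero, zero_div, Pi.inv_apply] using hinv
    have h2 : HasDerivAt (fun s : ℝ => (p ∘ radialProj) (x + s • stdVec 4))
        (fderiv ℝ p (radialProj x) (‖x‖⁻¹ • stdVec 4)) 0 := by
      have hd : HasFDerivAt p (fderiv ℝ p (radialProj x))
          (radialProj (x + (0 : ℝ) • (stdVec 4 : Eucl 5))) := by
        rw [zero_smul, add_zero]
        exact (hp.differentiable (by simp) _).hasFDerivAt
      exact hd.comp_hasDerivAt (0 : ℝ) hr
    rw [h1.unique h2, map_smul]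
    have := hp_deriv (radialProj x) (norm_radialProj hx) (by rw [radialProj_last, hx4, mul_zero])
    rw [northPole] at this
    rw [this, smul_zero]
  -- Horizontal directions stay in the hyperplane, where `p (x / |x|)` is constant.
  · refine h1.unique ((hasDerivAt_const (0 : ℝ) northPole).congr_of_eventuallyEq ?_)
    filter_upwards [hxs] with s hs
    refine hp_equator _ (norm_radialProj hs) ?_
    have : (x + s • stdVec i : Eucl 5) 4 = x 4 := by simp [Ne.symm hi]
    rw [radialProj_last, this, hx4, mul_zero]

/-- The map `p (x / |x|)` in the upper half space, continued by a constant. -/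
noncomputable def hemiMap (p : Eucl 5 → Eucl 5) : Eucl 5 → Eucl 5 :=
  halfGlue (p ∘ radialProj) northPole

/-- The partial derivatives of `hemiMap`. -/
noncomputable def hemiGrad (p : Eucl 5 → Eucl 5) (i : Fin 5) : Eucl 5 → Eucl 5 :=
  halfGlue (radialGrad p i) 0

/-- The second partial derivatives of `hemiMap`. -/
noncomputable def hemiHess (p : Eucl 5 → Eucl 5) (i j : Fin 5) : Eucl 5 → Eucl 5 :=
  halfGlue (radialHess p i j) 0

theorem stronglyMeasurable_hemiMap (hp : ContDiff ℝ ∞ p) : StronglyMeasurable (hemiMap p) :=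
  stronglyMeasurable_halfGlue (stronglyMeasurable_comp_radialProj hp) _

theorem stronglyMeasurable_hemiGrad (i : Fin 5) : StronglyMeasurable (hemiGrad p i) :=
  stronglyMeasurable_halfGlue (stronglyMeasurable_radialGrad i) _

theorem stronglyMeasurable_hemiHess (i j : Fin 5) : StronglyMeasurable (hemiHess p i j) :=
  stronglyMeasurable_halfGlue (stronglyMeasurable_radialHess i j) _

theorem exists_bound_hemiGrad (hp : ContDiff ℝ ∞ p) (i : Fin 5) :
    ∃ C : ℝ, ∀ x ≠ 0, ‖hemiGrad p i x‖ ≤ C * (‖x‖ ^ 1)⁻¹ := by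
  obtain ⟨C, hC⟩ := exists_bound_radialGrad hp i
  exact ⟨|C|, fun x hx => by
    rw [← zero_add (|C| * _), ← norm_zero (E := Eucl 5)]
    exact norm_halfGlue_le (c := 0) hC hx⟩

theorem exists_bound_hemiHess (hp : ContDiff ℝ ∞ p) (i j : Fin 5) :
    ∃ C : ℝ, ∀ x ≠ 0, ‖hemiHess p i j x‖ ≤ C * (‖x‖ ^ 2)⁻¹ := by
  obtain ⟨C, hC⟩ := exists_bound_radialHess hp i j
  exact ⟨|C|, fun x hx => by
    rw [← zero_add (|C| * _), ← norm_zero (E := Eucl 5)]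
    exact norm_halfGlue_le (c := 0) hC hx⟩

theorem locallyIntegrable_norm_pow_of_bound {g : Eucl 5 → Eucl 5} (hg : StronglyMeasurable g)
    {d k : ℕ} {C : ℝ} (hC : ∀ x ≠ 0, ‖g x‖ ≤ C * (‖x‖ ^ d)⁻¹) (hdk : d * k < 5) :
    LocallyIntegrable fun x => ‖g x‖ ^ k := by
  refine locallyIntegrable_of_bound (A := 0) (C := C ^ k) (d := d * k)
    (hg.norm.pow k).aestronglyMeasurable hdk fun x hx => ?_
  rw [norm_pow, norm_norm, zero_add, pow_mul, ← inv_pow, ← mul_pow]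
  exact pow_le_pow_left₀ (norm_nonneg _) (hC x hx) k

theorem hasWeakPartial_hemiMap (hp : ContDiff ℝ ∞ p)
    (hp_equator : ∀ y : Eucl 5, ‖y‖ = 1 → y 4 = 0 → p y = northPole) (i : Fin 5) :
    HasWeakPartial univ i (hemiMap p) (hemiGrad p i) := by
  obtain ⟨C, hC⟩ := exists_bound_comp_radialProj hp
  obtain ⟨C', hC'⟩ := exists_bound_radialGrad hp i
  refine hasWeakPartial_halfGlue (fun x hx =>
    (contDiffAt_comp_radialProj hp hx).differentiableAt (by simp)) (fun x hx hx4 =>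
      hp_equator _ (norm_radialProj hx) (by rw [radialProj_last, hx4, mul_zero])) ?_ ?_
  · exact locallyIntegrable_of_bound (stronglyMeasurable_hemiMap hp).aestronglyMeasurable
      (by norm_num) fun x hx => norm_halfGlue_le hC hx
  · exact locallyIntegrable_of_bound (stronglyMeasurable_hemiGrad i).aestronglyMeasurable
      (by norm_num) fun x hx => norm_halfGlue_le hC' hx

/-- The gluing lemma is used a second time, for the gradient. It requires the gradient to vanish on
the hyperplane, and this is where the normal derivative condition on `p` enters. -/
theorem hasWeakPartial_hemiGrad (hp : ContDiff ℝ ∞ p)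
    (hp_equator : ∀ y : Eucl 5, ‖y‖ = 1 → y 4 = 0 → p y = northPole)
    (hp_deriv : ∀ y : Eucl 5, ‖y‖ = 1 → y 4 = 0 → fderiv ℝ p y northPole = 0) (i j : Fin 5) :
    HasWeakPartial univ j (hemiGrad p i) (hemiHess p i j) := by
  obtain ⟨C, hC⟩ := exists_bound_radialGrad hp i
  obtain ⟨C', hC'⟩ := exists_bound_radialHess hp i j
  refine hasWeakPartial_halfGlue (fun x hx =>
    (contDiffAt_radialGrad hp i hx).differentiableAt (by simp)) (fun x hx hx4 =>
      radialGrad_eq_zero hp hp_equator hp_deriv i hx hx4) ?_ ?_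
  · exact locallyIntegrable_of_bound (stronglyMeasurable_hemiGrad i).aestronglyMeasurable
      (by norm_num) fun x hx => norm_halfGlue_le hC hx
  · exact locallyIntegrable_of_bound (stronglyMeasurable_hemiHess i j).aestronglyMeasurable
      (by norm_num) fun x hx => norm_halfGlue_le hC' hx

end HemisphereMap

/-! ### Geometry of the capsule and the two charts of the radial extension -/

section Capsule

open Filter Topology

variable {p : Eucl 5 → Eucl 5} {L : ℝ}

theorem northPole_eq : northPole = (stdVec 4 : Eucl 5) := rfl

theorem norm_northPole : ‖northPole‖ = 1 := by simp [northPole]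

theorem northPole_last : northPole 4 = 1 := by simp [northPole]

theorem norm_sub_smul_northPole_sq (x : Eucl 5) (t : ℝ) :
    ‖x - t • northPole‖ ^ 2 = ‖horizontalPart x‖ ^ 2 + (x 4 - t) ^ 2 := by
  rw [EuclideanSpace.norm_sq_eq, EuclideanSpace.norm_sq_eq, Fin.sum_univ_castSucc]
  congr 1
  · refine Finset.sum_congr rfl fun i _ => ?_
    have : northPole i.castSucc = 0 := by
      rw [northPole, PiLp.single_apply, if_neg]
      exact (Fin.castSucc_lt_last i).ne
    simp [this, horizontalPart]
  · have : (Fin.last 4 : Fin 5) = 4 := rfl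
    rw [this]
    simp [northPole_last]

/-- The capsule is the union of the unit balls centred on a segment of the axis. Openness, convexity
and boundedness are read off from this form. -/
theorem mem_capsule_iff (hL : 0 < L) {x : Eucl 5} :
    x ∈ capsule L ↔ ∃ t ∈ Icc (-L) L, ‖x - t • northPole‖ < 1 := by
  have hlt (t : ℝ) : ‖x - t • northPole‖ < 1 ↔ ‖horizontalPart x‖ ^ 2 + (x 4 - t) ^ 2 < 1 := by
    rw [← norm_sub_smul_northPole_sq, sq_lt_one_iff₀ (norm_nonneg _)]
  have hplus : x + L • northPole = x - (-L) • northPole := by simp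
  simp only [capsule, mem_union, mem_ofPred_eq, hplus]
  constructor
  · rintro ((⟨h1, -⟩ | ⟨h1, h2⟩) | ⟨h1, -⟩)
    · exact ⟨L, ⟨by linarith, le_rfl⟩, h1⟩
    · refine ⟨x 4, h2, (hlt _).2 ?_⟩
      have := (sq_lt_one_iff₀ (norm_nonneg (horizontalPart x))).2 h1
      simpa using this
    · exact ⟨-L, ⟨le_rfl, by linarith⟩, h1⟩
  · rintro ⟨t, ⟨ht1, ht2⟩, ht⟩
    rw [hlt] at ht
    rcases lt_or_ge L (x 4) with h | h
    · refine Or.inl (Or.inl ⟨(hlt _).2 ?_, h⟩)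
      nlinarith
    · rcases lt_or_ge (x 4) (-L) with h' | h'
      · refine Or.inr ⟨(hlt _).2 ?_, h'⟩
        nlinarith
      · refine Or.inl (Or.inr ⟨?_, h', h⟩)
        rw [← sq_lt_one_iff₀ (norm_nonneg _)]
        nlinarith [sq_nonneg (x 4 - t)]

theorem isOpen_capsule (hL : 0 < L) : IsOpen (capsule L) := by
  have : capsule L = ⋃ t ∈ Icc (-L) L, Metric.ball (t • northPole) 1 := by
    ext x
    rw [mem_capsule_iff hL]
    simp [dist_eq_norm]
  rw [this]
  exact isOpen_biUnion fun t _ => Metric.isOpen_ball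

theorem convex_capsule (hL : 0 < L) : Convex ℝ (capsule L) := by
  intro x hx y hy a b ha hb hab
  rw [mem_capsule_iff hL] at hx hy ⊢
  obtain ⟨s, hs, hxs⟩ := hx
  obtain ⟨t, ht, hyt⟩ := hy
  refine ⟨a * s + b * t, convex_Icc (-L) L hs ht ha hb hab, ?_⟩
  have := convex_ball (0 : Eucl 5) 1 (x := x - s • northPole) (y := y - t • northPole)
    (by simpa using hxs) (by simpa using hyt) ha hb hab
  rw [mem_ball_zero_iff] at this
  have e : a • x + b • y - (a * s + b * t) • northPole =
      a • (x - s • northPole) + b • (y - t • northPole) := by module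
  rwa [e]

theorem capsule_subset_ball (hL : 0 < L) : capsule L ⊆ Metric.ball 0 (L + 1) := by
  intro x hx
  obtain ⟨t, ht, hxt⟩ := (mem_capsule_iff hL).1 hx
  rw [mem_ball_zero_iff]
  have h1 : ‖x‖ ≤ ‖x - t • northPole‖ + ‖t • northPole‖ := by
    simpa using norm_add_le (x - t • northPole) (t • northPole)
  rw [norm_smul, norm_northPole, mul_one, Real.norm_eq_abs] at h1
  have := abs_le.2 ht
  linarith

theorem smul_northPole_mem_capsule (hL : 0 < L) {t : ℝ} (ht : t ∈ Icc (-L) L) :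
    t • northPole ∈ capsule L :=
  (mem_capsule_iff hL).2 ⟨t, ht, by simp⟩

theorem zero_mem_capsule (hL : 0 < L) : (0 : Eucl 5) ∈ capsule L := by
  simpa using smul_northPole_mem_capsule hL (t := 0) ⟨by linarith, hL.le⟩

/-- The reflection in the last coordinate as an isometry. -/
noncomputable def reflectIso : Eucl 5 ≃ₗᵢ[ℝ] Eucl 5 := (ℝ ∙ northPole)ᗮ.reflection

theorem reflectIso_apply (x : Eucl 5) : reflectIso x = reflectLast x := by
  rw [reflectIso, Submodule.reflection_orthogonal_apply, Submodule.reflection_singleton_apply]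
  have : inner ℝ northPole x = x 4 := by simp [northPole, PiLp.inner_apply]
  rw [this, norm_northPole, reflectLast]
  simp [two_smul, two_mul, add_smul]

/-- The sign of the reflection in the last coordinate in direction `eᵢ`. -/
def reflectSign (i : Fin 5) : ℝ := if i = 4 then -1 else 1

theorem reflectSign_mul_self (i : Fin 5) : reflectSign i * reflectSign i = 1 := by
  rw [reflectSign]; split_ifs <;> norm_num

theorem abs_reflectSign (i : Fin 5) : |reflectSign i| = 1 := by
  rw [reflectSign]; split_ifs <;> norm_num

theorem reflectIso_stdVec (i : Fin 5) : reflectIso (stdVec i) = reflectSign i • stdVec i := by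
  rw [reflectIso_apply, reflectLast, reflectSign, northPole_eq]
  split_ifs with h
  · subst h
    simp only [PiLp.single_apply, if_true]
    module
  · simp [Ne.symm h]

/-- The isometry carrying the upper half ball of the capsule to the upper unit half ball. -/
noncomputable def upperChart (L : ℝ) (x : Eucl 5) : Eucl 5 := x - L • northPole

/-- The isometry carrying the lower half ball of the capsule to the upper unit half ball. -/
noncomputable def lowerChart (L : ℝ) (x : Eucl 5) : Eucl 5 := reflectLast x - L • northPole

theorem upperChart_last (x : Eucl 5) : upperChart L x 4 = x 4 - L := by
  simp [upperChart, northPole_last]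

theorem lowerChart_last (x : Eucl 5) : lowerChart L x 4 = -x 4 - L := by
  simp [lowerChart, reflectLast, northPole_last]; ring

theorem norm_lowerChart (x : Eucl 5) : ‖lowerChart L x‖ = ‖x + L • northPole‖ := by
  have h : lowerChart L x = reflectIso (x + L • northPole) := by
    rw [map_add, map_smul, northPole_eq, reflectIso_stdVec, reflectSign, if_pos rfl,
      reflectIso_apply, lowerChart, northPole_eq]
    module
  rw [h, LinearIsometryEquiv.norm_map]

theorem continuous_upperChart : Continuous (upperChart L) := continuous_id.sub continuous_const

theorem continuous_lowerChart : Continuous (lowerChart L) := by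
  have : lowerChart L = fun x => reflectIso x - L • northPole := by
    ext1 x; rw [reflectIso_apply, lowerChart]
  rw [this]
  exact reflectIso.continuous.sub continuous_const

theorem measurePreserving_upperChart : MeasurePreserving (upperChart L) :=
  measurePreserving_sub_right volume _

theorem measurePreserving_lowerChart : MeasurePreserving (lowerChart L) := by
  have := (measurePreserving_sub_right (volume : Measure (Eucl 5)) (L • northPole)).comp
    reflectIso.measurePreserving
  have e : lowerChart L = (fun x => x - L • northPole) ∘ reflectIso := by
    ext1 x
    rw [Function.comp_apply, reflectIso_apply, lowerChart]
  rwa [e]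

theorem HasWeakPartial.comp_upperChart {f g : Eucl 5 → Eucl 5} {i : Fin 5}
    (h : HasWeakPartial univ i f g) :
    HasWeakPartial univ i (fun x => f (upperChart L x)) (fun x => g (upperChart L x)) := by
  have := h.comp_isometry (LinearIsometryEquiv.refl ℝ _) (-(L • northPole)) (σ := 1) (by simp)
    (by norm_num)
  simpa [upperChart, sub_eq_add_neg] using this

theorem HasWeakPartial.comp_lowerChart {f g : Eucl 5 → Eucl 5} {i : Fin 5}
    (h : HasWeakPartial univ i f g) :
    HasWeakPartial univ i (fun x => f (lowerChart L x))
      (fun x => reflectSign i • g (lowerChart L x)) := by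
  have := h.comp_isometry reflectIso (-(L • northPole)) (reflectIso_stdVec i)
    (reflectSign_mul_self i)
  simpa [lowerChart, sub_eq_add_neg, reflectIso_apply] using this

/-- At every point at least one chart takes values in the lower half space, where `hemiMap` is the
constant `northPole`; so the two contributions add up after one constant is subtracted. The formula
holds in all of `ℝ⁵` and reduces the weak derivatives to those of `hemiMap`. -/
theorem radialExtension_eq (hL : 0 < L) (x : Eucl 5) :
    radialExtension p L x =
      hemiMap p (upperChart L x) + (hemiMap p (lowerChart L x) - northPole) := by
  rw [radialExtension, hemiMap, halfGlue, halfGlue, upperChart_last, lowerChart_last]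
  by_cases h1 : L < x 4
  · have hρ : 0 ≤ radialProj (x - L • northPole) 4 := by
      rw [radialProj_last]
      refine mul_nonneg (by positivity) ?_
      have := upperChart_last (L := L) x
      rw [upperChart] at this
      rw [this]; linarith
    rw [if_pos h1, if_neg (by linarith), if_pos (by linarith), sub_self, add_zero, boundaryMap,
      if_pos (by simp [northPole_last, hρ]), add_sub_cancel_left]
    rfl
  · rw [if_neg h1, if_pos (by linarith : x 4 - L ≤ 0)]
    by_cases h2 : x 4 < -L
    · have hne : x + L • northPole ≠ 0 := by
        intro h
        have := congrArg (fun y : Eucl 5 => y 4) h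
        simp [northPole_last] at this
        linarith
      have hc : (x + L • northPole) 4 = x 4 + L := by simp [northPole_last]
      have hρ : radialProj (x + L • northPole) 4 ≤ 0 := by
        rw [radialProj_last, hc]
        exact mul_nonpos_of_nonneg_of_nonpos (by positivity) (by linarith)
      rw [if_pos h2, if_neg (by linarith), boundaryMap, if_neg, if_pos]
      · rw [Function.comp_apply, add_sub_cancel]
        congr 1
        rw [radialProj, radialProj.eq_def (lowerChart L x), norm_lowerChart]
        simp only [reflectLast, lowerChart, PiLp.add_apply, PiLp.neg_apply, PiLp.smul_apply,
          northPole_last, smul_eq_mul]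
        module
      · simp [northPole_last, hρ]
      · simp [northPole_last]
        linarith
    · rw [if_neg h2, if_pos (by linarith)]
      simp

/-- The weak partial derivatives of the radial extension. -/
noncomputable def radExtGrad (p : Eucl 5 → Eucl 5) (L : ℝ) (i : Fin 5) (x : Eucl 5) : Eucl 5 :=
  hemiGrad p i (upperChart L x) + reflectSign i • hemiGrad p i (lowerChart L x)

/-- The second weak partial derivatives of the radial extension. -/
noncomputable def radExtHess (p : Eucl 5 → Eucl 5) (L : ℝ) (i j : Fin 5) (x : Eucl 5) : Eucl 5 :=
  hemiHess p i j (upperChart L x) +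
    reflectSign i • reflectSign j • hemiHess p i j (lowerChart L x)

theorem hasWeakPartial_radialExtension (hL : 0 < L) (hp : ContDiff ℝ ∞ p)
    (hp_equator : ∀ y : Eucl 5, ‖y‖ = 1 → y 4 = 0 → p y = northPole) (i : Fin 5) :
    HasWeakPartial univ i (radialExtension p L) (radExtGrad p L i) := by
  have h := hasWeakPartial_hemiMap hp hp_equator i
  have h1 := h.comp_upperChart (L := L)
  have h2 := h.comp_lowerChart (L := L)
  have h3 := h1.add (h2.sub (hasWeakPartial_const northPole univ i))
  convert! h3 using 1
  · ext1 x; exact radialExtension_eq hL x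
  · ext1 x; simp [radExtGrad]

theorem hasWeakPartial_radExtGrad (hp : ContDiff ℝ ∞ p)
    (hp_equator : ∀ y : Eucl 5, ‖y‖ = 1 → y 4 = 0 → p y = northPole)
    (hp_deriv : ∀ y : Eucl 5, ‖y‖ = 1 → y 4 = 0 → fderiv ℝ p y northPole = 0) (i j : Fin 5) :
    HasWeakPartial univ j (radExtGrad p L i) (radExtHess p L i j) := by
  have h := hasWeakPartial_hemiGrad hp hp_equator hp_deriv i j
  have h1 := h.comp_upperChart (L := L)
  have h2 := (h.comp_lowerChart (L := L)).clm_comp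
    (reflectSign i • ContinuousLinearMap.id ℝ (Eucl 5))
  exact h1.add h2

end Capsule

/-! ### The radial extension is admissible with energy bounded uniformly in `L` -/

section RadialExtension

open Filter Topology

variable {p : Eucl 5 → Eucl 5} {L : ℝ}

theorem norm_hemiMap (hp_sphere : ∀ y : Eucl 5, ‖y‖ = 1 → 0 ≤ y 4 → ‖p y‖ = 1) (x : Eucl 5) :
    ‖hemiMap p x‖ = 1 := by
  rw [hemiMap, halfGlue]
  split_ifs with h
  · exact norm_northPole
  · have hx : x ≠ 0 := by
      rintro rfl
      simp at h
    refine hp_sphere _ (norm_radialProj hx) ?_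
    rw [radialProj_last]
    exact mul_nonneg (by positivity) (by linarith)

theorem hemiMap_eq_of_nonpos {x : Eucl 5} (hx : x 4 ≤ 0) : hemiMap p x = northPole := by
  rw [hemiMap, halfGlue, if_pos hx]

theorem norm_radialExtension (hL : 0 < L)
    (hp_sphere : ∀ y : Eucl 5, ‖y‖ = 1 → 0 ≤ y 4 → ‖p y‖ = 1) (x : Eucl 5) :
    ‖radialExtension p L x‖ = 1 := by
  rw [radialExtension_eq hL]
  rcases le_total (x 4) 0 with h | h
  · rw [hemiMap_eq_of_nonpos (x := upperChart L x) (by rw [upperChart_last]; linarith)]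
    simpa using norm_hemiMap hp_sphere _
  · rw [hemiMap_eq_of_nonpos (x := lowerChart L x) (by rw [lowerChart_last]; linarith)]
    simpa using norm_hemiMap hp_sphere _

theorem continuousAt_hemiMap (hp : ContDiff ℝ ∞ p)
    (hp_equator : ∀ y : Eucl 5, ‖y‖ = 1 → y 4 = 0 → p y = northPole) {x : Eucl 5} (hx : x ≠ 0) :
    ContinuousAt (hemiMap p) x := by
  have ha := (contDiffAt_comp_radialProj hp hx).continuousAt
  have hc : ContinuousAt (fun y : Eucl 5 => y 4) x :=
    (EuclideanSpace.proj (𝕜 := ℝ) (4 : Fin 5)).continuous.continuousAt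
  rcases lt_trichotomy (x 4) 0 with h | h | h
  · have e : hemiMap p =ᶠ[𝓝 x] fun _ => northPole := by
      filter_upwards [hc.eventually (gt_mem_nhds h)] with y hy
      exact hemiMap_eq_of_nonpos (le_of_lt hy)
    exact continuousAt_const.congr e.symm
  · have hN : (p ∘ radialProj) x = northPole :=
      hp_equator _ (norm_radialProj hx) (by rw [radialProj_last, h, mul_zero])
    rw [ContinuousAt, hemiMap_eq_of_nonpos h.le]
    rw [ContinuousAt, hN] at ha
    exact Tendsto.if (tendsto_const_nhds) (ha.mono_left inf_le_left)
  · have e : hemiMap p =ᶠ[𝓝 x] p ∘ radialProj := by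
      filter_upwards [hc.eventually (lt_mem_nhds h)] with y hy
      rw [hemiMap, halfGlue, if_neg (not_le.2 hy)]
    exact ha.congr e.symm

/-- The map can be discontinuous only at the two centres, and these lie inside the capsule. -/
theorem continuousAt_radialExtension (hL : 0 < L) (hp : ContDiff ℝ ∞ p)
    (hp_equator : ∀ y : Eucl 5, ‖y‖ = 1 → y 4 = 0 → p y = northPole) {x : Eucl 5}
    (hx : x ∉ capsule L) : ContinuousAt (radialExtension p L) x := by
  have e : radialExtension p L = fun x =>
      hemiMap p (upperChart L x) + (hemiMap p (lowerChart L x) - northPole) :=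
    funext (radialExtension_eq hL)
  have h1 : upperChart L x ≠ 0 := by
    intro h
    rw [upperChart, sub_eq_zero] at h
    exact hx (h ▸ smul_northPole_mem_capsule hL ⟨by linarith, le_rfl⟩)
  have h2 : lowerChart L x ≠ 0 := by
    intro h
    rw [← norm_eq_zero, norm_lowerChart, norm_eq_zero, add_eq_zero_iff_eq_neg, ← neg_smul] at h
    exact hx (h ▸ smul_northPole_mem_capsule hL ⟨le_rfl, by linarith⟩)
  rw [e]
  exact ((continuousAt_hemiMap hp hp_equator h1).comp continuous_upperChart.continuousAt).add
    (((continuousAt_hemiMap hp hp_equator h2).comp continuous_lowerChart.continuousAt).sub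
      continuousAt_const)

theorem LocallyIntegrable.comp_homeomorph {f : Eucl 5 → ℝ} (hf : LocallyIntegrable f)
    (A : Eucl 5 ≃ₜ Eucl 5) (hA : MeasurePreserving A) : LocallyIntegrable fun x => f (A x) :=
  (locallyIntegrable_map_homeomorph A (f := f) (μ := volume)).1 (by rwa [hA.map_eq])

/-- `upperChart` as a homeomorphism. -/
noncomputable def upperChartHomeo (L : ℝ) : Eucl 5 ≃ₜ Eucl 5 := Homeomorph.subRight (L • northPole)

/-- `lowerChart` as a homeomorphism. -/
noncomputable def lowerChartHomeo (L : ℝ) : Eucl 5 ≃ₜ Eucl 5 :=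
  reflectIso.toHomeomorph.trans (Homeomorph.subRight (L • northPole))

theorem coe_upperChartHomeo : ⇑(upperChartHomeo L) = upperChart L := rfl

theorem coe_lowerChartHomeo : ⇑(lowerChartHomeo L) = lowerChart L := by
  ext1 x
  change reflectIso x - L • northPole = _
  rw [reflectIso_apply, lowerChart]

theorem LocallyIntegrable.comp_upperChart {f : Eucl 5 → ℝ} (hf : LocallyIntegrable f) :
    LocallyIntegrable fun x => f (upperChart L x) := by
  rw [← coe_upperChartHomeo]
  exact LocallyIntegrable.comp_homeomorph hf _
    (by rw [coe_upperChartHomeo]; exact measurePreserving_upperChart)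

theorem LocallyIntegrable.comp_lowerChart {f : Eucl 5 → ℝ} (hf : LocallyIntegrable f) :
    LocallyIntegrable fun x => f (lowerChart L x) := by
  rw [← coe_lowerChartHomeo]
  exact LocallyIntegrable.comp_homeomorph hf _
    (by rw [coe_lowerChartHomeo]; exact measurePreserving_lowerChart)

theorem locallyIntegrable_norm_add_pow {n m : ℕ} {f g : Eucl n → Eucl m} (hfm : AEStronglyMeasurable f)
    (hgm : AEStronglyMeasurable g) {k : ℕ} (hf : LocallyIntegrable fun x => ‖f x‖ ^ k)
    (hg : LocallyIntegrable fun x => ‖g x‖ ^ k) :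
    LocallyIntegrable fun x => ‖f x + g x‖ ^ k := by
  refine ((hf.add hg).smul ((2 : ℝ) ^ (k - 1))).mono ((hfm.add hgm).norm.pow k)
    (Eventually.of_forall fun x => ?_)
  rw [norm_pow, norm_norm]
  refine (pow_le_pow_left₀ (norm_nonneg _) (norm_add_le _ _) k).trans
    ((add_pow_le (norm_nonneg _) (norm_nonneg _) k).trans (le_abs_self _))

theorem stronglyMeasurable_radExtGrad (i : Fin 5) : StronglyMeasurable (radExtGrad p L i) := by
  have h1 : StronglyMeasurable fun x => hemiGrad p i (upperChart L x) :=
    (stronglyMeasurable_hemiGrad i).comp_measurable continuous_upperChart.measurable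
  have h2 : StronglyMeasurable fun x => hemiGrad p i (lowerChart L x) :=
    (stronglyMeasurable_hemiGrad i).comp_measurable continuous_lowerChart.measurable
  exact h1.add (h2.const_smul (reflectSign i))

theorem stronglyMeasurable_radExtHess (i j : Fin 5) : StronglyMeasurable (radExtHess p L i j) := by
  have h1 : StronglyMeasurable fun x => hemiHess p i j (upperChart L x) :=
    (stronglyMeasurable_hemiHess i j).comp_measurable continuous_upperChart.measurable
  have h2 : StronglyMeasurable fun x => hemiHess p i j (lowerChart L x) :=
    (stronglyMeasurable_hemiHess i j).comp_measurable continuous_lowerChart.measurable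
  exact h1.add ((h2.const_smul (reflectSign j)).const_smul (reflectSign i))

theorem locallyIntegrable_radExtGrad_pow (hp : ContDiff ℝ ∞ p) (i : Fin 5) {k : ℕ} (hk : k < 5) :
    LocallyIntegrable fun x => ‖radExtGrad p L i x‖ ^ k := by
  obtain ⟨C, hC⟩ := exists_bound_hemiGrad hp i
  have h := locallyIntegrable_norm_pow_of_bound (stronglyMeasurable_hemiGrad i) (k := k) hC
    (by omega)
  have h1 : StronglyMeasurable fun x => hemiGrad p i (upperChart L x) :=
    (stronglyMeasurable_hemiGrad i).comp_measurable continuous_upperChart.measurable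
  have h2 : StronglyMeasurable fun x => hemiGrad p i (lowerChart L x) :=
    (stronglyMeasurable_hemiGrad i).comp_measurable continuous_lowerChart.measurable
  have h3 : LocallyIntegrable fun x => ‖reflectSign i • hemiGrad p i (lowerChart L x)‖ ^ k := by
    simp only [norm_smul, Real.norm_eq_abs, abs_reflectSign, one_mul]
    exact LocallyIntegrable.comp_lowerChart h
  exact locallyIntegrable_norm_add_pow h1.aestronglyMeasurable
    (h2.const_smul (reflectSign i)).aestronglyMeasurable (LocallyIntegrable.comp_upperChart h) h3

theorem locallyIntegrable_radExtHess_sq (hp : ContDiff ℝ ∞ p) (i j : Fin 5) :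
    LocallyIntegrable fun x => ‖radExtHess p L i j x‖ ^ 2 := by
  obtain ⟨C, hC⟩ := exists_bound_hemiHess hp i j
  have h := locallyIntegrable_norm_pow_of_bound (stronglyMeasurable_hemiHess i j) (k := 2) hC
    (by norm_num)
  have h1 : StronglyMeasurable fun x => hemiHess p i j (upperChart L x) :=
    (stronglyMeasurable_hemiHess i j).comp_measurable continuous_upperChart.measurable
  have h2 : StronglyMeasurable fun x => hemiHess p i j (lowerChart L x) :=
    (stronglyMeasurable_hemiHess i j).comp_measurable continuous_lowerChart.measurable
  have h3 : LocallyIntegrable fun x =>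
      ‖reflectSign i • reflectSign j • hemiHess p i j (lowerChart L x)‖ ^ 2 := by
    simp only [norm_smul, Real.norm_eq_abs, abs_reflectSign, one_mul]
    exact LocallyIntegrable.comp_lowerChart h
  exact locallyIntegrable_norm_add_pow h1.aestronglyMeasurable
    ((h2.const_smul (reflectSign j)).const_smul (reflectSign i)).aestronglyMeasurable
    (LocallyIntegrable.comp_upperChart h) h3

theorem memLp_two_restrict_capsule (hL : 0 < L) {g : Eucl 5 → Eucl 5}
    (hg : AEStronglyMeasurable g) (h : LocallyIntegrable fun x => ‖g x‖ ^ 2) :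
    MemLp g 2 (volume.restrict (capsule L)) := by
  rw [memLp_two_iff_integrable_sq_norm hg.restrict]
  exact (h.integrableOn_isCompact (isCompact_closedBall 0 (L + 1))).mono_set
    ((capsule_subset_ball hL).trans Metric.ball_subset_closedBall)

theorem memW22_radialExtension (hL : 0 < L) (hp : ContDiff ℝ ∞ p)
    (hp_sphere : ∀ y : Eucl 5, ‖y‖ = 1 → 0 ≤ y 4 → ‖p y‖ = 1)
    (hp_equator : ∀ y : Eucl 5, ‖y‖ = 1 → y 4 = 0 → p y = northPole)
    (hp_deriv : ∀ y : Eucl 5, ‖y‖ = 1 → y 4 = 0 → fderiv ℝ p y northPole = 0) :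
    MemW22 (capsule L) (radialExtension p L) := by
  have hw (i : Fin 5) := hasWeakPartial_radialExtension hL hp hp_equator i
  refine ⟨memLp_two_restrict_capsule hL
      (locallyIntegrableOn_univ.1 (hw 0).locallyIntegrableOn_left).aestronglyMeasurable ?_,
    radExtGrad p L, radExtHess p L, fun i => ⟨memLp_two_restrict_capsule hL
      (stronglyMeasurable_radExtGrad i).aestronglyMeasurable
      (locallyIntegrable_radExtGrad_pow hp i (by norm_num)), (hw i).mono (subset_univ _)⟩,
    fun i j => ⟨memLp_two_restrict_capsule hL
      (stronglyMeasurable_radExtHess i j).aestronglyMeasurable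
      (locallyIntegrable_radExtHess_sq hp i j),
      (hasWeakPartial_radExtGrad hp hp_equator hp_deriv i j).mono (subset_univ _)⟩⟩
  simp only [norm_radialExtension hL hp_sphere, one_pow]
  exact locallyIntegrable_const _

theorem radialExtension_mem_capsuleMaps (hL : 0 < L) (hp : ContDiff ℝ ∞ p)
    (hp_sphere : ∀ y : Eucl 5, ‖y‖ = 1 → 0 ≤ y 4 → ‖p y‖ = 1)
    (hp_equator : ∀ y : Eucl 5, ‖y‖ = 1 → y 4 = 0 → p y = northPole)
    (hp_deriv : ∀ y : Eucl 5, ‖y‖ = 1 → y 4 = 0 → fderiv ℝ p y northPole = 0) :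
    radialExtension p L ∈ capsuleMaps p L := by
  refine ⟨memW22_radialExtension hL hp hp_sphere hp_equator hp_deriv,
    Eventually.of_forall (norm_radialExtension hL hp_sphere), ?_⟩
  rw [sub_self]
  exact memW22Zero_zero (isOpen_capsule hL)

/-- The Laplacian of `hemiMap`. -/
noncomputable def hemiLaplacian (p : Eucl 5 → Eucl 5) (x : Eucl 5) : Eucl 5 :=
  ∑ i, hemiHess p i i x

theorem hemiLaplacian_eq_zero {x : Eucl 5} (hx : x 4 ≤ 0) : hemiLaplacian p x = 0 := by
  simp [hemiLaplacian, hemiHess, halfGlue, hx]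

theorem lintegral_hemiLaplacian_lt_top (hp : ContDiff ℝ ∞ p) :
    ∫⁻ x in Metric.ball 0 1, ‖hemiLaplacian p x‖ₑ ^ 2 < ⊤ := by
  choose C hC using fun i => exists_bound_hemiHess hp i i
  have hm : StronglyMeasurable (hemiLaplacian p) :=
    Finset.stronglyMeasurable_fun_sum _ fun i _ => stronglyMeasurable_hemiHess i i
  have h := locallyIntegrable_norm_pow_of_bound hm (k := 2) (d := 2) (C := ∑ i, C i)
    (fun x hx => by
      rw [Finset.sum_mul]
      exact (norm_sum_le _ _).trans (Finset.sum_le_sum fun i _ => hC i x hx)) (by norm_num)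
  have h2 := ((h.integrableOn_isCompact (isCompact_closedBall 0 1)).mono_set
    Metric.ball_subset_closedBall).2
  simpa [HasFiniteIntegral, enorm_pow] using h2

/-- The energy of the radial extension is bounded independently of the length of the capsule. -/
theorem hessianEnergy_radialExtension_le (hL : 0 < L) (hp : ContDiff ℝ ∞ p)
    (hp_equator : ∀ y : Eucl 5, ‖y‖ = 1 → y 4 = 0 → p y = northPole)
    (hp_deriv : ∀ y : Eucl 5, ‖y‖ = 1 → y 4 = 0 → fderiv ℝ p y northPole = 0) :
    hessianEnergy (capsule L) (radialExtension p L) ≤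
      2 * ∫⁻ x in Metric.ball 0 1, ‖hemiLaplacian p x‖ₑ ^ 2 := by
  rw [hessianEnergy_eq (isOpen_capsule hL)
    (fun i => (hasWeakPartial_radialExtension hL hp hp_equator i).mono (subset_univ _))
    (fun i => (hasWeakPartial_radExtGrad hp hp_equator hp_deriv i i).mono (subset_univ _))]
  set D := hemiLaplacian p
  -- The reflection sign enters squared in each pure second derivative, so the Laplacian commutes
  -- with both charts.
  have hsum (x : Eucl 5) : ∑ i, radExtHess p L i i x = D (upperChart L x) + D (lowerChart L x) := by
    simp only [radExtHess, smul_smul, reflectSign_mul_self, one_smul, Finset.sum_add_distrib, D,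
      hemiLaplacian]
  set k : Eucl 5 → ℝ≥0∞ := (Metric.ball 0 1).indicator fun x => ‖D x‖ₑ ^ 2 with hk
  have hm : Measurable k :=
    (((Finset.stronglyMeasurable_fun_sum _ fun i _ =>
      stronglyMeasurable_hemiHess i i : StronglyMeasurable D).enorm).pow_const 2).indicator
      measurableSet_ball
  -- At each point of the capsule at most one of the two terms is nonzero, and its chart then takes
  -- values in the unit ball. In the cylinder both vanish, hence the independence of `L`.
  have hle (x : Eucl 5) (hx : x ∈ capsule L) :
      ‖∑ i, radExtHess p L i i x‖ₑ ^ 2 ≤ k (upperChart L x) + k (lowerChart L x) := by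
    rw [hsum]
    rcases hx with (⟨h1, h2⟩ | ⟨-, h2, h3⟩) | ⟨h1, h2⟩
    · have e : D (lowerChart L x) = 0 :=
        hemiLaplacian_eq_zero (by rw [lowerChart_last]; linarith)
      rw [e, add_zero, hk, indicator_of_mem (a := upperChart L x)
        (by rw [mem_ball_zero_iff]; exact h1)]
      exact le_self_add
    · have e1 : D (lowerChart L x) = 0 :=
        hemiLaplacian_eq_zero (by rw [lowerChart_last]; linarith)
      have e2 : D (upperChart L x) = 0 :=
        hemiLaplacian_eq_zero (by rw [upperChart_last]; linarith)
      simp [e1, e2]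
    · have e : D (upperChart L x) = 0 :=
        hemiLaplacian_eq_zero (by rw [upperChart_last]; linarith)
      rw [e, zero_add, hk, indicator_of_mem (a := lowerChart L x)
        (by rw [mem_ball_zero_iff, norm_lowerChart]; exact h1)]
      exact le_add_self
  calc ∫⁻ x in capsule L, ‖∑ i, radExtHess p L i i x‖ₑ ^ 2
      ≤ ∫⁻ x in capsule L, k (upperChart L x) + k (lowerChart L x) :=
        setLIntegral_mono' (isOpen_capsule hL).measurableSet hle
    _ ≤ ∫⁻ x, k (upperChart L x) + k (lowerChart L x) := setLIntegral_le_lintegral _ _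
    _ = (∫⁻ x, k x) + ∫⁻ x, k x := by
        rw [lintegral_add_left (f := fun x => k (upperChart L x))
            (hm.comp continuous_upperChart.measurable),
          measurePreserving_upperChart.lintegral_comp hm,
          measurePreserving_lowerChart.lintegral_comp hm]
    _ = 2 * ∫⁻ x in Metric.ball 0 1, ‖D x‖ₑ ^ 2 := by
        rw [← two_mul, hk, lintegral_indicator measurableSet_ball]

end RadialExtension

/-! ### Functions in `W^{2,2}_0` have boundary value zero wherever they have a limit -/

section BoundaryValues

open Filter Topology

theorem sq_lintegral_le {α : Type*} [MeasurableSpace α] (μ : Measure α) {f : α → ℝ≥0∞}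
    (hf : AEMeasurable f μ) : (∫⁻ a, f a ∂μ) ^ 2 ≤ μ univ * ∫⁻ a, f a ^ 2 ∂μ := by
  have h := ENNReal.lintegral_mul_le_Lp_mul_Lq μ Real.HolderConjugate.two_two
    (aemeasurable_const (b := (1 : ℝ≥0∞))) hf
  simp only [Pi.mul_apply, one_mul, ENNReal.rpow_two, one_pow, lintegral_const] at h
  refine (pow_le_pow_left₀ zero_le h 2).trans_eq ?_
  rw [mul_pow, ← ENNReal.rpow_two, ← ENNReal.rpow_two, ← ENNReal.rpow_mul, ← ENNReal.rpow_mul]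
  norm_num

variable {n : ℕ} {F : Type*} [NormedAddCommGroup F] [NormedSpace ℝ F] [CompleteSpace F]
  {Ω : Set (Eucl n)} {l : ℝ}

open scoped Pointwise

theorem lintegral_comp_smul_le {k : Eucl n → ℝ≥0∞} (hk : Measurable k) {s : ℝ} (hs : 1 ≤ s) :
    ∫⁻ x, k (s • x) ≤ ∫⁻ x, k x := by
  have hs0 : 0 < s := by linarith
  rw [← lintegral_map hk (measurable_const_smul s),
    Measure.map_addHaar_smul volume hs0.ne', lintegral_smul_measure, smul_eq_mul]
  refine (mul_le_mul_left (ENNReal.ofReal_le_one.2 ?_) _).trans_eq (one_mul _)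
  rw [abs_of_pos (by positivity)]
  exact inv_le_one_of_one_le₀ (one_le_pow₀ hs)

/-- A differentiable function is controlled by its derivative on a set which the dilation by `l`
moves out of the support of the function. -/
theorem lintegral_sq_le_of_smul_eq_zero {φ : Eucl n → F} {h : Eucl n → ℝ} (hφ : ContDiff ℝ ∞ φ)
    (hh : Continuous h) (hh0 : ∀ x, 0 ≤ h x) (hle : ∀ x y, ‖fderiv ℝ φ x y‖ ≤ h x * ‖y‖) {E : Set (Eucl n)}
    (hE : MeasurableSet E) {M : ℝ} (hM : ∀ x ∈ E, ‖x‖ ≤ M) (hl : 1 ≤ l)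
    (h0 : ∀ x ∈ E, φ (l • x) = 0) :
    ∫⁻ x in E, ‖φ x‖ₑ ^ 2 ≤ ENNReal.ofReal ((l - 1) * M) ^ 2 * ∫⁻ x, ‖h x‖ₑ ^ 2 := by
  set c := ENNReal.ofReal (l - 1)
  have hvol : (volume.restrict (Ioc 1 l)) univ = c := by simp [c]
  have hkc : Continuous fun z : Eucl n × ℝ => ‖h (z.2 • z.1)‖ₑ ^ 2 :=
    (ENNReal.continuous_pow 2).comp (hh.comp (continuous_snd.smul continuous_fst)).enorm
  -- Fundamental theorem of calculus along the ray from `x` to `l • x`, where `φ` vanishes. The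
  -- Cauchy–Schwarz inequality in `s` supplies one factor `c`; the final integration over `s`
  -- supplies the second, since dilations by `s ≥ 1` do not increase the integral.
  have hpt (x : Eucl n) (hx : x ∈ E) :
      ‖φ x‖ₑ ^ 2 ≤ ENNReal.ofReal M ^ 2 * c * ∫⁻ s in Ioc 1 l, ‖h (s • x)‖ₑ ^ 2 := by
    have hd (s : ℝ) : HasDerivAt (fun s : ℝ => φ (s • x)) (fderiv ℝ φ (s • x) x) s := by
      have h1 : HasDerivAt (fun s : ℝ => s • x) x s := by
        simpa using (hasDerivAt_id s).smul_const x
      exact (hφ.differentiable (by simp) _).hasFDerivAt.comp_hasDerivAt s h1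
    have hcont : Continuous fun s : ℝ => fderiv ℝ φ (s • x) x :=
      ((hφ.continuous_fderiv (by simp)).comp (continuous_id.smul continuous_const)).clm_apply
        continuous_const
    have hint := intervalIntegral.integral_eq_sub_of_hasDerivAt (fun s _ => hd s)
      (hcont.intervalIntegrable 1 l)
    rw [h0 x hx, one_smul, zero_sub, intervalIntegral.integral_of_le hl] at hint
    have h1 : ‖φ x‖ₑ ≤ ENNReal.ofReal M * ∫⁻ s in Ioc 1 l, ‖h (s • x)‖ₑ := by
      rw [← enorm_neg, ← hint, ← lintegral_const_mul' _ _ ENNReal.ofReal_ne_top]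
      refine (enorm_integral_le_lintegral_enorm _).trans (lintegral_mono fun s => ?_)
      rw [← ofReal_norm, ← ofReal_norm, ← ENNReal.ofReal_mul' (norm_nonneg _)]
      refine ENNReal.ofReal_le_ofReal ((hle _ _).trans ?_)
      rw [mul_comm]
      exact mul_le_mul (hM x hx) (le_abs_self _)
        (hh0 _) ((norm_nonneg x).trans (hM x hx))
    refine (pow_le_pow_left₀ zero_le h1 2).trans ?_
    rw [mul_pow, mul_assoc, ← hvol]
    gcongr
    exact sq_lintegral_le _
      ((hh.comp (continuous_id.smul continuous_const)).enorm.measurable.aemeasurable)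
  calc ∫⁻ x in E, ‖φ x‖ₑ ^ 2
      ≤ ∫⁻ x in E, ENNReal.ofReal M ^ 2 * c * ∫⁻ s in Ioc 1 l, ‖h (s • x)‖ₑ ^ 2 :=
        setLIntegral_mono' hE hpt
    _ = ENNReal.ofReal M ^ 2 * c * ∫⁻ s in Ioc 1 l, ∫⁻ x in E, ‖h (s • x)‖ₑ ^ 2 := by
        rw [lintegral_const_mul' _ _ (by finiteness), lintegral_lintegral_swap]
        exact hkc.measurable.aemeasurable
    _ ≤ ENNReal.ofReal M ^ 2 * c * ∫⁻ s in Ioc 1 l, ∫⁻ x, ‖h x‖ₑ ^ 2 := by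
        refine mul_le_mul' le_rfl ?_
        refine setLIntegral_mono' measurableSet_Ioc fun s hs => ?_
        exact (setLIntegral_le_lintegral _ _).trans
          (lintegral_comp_smul_le (k := fun x => ‖h x‖ₑ ^ 2) ((ENNReal.continuous_pow 2).comp hh.enorm).measurable hs.1.le)
    _ = ENNReal.ofReal ((l - 1) * M) ^ 2 * ∫⁻ x, ‖h x‖ₑ ^ 2 := by
        rw [lintegral_const, hvol, ENNReal.ofReal_mul (by linarith)]
        ring

theorem eLpNorm_two_eq {μ : Measure (Eucl n)} {G : Type*} [NormedAddCommGroup G]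
    (f : Eucl n → G) : eLpNorm f 2 μ ^ 2 = ∫⁻ x, ‖f x‖ₑ ^ 2 ∂μ := by
  have := eLpNorm_nnreal_pow_eq_lintegral (f := f) (μ := μ) (p := 2) (by norm_num)
  simpa using this

theorem norm_fderiv_apply_le_sum {φ : Eucl n → F} (x y : Eucl n) :
    ‖fderiv ℝ φ x y‖ ≤ (∑ i, ‖fderiv ℝ φ x (stdVec i)‖) * ‖y‖ := by
  have hy : y = ∑ i, y i • stdVec i := by
    ext j
    simp [stdVec, Pi.single_apply]
  conv_lhs => rw [hy, map_sum]
  rw [Finset.sum_mul]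
  refine (norm_sum_le _ _).trans (Finset.sum_le_sum fun i _ => ?_)
  rw [map_smul, norm_smul, mul_comm]
  gcongr
  exact PiLp.norm_apply_le y i

theorem IsTestFunction.eLpNorm_le_of_smul_notMem {φ : Eucl n → F} (hφ : IsTestFunction Ω φ)
    {E : Set (Eucl n)} (hE : MeasurableSet E) {M : ℝ} (hM : ∀ x ∈ E, ‖x‖ ≤ M) (hl : 1 ≤ l)
    (h0 : ∀ x ∈ E, l • x ∉ Ω) :
    eLpNorm φ 2 (volume.restrict E) ≤ ENNReal.ofReal ((l - 1) * M) *
      ∑ i, eLpNorm (fun x => fderiv ℝ φ x (stdVec i)) 2 volume := by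
  have hc (i : Fin n) : Continuous fun x => fderiv ℝ φ x (stdVec i) :=
    (hφ.contDiff.fderiv_apply_const _).continuous
  set h : Eucl n → ℝ := ∑ i, fun x => ‖fderiv ℝ φ x (stdVec i)‖ with hh
  have hhx (x : Eucl n) : h x = ∑ i, ‖fderiv ℝ φ x (stdVec i)‖ := by simp [hh]
  have hhc : Continuous h := by
    rw [funext hhx]
    exact continuous_finsetSum _ fun i _ => (hc i).norm
  have key := lintegral_sq_le_of_smul_eq_zero hφ.contDiff hhc
    (fun x => by rw [hhx]; positivity)
    (fun x y => by rw [hhx]; exact norm_fderiv_apply_le_sum x y) hE hM hl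
    (fun x hx => hφ.eq_zero (h0 x hx))
  rw [← eLpNorm_two_eq, ← eLpNorm_two_eq, ← mul_pow] at key
  refine ((ENNReal.pow_le_pow_left_iff two_ne_zero).1 key).trans ?_
  gcongr
  refine (eLpNorm_sum_le (fun i _ => (hc i).norm.aestronglyMeasurable) (by norm_num)).trans ?_
  simp [eLpNorm_norm]

/-- An estimate of Poincaré type in a thin layer at the boundary. The test function is chosen with
the accuracy `l - 1`, so the approximation error has the order of the bound itself; `K` depends
neither on `l` nor on the layer `E`. -/
theorem MemW22Zero.exists_forall_eLpNorm_le (hΩ : IsOpen Ω) {w : Eucl n → F}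
    (hw : MemW22Zero Ω w) {M : ℝ} (hM : ∀ x ∈ Ω, ‖x‖ ≤ M) :
    ∃ K : ℝ≥0∞, K ≠ ⊤ ∧ ∀ l : ℝ, 1 < l → l ≤ 2 → ∀ E ⊆ Ω, MeasurableSet E →
      (∀ x ∈ E, l • x ∉ Ω) →
      eLpNorm w 2 (volume.restrict E) ≤ ENNReal.ofReal (l - 1) * K := by
  obtain ⟨⟨hw2, G, H, hG, hH⟩, -⟩ := id hw
  refine ⟨1 + ENNReal.ofReal M * ∑ i, (1 + eLpNorm (G i) 2 (volume.restrict Ω)),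
    by
      have (i : Fin n) := (hG i).1.2.ne
      exact ENNReal.add_ne_top.2 ⟨ENNReal.one_ne_top, ENNReal.mul_ne_top ENNReal.ofReal_ne_top
        (ENNReal.sum_ne_top.2 fun i _ => ENNReal.add_ne_top.2 ⟨ENNReal.one_ne_top, this i⟩)⟩,
    fun l hl hl2 E hE hEm h0 => ?_⟩
  have hε : 0 < ENNReal.ofReal (l - 1) := by simpa using hl
  obtain ⟨φ, hφ, h1, h2, -⟩ := hw.exists_approx hΩ (fun i => (hG i).2) (fun i j => (hH i j).2) hε
  have hφm : AEStronglyMeasurable φ (volume.restrict E) := hφ.continuous.aestronglyMeasurable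
  have e : w = (fun x => w x - φ x) + φ := by ext x; simp
  have h3 : eLpNorm w 2 (volume.restrict E) ≤
      ENNReal.ofReal (l - 1) + eLpNorm φ 2 (volume.restrict E) := by
    conv_lhs => rw [e]
    have hwm : AEStronglyMeasurable w (volume.restrict E) := hw2.1.mono_set hE
    refine (eLpNorm_add_le (hwm.sub hφm) hφm (by norm_num)).trans ?_
    gcongr
    exact (eLpNorm_mono_measure _ (Measure.restrict_mono hE le_rfl)).trans h1.le
  have h4 (i : Fin n) : eLpNorm (fun x => fderiv ℝ φ x (stdVec i)) 2 volume ≤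
      1 + eLpNorm (G i) 2 (volume.restrict Ω) := by
    have ht := hφ.fderiv_apply (stdVec i)
    have hm : AEStronglyMeasurable (fun x => fderiv ℝ φ x (stdVec i)) (volume.restrict Ω) :=
      ht.continuous.aestronglyMeasurable
    have e1 : (fun x => fderiv ℝ φ x (stdVec i)) =
        Ω.indicator fun x => fderiv ℝ φ x (stdVec i) :=
      (indicator_eq_self.2 fun x hx => by
        by_contra h
        exact hx (ht.eq_zero h)).symm
    rw [e1, eLpNorm_indicator_eq_eLpNorm_restrict hΩ.measurableSet]
    have e2 : (fun x => fderiv ℝ φ x (stdVec i)) =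
        G i - (fun x => G i x - fderiv ℝ φ x (stdVec i)) := by ext1 x; simp
    conv_lhs => rw [e2]
    refine (eLpNorm_sub_le (hG i).1.1 ((hG i).1.1.sub hm) (by norm_num)).trans ?_
    rw [add_comm]
    gcongr
    refine (h2 i).le.trans (ENNReal.ofReal_le_one.2 (by linarith))
  refine h3.trans ?_
  rw [mul_add, mul_one, ← mul_assoc, ← ENNReal.ofReal_mul (by linarith)]
  gcongr
  refine (hφ.eLpNorm_le_of_smul_notMem hEm (fun x hx => hM x (hE hx)) hl.le h0).trans ?_
  gcongr with i
  exact h4 i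

/-- A convex domain is star-shaped about an interior point with a boundary that is a continuous
radial graph. If `y` is close to `x₀` and the ray through `y` leaves `Ω` between `t • y` and `l • t
• y`, it does so close to `x₀`. -/
theorem exists_forall_norm_smul_sub_lt (hΩ : IsOpen Ω) (hc : Convex ℝ Ω) (h0 : 0 ∈ Ω)
    {x₀ : Eucl n} (hx₀ : x₀ ∈ frontier Ω) {ε : ℝ} (hε : 0 < ε) :
    ∃ ρ > 0, ∃ τ > 0, ∀ l t : ℝ, 1 < l → l < 1 + τ → 0 < t → ∀ y ∈ Metric.ball x₀ ρ,
      t • y ∈ Ω → l • t • y ∉ Ω → ‖t • y - x₀‖ < ε := by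
  obtain ⟨r, hr, hball⟩ := Metric.isOpen_iff.1 hΩ 0 h0
  have hxΩ : x₀ ∉ Ω := by
    rw [hΩ.frontier_eq] at hx₀
    exact hx₀.2
  have hin (z : Eucl n) (hz : ‖z‖ < r) : z ∈ interior Ω := by
    rw [hΩ.interior_eq]
    exact hball (by simpa using hz)
  set X := ‖x₀‖
  have hX : 0 ≤ X := norm_nonneg _
  obtain ⟨a, ha, ha2, haε⟩ : ∃ a : ℝ, 0 < a ∧ a ≤ 1 / 2 ∧ 2 * a * r + 2 * a * X < ε / 2 := by
    refine ⟨min (1 / 2) (ε / (8 * (r + X))), by positivity, min_le_left _ _, ?_⟩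
    have h1 := min_le_right (1 / 2) (ε / (8 * (r + X)))
    rw [le_div_iff₀ (by positivity)] at h1
    linarith
  obtain ⟨τ, hτ, hτ1, hτε⟩ : ∃ τ : ℝ, 0 < τ ∧ τ ≤ 1 ∧ 2 * τ * X ≤ ε / 2 := by
    refine ⟨min 1 (ε / (4 * (1 + X))), by positivity, min_le_left _ _, ?_⟩
    have h1 := min_le_right 1 (ε / (4 * (1 + X)))
    have h2 : 0 < min 1 (ε / (4 * (1 + X))) := by positivity
    rw [le_div_iff₀ (by positivity)] at h1
    linarith
  refine ⟨a * r, by positivity, τ, hτ, fun l t hl hlτ ht y hy hty hlty => ?_⟩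
  rw [mem_ball_iff_norm] at hy
  -- For larger `t` the point `x₀` would be a convex combination of `t • y`, which is in `Ω`, and a
  -- point of the ball about 0, hence an interior point.
  have h1 : t * (1 - a) ≤ 1 := by
    by_contra! hcon
    have ht1 : 1 < t := by nlinarith
    refine hxΩ (interior_subset ?_)
    have hb : 0 < 1 - t⁻¹ := by
      have := inv_lt_one_of_one_lt₀ ht1
      linarith
    have hz : ‖(1 - t⁻¹)⁻¹ • (x₀ - y)‖ < r := by
      rw [norm_smul, norm_sub_rev, Real.norm_eq_abs, abs_of_pos (inv_pos.2 hb),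
        inv_mul_lt_iff₀ hb]
      refine hy.trans_le (mul_le_mul_of_nonneg_right ?_ hr.le)
      have : t⁻¹ < 1 - a := (inv_lt_iff_one_lt_mul₀' ht).2 hcon
      linarith
    have := hc.combo_closure_interior_mem_interior (subset_closure hty) (hin _ hz)
      (inv_pos.2 ht).le hb (by ring)
    rwa [smul_smul, smul_smul, inv_mul_cancel₀ ht.ne', mul_inv_cancel₀ hb.ne', one_smul, one_smul,
      add_sub_cancel] at this
  -- Otherwise `l • t • y` would be a convex combination of `x₀` and a point of the ball about 0,
  -- hence in `Ω`.
  have h2 : 1 ≤ l * t * (1 + a) := by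
    by_contra! hcon
    have hlt : 0 < l * t := by positivity
    have hb : 0 < 1 - l * t := by nlinarith
    have hz : ‖(1 - l * t)⁻¹ • ((l * t) • (y - x₀))‖ < r := by
      rw [norm_smul, norm_smul, Real.norm_eq_abs, Real.norm_eq_abs, abs_of_pos (inv_pos.2 hb),
        abs_of_pos hlt, inv_mul_lt_iff₀ hb]
      refine (mul_lt_mul_of_pos_left hy hlt).trans_le ?_
      rw [← mul_assoc]
      exact mul_le_mul_of_nonneg_right (by nlinarith) hr.le
    have := hc.combo_closure_interior_mem_interior (frontier_subset_closure hx₀) (hin _ hz)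
      hlt.le hb (by ring)
    rw [smul_smul, smul_smul, ← mul_assoc, mul_inv_cancel₀ hb.ne', one_mul, ← smul_add,
      add_sub_cancel, ← smul_smul] at this
    exact hlty (interior_subset this)
  have h3 : |t - 1| ≤ 2 * a + 2 * τ := by
    have h4 : l * (1 + a) ≤ 1 + 2 * τ + a := by nlinarith
    have h5 : 1 ≤ t * (1 + 2 * τ + a) := by nlinarith
    rw [abs_le]
    constructor <;> nlinarith
  have ht2 : t ≤ 2 := by nlinarith
  calc ‖t • y - x₀‖ = ‖t • (y - x₀) + (t - 1) • x₀‖ := by congr 1; module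
    _ ≤ t * ‖y - x₀‖ + |t - 1| * X := by
        refine (norm_add_le _ _).trans_eq ?_
        rw [norm_smul, norm_smul, Real.norm_eq_abs, Real.norm_eq_abs, abs_of_pos ht]
    _ ≤ 2 * (a * r) + (2 * a + 2 * τ) * X := by gcongr
    _ < ε := by linarith

/-- A map in `W^{2,2}_0(Ω)` which has a limit at a boundary point has the limit zero there. -/
theorem MemW22Zero.eq_zero_of_tendsto (hn : n ≠ 0) (hΩ : IsOpen Ω) (hc : Convex ℝ Ω) (h0 : 0 ∈ Ω)
    (hb : Bornology.IsBounded Ω) {w : Eucl n → F} (hw : MemW22Zero Ω w) {x₀ : Eucl n}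
    (hx₀ : x₀ ∈ frontier Ω) {a : F} (ha : Tendsto w (𝓝[Ω] x₀) (𝓝 a)) : a = 0 := by
  by_contra hne
  have hδ : 0 < ‖a‖ / 2 := by positivity
  set δ := ‖a‖ / 2 with hδdef
  obtain ⟨ε, hε, hwε⟩ : ∃ ε > 0, ∀ x ∈ Ω, ‖x - x₀‖ < ε → δ ≤ ‖w x‖ := by
    have h1 : ∀ᶠ x in 𝓝[Ω] x₀, δ < ‖w x‖ :=
      ha.norm.eventually (lt_mem_nhds (by rw [hδdef]; linarith))
    obtain ⟨ε, hε, h⟩ := Metric.mem_nhdsWithin_iff.1 h1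
    exact ⟨ε, hε, fun x hx hlt => le_of_lt (h ⟨mem_ball_iff_norm.2 hlt, hx⟩)⟩
  obtain ⟨M, hM⟩ := hb.exists_norm_le
  obtain ⟨K, hK, hKle⟩ := hw.exists_forall_eLpNorm_le hΩ hM
  obtain ⟨ρ, hρ, τ, hτ, hnear⟩ := exists_forall_norm_smul_sub_lt hΩ hc h0 hx₀ hε
  -- The part in `Ω` of the cone over a small ball about `x₀`. Within `Ω` it is stable under
  -- dilations, so a point of `A` leaves `A` by a dilation only if it leaves `Ω`.
  set A : Set (Eucl n) := (⋃ t ∈ Ioi (0 : ℝ), t • Metric.ball x₀ ρ) ∩ Ω with hA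
  have hAo : IsOpen A := by
    have hto (t : ℝ) (ht : t ∈ Ioi (0 : ℝ)) : IsOpen (t • Metric.ball x₀ ρ) :=
      IsOpen.smul₀ Metric.isOpen_ball (ne_of_gt ht)
    exact (isOpen_biUnion hto).inter hΩ
  have hA0 : 0 < volume A := by
    refine hAo.measure_pos _ ?_
    obtain ⟨x, hx, hxΩ⟩ := mem_closure_iff.1 (frontier_subset_closure hx₀) _ Metric.isOpen_ball
      (Metric.mem_ball_self hρ)
    refine ⟨x, mem_biUnion (mem_Ioi.2 one_pos) ?_, hxΩ⟩
    rwa [one_smul]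
  have hAtop : volume A < ⊤ :=
    (measure_mono inter_subset_right).trans_lt hb.measure_lt_top
  -- On the layer `A \ l⁻¹ • A` the norm of `w` is at least `δ`, and the layer has volume at least
  -- `(l - 1) / 2` times that of `A`. The square integral of `w` there is at most `(l - 1)² K²`. As
  -- `l` decreases to 1, the two rates are incompatible.
  have key (l : ℝ) (hl : 1 < l) (hl2 : l ≤ 2) (hlτ : l < 1 + τ) :
      ENNReal.ofReal δ ^ 2 * volume A ≤ ENNReal.ofReal (l - 1) * (2 * K ^ 2) := by
    have hl0 : 0 < l := by linarith
    set E : Set (Eucl n) := A \ (l⁻¹ • A)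
    have hEm : MeasurableSet E :=
      hAo.measurableSet.diff (hAo.smul₀ (inv_ne_zero hl0.ne')).measurableSet
    have hEA : E ⊆ A := sdiff_subset
    have hEl : ∀ x ∈ E, l • x ∉ Ω := by
      rintro x ⟨⟨hx1, hx2⟩, hx3⟩ hlx
      refine hx3 ((mem_inv_smul_set_iff₀ hl0.ne' _ _).2 ⟨?_, hlx⟩)
      obtain ⟨t, ht, y, hy, rfl⟩ := mem_iUnion₂.1 hx1
      exact mem_biUnion (mem_Ioi.2 (mul_pos hl0 ht)) ⟨y, hy, by simp only [smul_smul]⟩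
    have hEδ : ∀ x ∈ E, ENNReal.ofReal δ ≤ ‖w x‖ₑ := by
      intro x hx
      obtain ⟨t, ht, y, hy, rfl⟩ := mem_iUnion₂.1 (hEA hx).1
      rw [← ofReal_norm]
      exact ENNReal.ofReal_le_ofReal
        (hwε _ (hEA hx).2 (hnear l t hl hlτ ht y hy (hEA hx).2 (hEl _ hx)))
    have h1 : ENNReal.ofReal δ ^ 2 * volume E ≤ (ENNReal.ofReal (l - 1) * K) ^ 2 := by
      refine le_trans ?_ (pow_le_pow_left₀ zero_le
        (hKle l hl hl2 E (hEA.trans inter_subset_right) hEm hEl) 2)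
      rw [eLpNorm_two_eq, ← setLIntegral_const]
      exact setLIntegral_mono' hEm fun x hx => pow_le_pow_left₀ zero_le (hEδ x hx) 2
    have h2 : ENNReal.ofReal (l - 1) * volume A ≤ 2 * volume E := by
      have h3 : volume (l⁻¹ • A) ≤ ENNReal.ofReal l⁻¹ * volume A := by
        rw [Measure.addHaar_smul]
        gcongr
        rw [finrank_euclideanSpace_fin, abs_of_pos (by positivity)]
        exact pow_le_of_le_one (by positivity) (inv_le_one_of_one_le₀ hl.le) hn
      have h4 : volume A ≤ ENNReal.ofReal l⁻¹ * volume A + volume E := by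
        refine (measure_mono (t := (l⁻¹ • A) ∪ E) ?_).trans
          ((measure_union_le _ _).trans (by gcongr))
        rw [union_sdiff_self]
        exact subset_union_right
      have h5 : ENNReal.ofReal (1 - l⁻¹) * volume A ≤ volume E := by
        rw [ENNReal.ofReal_sub _ (by positivity), ENNReal.ofReal_one,
          ENNReal.sub_mul (fun _ _ => hAtop.ne), one_mul]
        exact tsub_le_iff_left.2 h4
      refine le_trans ?_ (mul_le_mul' le_rfl h5)
      have e2 : 2 * ENNReal.ofReal (1 - l⁻¹) = ENNReal.ofReal (2 * (1 - l⁻¹)) := by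
        rw [ENNReal.ofReal_mul (by norm_num), ENNReal.ofReal_ofNat]
      rw [← mul_assoc, e2]
      gcongr
      have h6 : l⁻¹ * l = 1 := inv_mul_cancel₀ hl0.ne'
      have h7 : 0 < l⁻¹ := by positivity
      nlinarith
    have h3 : ENNReal.ofReal (l - 1) * (ENNReal.ofReal δ ^ 2 * volume A) ≤
        ENNReal.ofReal (l - 1) * (ENNReal.ofReal (l - 1) * (2 * K ^ 2)) := by
      calc ENNReal.ofReal (l - 1) * (ENNReal.ofReal δ ^ 2 * volume A)
          = ENNReal.ofReal δ ^ 2 * (ENNReal.ofReal (l - 1) * volume A) := by ring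
        _ ≤ ENNReal.ofReal δ ^ 2 * (2 * volume E) := by gcongr
        _ = 2 * (ENNReal.ofReal δ ^ 2 * volume E) := by ring
        _ ≤ 2 * (ENNReal.ofReal (l - 1) * K) ^ 2 := by gcongr
        _ = _ := by ring
    exact (ENNReal.mul_le_mul_iff_right (by simpa using hl) ENNReal.ofReal_ne_top).1 h3
  have hlim : Tendsto (fun l : ℝ => ENNReal.ofReal (l - 1) * (2 * K ^ 2)) (𝓝[>] 1) (𝓝 0) := by
    have h1 : Tendsto (fun l : ℝ => ENNReal.ofReal (l - 1)) (𝓝[>] 1) (𝓝 (ENNReal.ofReal (1 - 1))) :=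
      (ENNReal.continuous_ofReal.tendsto _).comp
        (((continuous_id.sub continuous_const).tendsto 1).mono_left inf_le_left)
    have h2 := ENNReal.Tendsto.mul_const (b := 2 * K ^ 2) h1 (Or.inr (by finiteness))
    simpa using h2
  have hle : ENNReal.ofReal δ ^ 2 * volume A ≤ 0 := by
    refine ge_of_tendsto hlim ?_
    filter_upwards [Ioo_mem_nhdsGT (show (1 : ℝ) < min 2 (1 + τ) by simp [hτ])] with l hl
    exact key l hl.1 (hl.2.le.trans (min_le_left _ _)) (hl.2.trans_le (min_le_right _ _))
  have hpos : 0 < ENNReal.ofReal δ ^ 2 * volume A :=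
    ENNReal.mul_pos (pow_ne_zero _ (by simpa using hδ)) hA0.ne'
  exact absurd hle (not_le.2 hpos)

end BoundaryValues

/-! ### Continuation of a continuous competitor to the whole space -/

section ContinuousCompetitor

open Filter Topology

variable {p : Eucl 5 → Eucl 5} {L : ℝ}

/-- At a boundary point `v - f` has a limit from inside, and this limit is zero because `v - f` is
in `W^{2,2}_0`. So the indicator creates no jump. Continuity of `f` is not needed in `Ω`, where the
sum is just `v`. -/
theorem continuous_add_indicator {n : ℕ} {F : Type*} [NormedAddCommGroup F] [NormedSpace ℝ F]
    [CompleteSpace F] {Ω : Set (Eucl n)} (hn : n ≠ 0) (hΩ : IsOpen Ω) (hc : Convex ℝ Ω)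
    (h0 : 0 ∈ Ω) (hb : Bornology.IsBounded Ω) {v f : Eucl n → F}
    (hv : ContinuousOn v (closure Ω)) (hf : ∀ x ∉ Ω, ContinuousAt f x)
    (hw : MemW22Zero Ω (v - f)) : Continuous fun x => f x + Ω.indicator (v - f) x := by
  rw [continuous_iff_continuousAt]
  intro x
  by_cases hx : x ∈ Ω
  · refine ((hv x (subset_closure hx)).continuousAt
      (mem_of_superset (hΩ.mem_nhds hx) subset_closure)).congr ?_
    filter_upwards [hΩ.mem_nhds hx] with y hy
    simp [indicator_of_mem hy]
  · refine (hf x hx).add ?_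
    rw [ContinuousAt, indicator_of_notMem hx, ← nhdsWithin_univ, ← union_compl_self Ω,
      nhdsWithin_union, tendsto_sup]
    constructor
    · by_cases hxc : x ∈ closure Ω
      · have h1 : Tendsto (v - f) (𝓝[Ω] x) (𝓝 (v x - f x)) :=
          ((hv x hxc).mono_left (nhdsWithin_mono _ subset_closure)).sub
            ((hf x hx).mono_left inf_le_left)
        have h2 := hw.eq_zero_of_tendsto hn hΩ hc h0 hb
          (by rw [hΩ.frontier_eq]; exact ⟨hxc, hx⟩) h1
        rw [h2] at h1
        exact h1.congr' (by filter_upwards [self_mem_nhdsWithin] with y hy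
                            rw [indicator_of_mem hy])
      · rw [mem_closure_iff_nhdsWithin_neBot, not_neBot] at hxc
        rw [hxc]
        exact tendsto_bot
    · refine tendsto_const_nhds.congr' ?_
      filter_upwards [self_mem_nhdsWithin] with y hy
      rw [indicator_of_notMem hy]

theorem LocSqIntegrable.add_indicator {n m : ℕ} {Ω : Set (Eucl n)} {f g : Eucl n → Eucl m}
    (hΩ : MeasurableSet Ω) (hf : LocSqIntegrable f) (hg : MemLp g 2 (volume.restrict Ω)) :
    LocSqIntegrable fun x => f x + Ω.indicator g x := by
  have h1 : MemLp (Ω.indicator g) 2 volume := (memLp_indicator_iff_restrict hΩ).2 hg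
  refine ⟨hf.1.add h1.1, ?_⟩
  have h2 : LocallyIntegrable fun x => ‖Ω.indicator g x‖ ^ 2 :=
    ((memLp_two_iff_integrable_sq_norm h1.1).1 h1).locallyIntegrable
  exact locallyIntegrable_norm_add_pow hf.1 h1.1 hf.2 h2

/-- A continuous map of the class, extended by the radial extension to all of `ℝ⁵`. -/
theorem exists_continuous_extension (hL : 0 < L) (hp : ContDiff ℝ ∞ p)
    (hp_sphere : ∀ y : Eucl 5, ‖y‖ = 1 → 0 ≤ y 4 → ‖p y‖ = 1)
    (hp_equator : ∀ y : Eucl 5, ‖y‖ = 1 → y 4 = 0 → p y = northPole)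
    (hp_deriv : ∀ y : Eucl 5, ‖y‖ = 1 → y 4 = 0 → fderiv ℝ p y northPole = 0)
    {v : Eucl 5 → Eucl 5} (hv : v ∈ capsuleMaps p L)
    (hvc : ContinuousOn v (closure (capsule L))) (hE : hessianEnergy (capsule L) v < ⊤) :
    ∃ (u : Eucl 5 → Eucl 5) (G : Fin 5 → Eucl 5 → Eucl 5), Continuous u ∧ (∀ x, ‖u x‖ = 1) ∧
      (∀ i, HasWeakPartial univ i u (G i)) ∧ (∀ i, LocallyIntegrable fun x => ‖G i x‖ ^ 4) ∧
      (∀ x ∉ capsule L, u x = radialExtension p L x ∧ ∀ i, G i x = radExtGrad p L i x) ∧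
      ∫⁻ x in capsule L, ENNReal.ofReal ((∑ i, ‖G i x‖ ^ 2) ^ 2) ≤
        hessianEnergy (capsule L) v := by
  set Ω := capsule L
  have hΩ : IsOpen Ω := isOpen_capsule hL
  obtain ⟨-, hv1, hw⟩ := hv
  obtain ⟨⟨-, G, K, hG, hK⟩, -⟩ := id hw
  obtain ⟨hGi, hKi⟩ := hw.hasWeakPartial_indicator hΩ hG hK
  set u : Eucl 5 → Eucl 5 := fun x =>
    radialExtension p L x + Ω.indicator (v - radialExtension p L) x with hu
  set U : Fin 5 → Eucl 5 → Eucl 5 := fun i x => radExtGrad p L i x + Ω.indicator (G i) x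
  set V : Fin 5 → Eucl 5 → Eucl 5 := fun i x => radExtHess p L i i x + Ω.indicator (K i i) x
  have huv : EqOn u v Ω := fun x hx => by simp [hu, indicator_of_mem hx]
  have hcont : Continuous u :=
    continuous_add_indicator (by norm_num) hΩ (convex_capsule hL) (zero_mem_capsule hL)
      (Metric.isBounded_ball.subset (capsule_subset_ball hL)) hvc
      (fun x hx => continuousAt_radialExtension hL hp hp_equator hx) hw
  -- Inside `Ω` the constraint is known almost everywhere only; continuity and openness give it at
  -- every point.
  have hnorm (x : Eucl 5) : ‖u x‖ = 1 := by
    by_cases hx : x ∈ Ω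
    · have h1 : EqOn (fun x => ‖u x‖) (fun _ => (1 : ℝ)) Ω := by
        refine Measure.eqOn_open_of_ae_eq (μ := volume) ?_ hΩ hcont.norm.continuousOn
          continuousOn_const
        filter_upwards [hv1, ae_restrict_mem hΩ.measurableSet] with y hy hyΩ
        rw [huv hyΩ, hy]
      exact h1 hx
    · simp only [hu, indicator_of_notMem hx, add_zero]
      exact norm_radialExtension hL hp_sphere x
  have hU (i : Fin 5) : HasWeakPartial univ i u (U i) :=
    (hasWeakPartial_radialExtension hL hp hp_equator i).add (hGi i)
  have hV (i : Fin 5) : HasWeakPartial univ i (U i) (V i) :=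
    (hasWeakPartial_radExtGrad hp hp_equator hp_deriv i i).add (hKi i i)
  have hu2 : LocSqIntegrable u := ⟨hcont.aestronglyMeasurable, by
    simp only [hnorm, one_pow]
    exact locallyIntegrable_const _⟩
  have hU2 (i : Fin 5) : LocSqIntegrable (U i) :=
    LocSqIntegrable.add_indicator hΩ.measurableSet
      ⟨(stronglyMeasurable_radExtGrad i).aestronglyMeasurable,
        locallyIntegrable_radExtGrad_pow hp i (by norm_num)⟩ (hG i).1
  have hV2 (i : Fin 5) : LocSqIntegrable (V i) :=
    LocSqIntegrable.add_indicator hΩ.measurableSet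
      ⟨(stronglyMeasurable_radExtHess i i).aestronglyMeasurable,
        locallyIntegrable_radExtHess_sq hp i i⟩ (hK i i).1
  have hid := norm_sq_gradient_eq_of_norm_eq_one (Eventually.of_forall hnorm) hU hV hu2 hU2 hV2
  -- From `|∇u|² = -⟨u, Δu⟩` and `|u| = 1` follows `|∇u|² ≤ |Δu|`; this is then squared and
  -- integrated.
  have henergy : ∫⁻ x in Ω, ENNReal.ofReal ((∑ i, ‖U i x‖ ^ 2) ^ 2) ≤ hessianEnergy Ω v := by
    rw [hessianEnergy_eq hΩ (g := U) (k := V)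
      (fun i => ((hU i).mono (subset_univ _)).congr
        (by filter_upwards [ae_restrict_mem hΩ.measurableSet] with x hx using huv hx)
        (ae_eq_refl _))
      (fun i => (hV i).mono (subset_univ _))]
    refine lintegral_mono_ae ?_
    filter_upwards [ae_restrict_of_ae hid] with x hx
    rw [← ofReal_norm, ← ENNReal.ofReal_pow (norm_nonneg _)]
    refine ENNReal.ofReal_le_ofReal (pow_le_pow_left₀ (by positivity) ?_ 2)
    rw [hx]
    refine (neg_le_abs _).trans ((abs_real_inner_le_norm _ _).trans ?_)
    rw [hnorm, one_mul]
  have hout (x : Eucl 5) (hx : x ∉ Ω) :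
      u x = radialExtension p L x ∧ ∀ i, U i x = radExtGrad p L i x := by
    simp [hu, U, indicator_of_notMem hx]
  refine ⟨u, U, hcont, hnorm, hU, fun i => ?_, hout, henergy⟩
  have h1 : IntegrableOn (fun x => ‖U i x‖ ^ 4) Ω := by
    refine ⟨((hU2 i).1.norm.pow 4).restrict, ?_⟩
    refine (lintegral_mono fun x => ?_).trans_lt (henergy.trans_lt hE)
    rw [Real.enorm_eq_ofReal (by positivity)]
    refine ENNReal.ofReal_le_ofReal ?_
    calc ‖U i x‖ ^ 4 = (‖U i x‖ ^ 2) ^ 2 := by ring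
      _ ≤ _ := by
        gcongr
        exact Finset.single_le_sum (f := fun i => ‖U i x‖ ^ 2) (fun _ _ => by positivity)
          (Finset.mem_univ i)
  have h2 := (integrable_indicator_iff hΩ.measurableSet).2 h1
  refine (h2.locallyIntegrable.add (locallyIntegrable_radExtGrad_pow (L := L) hp i
    (k := 4) (by norm_num))).mono ((hU2 i).1.norm.pow 4) (Eventually.of_forall fun x => ?_)
  rw [norm_pow, norm_norm, Pi.add_apply]
  refine le_trans ?_ (le_abs_self _)
  by_cases hx : x ∈ Ω
  · rw [indicator_of_mem hx]
    exact le_add_of_nonneg_right (by positivity)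
  · rw [indicator_of_notMem hx, zero_add, (hout x hx).2 i]

end ContinuousCompetitor

/-! ### The flux of the homogeneous map is the degree times the area -/

section Flux

open Filter Topology

theorem det_eq_detForm {n : ℕ} (A : Eucl n →L[ℝ] Eucl n) :
    A.det = detForm n fun i => A (stdVec i) := by
  have h := (EuclideanSpace.basisFun (Fin n) ℝ).toBasis.det_comp (A : Eucl n →ₗ[ℝ] Eucl n)
    (EuclideanSpace.basisFun (Fin n) ℝ).toBasis
  rw [Module.Basis.det_self, mul_one] at h
  rw [ContinuousLinearMap.det, ← h, detForm]
  congr 1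
  ext1 i
  simp [stdVec]

theorem detForm_update_add_smul {n : ℕ} (A : Fin n → Eucl n) (y : Fin n → ℝ) (w : Eucl n)
    (j : Fin n) : detForm n (Function.update (fun i => A i + y i • w) j w) =
      detForm n (Function.update A j w) := by
  rw [detForm_eq_det, detForm_eq_det, ← Matrix.det_transpose, ← Matrix.det_transpose (Matrix.of _)]
  refine Matrix.det_eq_of_forall_row_eq_smul_add_const (Function.update y j 0) j (by simp)
    fun i k => ?_
  rcases eq_or_ne i j with rfl | h
  · simp
  · simp [Function.update_of_ne h]

/-- A rank-one perturbation of a linear map with kernel vector `y`. -/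
theorem detForm_add_smul_of_sum_eq_zero {n : ℕ} (A : Fin n → Eucl n) (y : Eucl n) {w : Eucl n}
    (hw : w ≠ 0) (hy : y ≠ 0) (hA : ∑ j, y j • A j = 0) :
    detForm n (fun i => A i + y i • w) = ∑ j, y j * detForm n (Function.update A j w) := by
  have hdet : detForm n A = 0 := by
    obtain ⟨k, hk⟩ : ∃ k, y k ≠ 0 := by
      by_contra! h
      exact hy (by ext i; simpa using h i)
    refine AlternatingMap.map_linearDependent _ _ fun hli => hk ?_
    exact Fintype.linearIndependent_iff.1 hli _ hA k
  -- Cramer's rule for `A`, where the determinant vanishes, and for the perturbed family. The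
  -- perturbation does not change the coefficients, because `w` already occupies slot `j`; comparing
  -- the multiples of `w` yields the identity.
  have h1 := sum_detForm_update_smul A w
  have h2 := sum_detForm_update_smul (fun i => A i + y i • w) w
  simp only [detForm_update_add_smul, smul_add, Finset.sum_add_distrib, h1, hdet, zero_smul,
    zero_add, smul_smul, ← Finset.sum_smul] at h2
  rw [← smul_left_injective ℝ hw h2]
  exact Finset.sum_congr rfl fun j _ => mul_comm _ _

theorem detForm_update_smul {n : ℕ} (A : Fin n → Eucl n) (w : Eucl n) (j : Fin n) (c : ℝ) :
    detForm n (Function.update (fun i => c • A i) j w) =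
      c ^ (n - 1) * detForm n (Function.update A j w) := by
  have h := (detForm n).map_smul_univ (Function.update (fun _ => c) j 1) (Function.update A j w)
  have e : (fun i => Function.update (fun _ => c) j 1 i • Function.update A j w i) =
      Function.update (fun i => c • A i) j w := by
    ext1 i
    rcases eq_or_ne i j with rfl | hi
    · simp
    · simp [Function.update_of_ne hi]
  rw [e, Finset.prod_update_of_mem (Finset.mem_univ j)] at h
  rw [h]
  simp [Finset.card_sdiff]

theorem integral_eq_of_polar {F : Eucl 5 → ℝ} {h : Metric.sphere (0 : Eucl 5) 1 → ℝ} {k : ℝ → ℝ}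
    (hF : ∀ (y : Metric.sphere (0 : Eucl 5) 1) (r : ℝ), 0 < r → F (r • (y : Eucl 5)) = h y * k r) :
    ∫ x, F x = (∫ y, h y ∂(volume : Measure (Eucl 5)).toSphere) * ∫ r in Ioi (0 : ℝ), r ^ 4 * k r := by
  have hd : Module.finrank ℝ (Eucl 5) - 1 = 4 := by simp
  have hmp := (volume : Measure (Eucl 5)).measurePreserving_homeomorphUnitSphereProd
  rw [hd] at hmp
  calc ∫ x, F x = ∫ x : ({(0)}ᶜ : Set (Eucl 5)), F x.1 ∂((volume : Measure (Eucl 5)).comap (↑)) := by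
        rw [integral_subtype_comap (measurableSet_singleton _).compl fun x ↦ F x,
          restrict_compl_singleton]
    _ = ∫ z, h z.1 * k z.2 ∂(volume : Measure (Eucl 5)).toSphere.prod (.volumeIoiPow 4) := by
        rw [← hmp.integral_comp (Homeomorph.measurableEmbedding _)]
        refine integral_congr_ae (Eventually.of_forall fun x => ?_)
        have hx : 0 < ‖x.1‖ := norm_pos_iff.2 x.2
        have e : x.1 = ‖x.1‖ • (homeomorphUnitSphereProd (Eucl 5) x).1.1 := by
          rw [homeomorphUnitSphereProd_apply_fst_coe, smul_inv_smul₀ hx.ne']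
        simp only
        rw [homeomorphUnitSphereProd_apply_snd_coe, ← hF _ _ hx, ← e]
    _ = (∫ y, h y ∂(volume : Measure (Eucl 5)).toSphere) *
          ∫ r : Ioi (0 : ℝ), k r ∂.volumeIoiPow 4 :=
        integral_prod_mul h fun r : Ioi (0 : ℝ) => k r
    _ = _ := by
        congr 1
        simp only [Measure.volumeIoiPow, ENNReal.ofReal]
        rw [integral_withDensity_eq_integral_smul,
          integral_subtype_comap measurableSet_Ioi fun a ↦ Real.toNNReal (a ^ 4) • k a]
        · refine setIntegral_congr_fun measurableSet_Ioi fun x hx ↦ ?_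
          rw [NNReal.smul_def, Real.coe_toNNReal _ (pow_nonneg (le_of_lt hx) _), smul_eq_mul]
        · exact (measurable_subtype_coe.pow_const _).real_toNNReal

theorem integral_Ioi_two_mul_deriv_sq {g : ℝ → ℝ} (hg : ContDiff ℝ ∞ g) {R : ℝ} (hR : 0 ≤ R)
    (hgR : ∀ s, R ≤ s → g s = 0) : ∫ r in Ioi (0 : ℝ), 2 * r * deriv g (r ^ 2) = -g 0 := by
  have hd (r : ℝ) : HasDerivAt (fun r => g (r ^ 2)) (2 * r * deriv g (r ^ 2)) r := by
    have h1 := (hg.differentiable (by simp) (r ^ 2)).hasDerivAt.comp r (hasDerivAt_pow 2 r)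
    convert! h1 using 1
    simp
    ring
  have hcont : Continuous fun r : ℝ => 2 * r * deriv g (r ^ 2) :=
    (continuous_const.mul continuous_id).mul
      ((hg.continuous_deriv (by simp)).comp (continuous_pow 2))
  have hbig (r : ℝ) (hr : R + 1 < |r|) : R < r ^ 2 := by
    rw [← sq_abs]
    nlinarith
  have hint : Integrable fun r : ℝ => 2 * r * deriv g (r ^ 2) := by
    refine hcont.integrable_of_hasCompactSupport
      (HasCompactSupport.intro (isCompact_Icc (a := -(R + 1)) (b := R + 1)) fun r hr => ?_)
    have h1 : R < r ^ 2 := hbig r (by rwa [mem_Icc, ← abs_le, not_le] at hr)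
    have h2 : g =ᶠ[𝓝 (r ^ 2)] fun _ => 0 := by
      filter_upwards [lt_mem_nhds h1] with s hs using hgR s hs.le
    rw [h2.deriv_eq]
    simp
  have hlim : Tendsto (fun r : ℝ => g (r ^ 2)) atTop (𝓝 0) := by
    refine tendsto_const_nhds.congr' ?_
    filter_upwards [eventually_gt_atTop (R + 1)] with r hr
    exact (hgR _ (hbig r (hr.trans_le (le_abs_self r))).le).symm
  have := integral_Ioi_of_hasDerivAt_of_tendsto (hd 0).continuousAt.continuousWithinAt
    (fun r _ => hd r) hint.integrableOn hlim
  simpa using this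

variable {p : Eucl 5 → Eucl 5}

theorem fderiv_comp_radialProj_self (hp : ContDiff ℝ ∞ p) {x : Eucl 5} (hx : x ≠ 0) :
    fderiv ℝ (p ∘ radialProj) x x = 0 := by
  have h1 : HasDerivAt (fun s : ℝ => s • x) x 1 := by
    simpa using (hasDerivAt_id (1 : ℝ)).smul_const x
  have h2 : HasFDerivAt (p ∘ radialProj) (fderiv ℝ (p ∘ radialProj) x) ((1 : ℝ) • x) := by
    rw [one_smul]
    exact ((contDiffAt_comp_radialProj hp hx).differentiableAt (by simp)).hasFDerivAt
  have h3 := h2.comp_hasDerivAt (1 : ℝ) h1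
  have h4 : (p ∘ radialProj) ∘ (fun s : ℝ => s • x) =ᶠ[𝓝 1] fun _ => p (radialProj x) := by
    filter_upwards [lt_mem_nhds one_pos] with s hs
    simp [radialProj_smul hs]
  exact h3.unique ((hasDerivAt_const (1 : ℝ) (p (radialProj x))).congr_of_eventuallyEq h4)

theorem current_eq_zero {u : Eucl 5 → Eucl 5} {G : Fin 5 → Eucl 5 → Eucl 5} {x : Eucl 5}
    (hu : ‖u x‖ ≤ 1) (hG : ∀ i, G i x = 0) (j : Fin 5) : current u G j x = 0 := by
  have h := abs_current_le_sum G j hu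
  simp only [hG, norm_zero] at h
  simpa using h

/-- The four gradient factors are homogeneous of degree `-1`, whence `r⁻⁴`. Since `y` is in the
kernel of the differential of `p (x / |x|)` at `y`, the rank-one identity turns the radial component
of the current into the determinant that defines the degree. -/
theorem sum_mul_current_hemiMap (hp : ContDiff ℝ ∞ p)
    (hp_sphere : ∀ y : Eucl 5, ‖y‖ = 1 → 0 ≤ y 4 → ‖p y‖ = 1) {y : Eucl 5} (hy : ‖y‖ = 1)
    {r : ℝ} (hr : 0 < r) :
    ∑ j, y j * current (hemiMap p) (hemiGrad p) j (r • y) =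
      {y : Eucl 5 | 0 < y 4}.indicator (fun y =>
        (fderiv ℝ (p ∘ radialProj) y + (innerSL ℝ y).smulRight (p y)).det) y * (r ^ 4)⁻¹ := by
  have hlast : (r • y) 4 = r * y 4 := by simp
  by_cases hy4 : 0 < y 4
  · have hy0 : y ≠ 0 := by
      rintro rfl
      simp at hy4
    have hpos : ¬ (r • y) 4 ≤ 0 := by
      rw [hlast, not_le]
      positivity
    have hrad : radialProj y = y := by simp [radialProj, hy]
    have hw : p y ≠ 0 := by
      rw [← norm_ne_zero_iff, hp_sphere y hy hy4.le]
      exact one_ne_zero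
    have hcur (j : Fin 5) : current (hemiMap p) (hemiGrad p) j (r • y) =
        (r ^ 4)⁻¹ * detForm 5 (Function.update (fun i => radialGrad p i y) j (p y)) := by
      have e1 : hemiMap p (r • y) = p y := by
        rw [hemiMap, halfGlue, if_neg hpos, Function.comp_apply, radialProj_smul hr, hrad]
      have e2 (i : Fin 5) : hemiGrad p i (r • y) = r⁻¹ • radialGrad p i y := by
        rw [hemiGrad, halfGlue, if_neg hpos, isNegHomogeneous_radialGrad i r hr y, pow_one]
      simp only [current, e1, e2]
      rw [detForm_update_smul, inv_pow]
    have hsum : ∑ j, y j • radialGrad p j y = 0 := by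
      have h1 := fderiv_comp_radialProj_self hp hy0
      have h2 : y = ∑ i, y i • stdVec i := by
        ext j
        simp [stdVec, Pi.single_apply]
      conv_lhs at h1 => rw [h2, map_sum]
      rw [← h2] at h1
      simpa only [map_smul, radialGrad] using h1
    have key := detForm_add_smul_of_sum_eq_zero (fun i => radialGrad p i y) y hw hy0 hsum
    rw [indicator_of_mem (show y ∈ {y : Eucl 5 | 0 < y 4} from hy4), det_eq_detForm]
    have e3 (i : Fin 5) : (fderiv ℝ (p ∘ radialProj) y + (innerSL ℝ y).smulRight (p y)) (stdVec i)
        = radialGrad p i y + y i • p y := by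
      simp [radialGrad, stdVec, EuclideanSpace.inner_single_right]
    simp only [e3, key, hcur, Finset.sum_mul]
    exact Finset.sum_congr rfl fun j _ => by ring
  · rw [indicator_of_notMem (show y ∉ {y : Eucl 5 | 0 < y 4} from hy4), zero_mul]
    have hneg : (r • y) 4 ≤ 0 := by
      rw [hlast]
      exact mul_nonpos_of_nonneg_of_nonpos hr.le (not_lt.1 hy4)
    refine Finset.sum_eq_zero fun j _ => ?_
    rw [current_eq_zero (norm_hemiMap hp_sphere _).le (fun i => ?_), mul_zero]
    rw [hemiGrad, halfGlue, if_pos hneg]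

/-- The factor `r⁻⁴` cancels the `r⁴` of the volume element, and the radial integral of `2 r g'(r²)`
is `-g 0` for every cut-off. The spherical integral is the area, as the degree is one. -/
theorem integral_flux_hemiMap (hp : ContDiff ℝ ∞ p)
    (hp_sphere : ∀ y : Eucl 5, ‖y‖ = 1 → 0 ≤ y 4 → ‖p y‖ = 1) (hp_degree : hemisphereDegree p = 1)
    {g : ℝ → ℝ} (hg : ContDiff ℝ ∞ g) {R : ℝ} (hR : 0 ≤ R) (hg0 : g 0 = 1)
    (hgR : ∀ s, R ≤ s → g s = 0) :
    ∫ y, ∑ j, 2 * y j * deriv g (‖y‖ ^ 2) * current (hemiMap p) (hemiGrad p) j y =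
      -(volume : Measure (Eucl 5)).toSphere.real univ := by
  set S := (volume : Measure (Eucl 5)).toSphere.real univ
  set D : Eucl 5 → ℝ := fun y =>
    (fderiv ℝ (p ∘ radialProj) y + (innerSL ℝ y).smulRight (p y)).det
  rw [integral_eq_of_polar (h := fun y => {y : Eucl 5 | 0 < y 4}.indicator D y)
    (k := fun r => 2 * r * deriv g (r ^ 2) * (r ^ 4)⁻¹)]
  · have h1 : ∫ r in Ioi (0 : ℝ), r ^ 4 * (2 * r * deriv g (r ^ 2) * (r ^ 4)⁻¹) = -1 := by
      rw [← hg0, ← integral_Ioi_two_mul_deriv_sq hg hR hgR]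
      refine setIntegral_congr_fun measurableSet_Ioi fun r hr => ?_
      have : r ^ 4 ≠ 0 := pow_ne_zero _ (ne_of_gt hr)
      field_simp
    have h2 : ∫ y : Metric.sphere (0 : Eucl 5) 1, {y : Eucl 5 | 0 < y 4}.indicator D y
        ∂(volume : Measure (Eucl 5)).toSphere = S := by
      -- With the convention `0⁻¹ = 0`, vanishing area would force the degree to be 0.
      have hS : S ≠ 0 := by
        intro h
        rw [hemisphereDegree] at hp_degree
        change S⁻¹ * _ = 1 at hp_degree
        rw [h, inv_zero, zero_mul] at hp_degree
        exact zero_ne_one hp_degree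
      have hms : MeasurableSet {y : Metric.sphere (0 : Eucl 5) 1 | 0 < (y : Eucl 5) 4} :=
        (isOpen_lt continuous_const ((EuclideanSpace.proj (𝕜 := ℝ) (4 : Fin 5)).continuous.comp
          continuous_subtype_val)).measurableSet
      have h3 : S⁻¹ * ∫ y in {y : Metric.sphere (0 : Eucl 5) 1 | 0 < (y : Eucl 5) 4}, D y
          ∂(volume : Measure (Eucl 5)).toSphere = 1 := hp_degree
      rw [inv_mul_eq_one₀ hS, ← integral_indicator hms] at h3
      exact h3.symm
    rw [h1, h2, mul_neg_one]
  · intro y r hr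
    have hy : ‖(y : Eucl 5)‖ = 1 := norm_eq_of_mem_sphere y
    have h1 := sum_mul_current_hemiMap hp hp_sphere hy hr
    have h2 : ‖r • (y : Eucl 5)‖ = r := by rw [norm_smul, hy, mul_one, Real.norm_of_nonneg hr.le]
    calc _ = 2 * r * deriv g (r ^ 2) *
          ∑ j, (y : Eucl 5) j * current (hemiMap p) (hemiGrad p) j (r • (y : Eucl 5)) := by
          rw [Finset.mul_sum, h2]
          refine Finset.sum_congr rfl fun j _ => ?_
          rw [PiLp.smul_apply, smul_eq_mul]
          ring
      _ = _ := by
          rw [h1]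
          ring

end Flux

/-! ### The energy of continuous maps grows linearly with `L` -/

section EnergyLowerBound

open Filter Topology

theorem exists_bound_deriv_smoothTransition :
    ∃ C : ℝ, 0 < C ∧ ∀ t, |deriv Real.smoothTransition t| ≤ C := by
  have hcs : HasCompactSupport (deriv Real.smoothTransition) := by
    refine HasCompactSupport.intro (isCompact_Icc (a := (0 : ℝ)) (b := 1)) fun t ht => ?_
    rw [mem_Icc, not_and_or, not_le, not_le] at ht
    rcases ht with ht | ht
    · have e : Real.smoothTransition =ᶠ[𝓝 t] fun _ => 0 := by
        filter_upwards [gt_mem_nhds ht] with s hs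
        exact Real.smoothTransition.zero_of_nonpos hs.le
      rw [e.deriv_eq, deriv_const]
    · have e : Real.smoothTransition =ᶠ[𝓝 t] fun _ => 1 := by
        filter_upwards [lt_mem_nhds ht] with s hs
        exact Real.smoothTransition.one_of_one_le hs.le
      rw [e.deriv_eq, deriv_const]
  obtain ⟨C, hC⟩ := hcs.exists_bound_of_continuous
    ((Real.smoothTransition.contDiff (n := 1)).continuous_deriv le_rfl)
  exact ⟨max C 1, by positivity, fun t => (hC t).trans (le_max_left _ _)⟩

theorem contDiff_smoothTransition : ContDiff ℝ ∞ Real.smoothTransition :=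
  Real.smoothTransition.contDiff

theorem locallyIntegrable_current {u : Eucl 5 → Eucl 5} {G : Fin 5 → Eucl 5 → Eucl 5}
    (hu : Continuous u) (hu1 : ∀ x, ‖u x‖ = 1) (hG : ∀ i, AEStronglyMeasurable (G i))
    (hG4 : ∀ i, LocallyIntegrable fun x => ‖G i x‖ ^ 4) (j : Fin 5) :
    LocallyIntegrable (current u G j) := by
  have hm : AEStronglyMeasurable (current u G j) := by
    have h1 : AEMeasurable fun x => Function.update (fun i => G i x) j (u x) := by
      refine aemeasurable_pi_lambda _ fun i => ?_
      rcases eq_or_ne i j with rfl | hi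
      · simpa using hu.measurable.aemeasurable
      · simpa [Function.update_of_ne hi] using (hG i).aemeasurable
    exact (detMap 5).cont.comp_aestronglyMeasurable h1.aestronglyMeasurable
  refine (locallyIntegrable_finsetSum Finset.univ fun i _ => hG4 i).mono hm
    (Eventually.of_forall fun x => ?_)
  rw [Real.norm_eq_abs]
  exact (abs_current_le_sum G j (hu1 x).le).trans (le_abs_self _)

variable {p : Eucl 5 → Eucl 5} {L : ℝ}

theorem hemiGrad_eq_zero {x : Eucl 5} (hx : x 4 ≤ 0) (i : Fin 5) : hemiGrad p i x = 0 := by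
  rw [hemiGrad, halfGlue, if_pos hx]

/-- The cut-off function in the direction of the axis of the capsule. -/
noncomputable def axialCutoff (L t : ℝ) : ℝ := Real.smoothTransition ((t + L) / (2 * L))

theorem contDiff_axialCutoff : ContDiff ℝ ∞ (axialCutoff L) :=
  contDiff_smoothTransition.comp ((contDiff_id.add contDiff_const).div_const _)

theorem axialCutoff_eq_zero (hL : 0 < L) {t : ℝ} (ht : t ≤ -L) : axialCutoff L t = 0 :=
  Real.smoothTransition.zero_of_nonpos (div_nonpos_of_nonpos_of_nonneg (by linarith) (by linarith))

theorem axialCutoff_eq_one (hL : 0 < L) {t : ℝ} (ht : L ≤ t) : axialCutoff L t = 1 :=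
  Real.smoothTransition.one_of_one_le (by rw [one_le_div (by linarith)]; linarith)

theorem abs_deriv_axialCutoff_le (hL : 0 < L) {C : ℝ}
    (hC : ∀ t, |deriv Real.smoothTransition t| ≤ C) (t : ℝ) :
    |deriv (axialCutoff L) t| ≤ C / (2 * L) := by
  have h1 : HasDerivAt (fun t => (t + L) / (2 * L)) (1 / (2 * L)) t :=
    ((hasDerivAt_id t).add_const L).div_const _
  have h2 : HasDerivAt (axialCutoff L) _ t :=
    ((contDiff_smoothTransition.differentiable (by simp) _).hasDerivAt).comp t h1
  rw [h2.deriv, abs_mul, abs_of_pos (a := 1 / (2 * L)) (by positivity), mul_one_div]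
  gcongr
  exact hC _

theorem deriv_axialCutoff_eq_zero (hL : 0 < L) {t : ℝ} (ht : L < |t|) :
    deriv (axialCutoff L) t = 0 := by
  rcases lt_abs.1 ht with h | h
  · have e : axialCutoff L =ᶠ[𝓝 t] fun _ => 1 := by
      filter_upwards [lt_mem_nhds h] with s hs using axialCutoff_eq_one hL hs.le
    rw [e.deriv_eq, deriv_const]
  · have e : axialCutoff L =ᶠ[𝓝 t] fun _ => 0 := by
      filter_upwards [gt_mem_nhds (lt_neg.1 h)] with s hs using axialCutoff_eq_zero hL hs.le
    rw [e.deriv_eq, deriv_const]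

/-- The radial cut-off function, as a function of the square of the distance. -/
noncomputable def radialCutoff (L s : ℝ) : ℝ :=
  Real.smoothTransition ((2 * L + 1) ^ 2 + 1 - s)

theorem contDiff_radialCutoff : ContDiff ℝ ∞ (radialCutoff L) :=
  contDiff_smoothTransition.comp (contDiff_const.sub contDiff_id)

theorem radialCutoff_eq_one {s : ℝ} (hs : s ≤ (2 * L + 1) ^ 2) : radialCutoff L s = 1 :=
  Real.smoothTransition.one_of_one_le (by linarith)

theorem radialCutoff_eq_zero {s : ℝ} (hs : (2 * L + 1) ^ 2 + 1 ≤ s) : radialCutoff L s = 0 :=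
  Real.smoothTransition.zero_of_nonpos (by linarith)

theorem deriv_radialCutoff_eq_zero {s : ℝ} (hs : s < (2 * L + 1) ^ 2) :
    deriv (radialCutoff L) s = 0 := by
  have e : radialCutoff L =ᶠ[𝓝 s] fun _ => 1 := by
    filter_upwards [gt_mem_nhds hs] with t ht using radialCutoff_eq_one ht.le
  rw [e.deriv_eq, deriv_const]

/-- The function against which the current of a map is tested. -/
noncomputable def fluxCutoff (L : ℝ) (x : Eucl 5) : ℝ :=
  axialCutoff L (x 4) * radialCutoff L (‖upperChart L x‖ ^ 2)

theorem isTestFunction_fluxCutoff (hL : 0 < L) : IsTestFunction univ (fluxCutoff L) := by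
  refine ⟨?_, ?_, subset_univ _⟩
  · exact (contDiff_axialCutoff.comp (EuclideanSpace.proj (𝕜 := ℝ) (4 : Fin 5)).contDiff).mul
      (contDiff_radialCutoff.comp ((contDiff_id.sub contDiff_const).norm_sq ℝ))
  · refine HasCompactSupport.intro
      (isCompact_closedBall (L • northPole) (2 * L + 2)) fun x hx => ?_
    rw [mem_closedBall_iff_norm, not_le] at hx
    rw [fluxCutoff, radialCutoff_eq_zero, mul_zero]
    rw [upperChart]
    nlinarith

theorem fderiv_fluxCutoff (x : Eucl 5) (j : Fin 5) :
    fderiv ℝ (fluxCutoff L) x (stdVec j) =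
      (if j = 4 then deriv (axialCutoff L) (x 4) * radialCutoff L (‖upperChart L x‖ ^ 2) else 0) +
      axialCutoff L (x 4) *
        (2 * upperChart L x j * deriv (radialCutoff L) (‖upperChart L x‖ ^ 2)) := by
  have ha : HasDerivAt (axialCutoff L) (deriv (axialCutoff L) (x 4)) (x 4) :=
    (contDiff_axialCutoff.differentiable (by simp) _).hasDerivAt
  have hb : HasDerivAt (radialCutoff L) (deriv (radialCutoff L) (‖upperChart L x‖ ^ 2))
      (‖upperChart L x‖ ^ 2) := (contDiff_radialCutoff.differentiable (by simp) _).hasDerivAt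
  have h1 := ha.comp_hasFDerivAt x (EuclideanSpace.proj (𝕜 := ℝ) (4 : Fin 5)).hasFDerivAt
  have h2 := hb.comp_hasFDerivAt x ((hasFDerivAt_id x).sub_const (L • northPole)).norm_sq
  have h3 : HasFDerivAt (fluxCutoff L) _ x := h1.mul h2
  rw [h3.fderiv]
  simp [stdVec, EuclideanSpace.inner_single_right, upperChart, eq_comm]
  split_ifs <;> ring

/-- The derivative of the radial factor vanishes in the capsule, and outside `u` is the radial
extension. Above height `L` the axial factor is one and `u` is the upper `hemiMap`; between the two
heights the current vanishes; below `-L` the axial factor removes the opposite charge. So this term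
depends on `p` alone. -/
theorem sum_fderiv_fluxCutoff_mul_current (hL : 0 < L)
    (hp_sphere : ∀ y : Eucl 5, ‖y‖ = 1 → 0 ≤ y 4 → ‖p y‖ = 1)
    {u : Eucl 5 → Eucl 5} {G : Fin 5 → Eucl 5 → Eucl 5} (hu1 : ∀ x, ‖u x‖ = 1)
    (hout : ∀ x ∉ capsule L, u x = radialExtension p L x ∧ ∀ i, G i x = radExtGrad p L i x)
    (x : Eucl 5) :
    ∑ j, fderiv ℝ (fluxCutoff L) x (stdVec j) * current u G j x =
      deriv (axialCutoff L) (x 4) * radialCutoff L (‖upperChart L x‖ ^ 2) * current u G 4 x +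
      ∑ j, 2 * upperChart L x j * deriv (radialCutoff L) (‖upperChart L x‖ ^ 2) *
        current (hemiMap p) (hemiGrad p) j (upperChart L x) := by
  simp only [fderiv_fluxCutoff, add_mul, Finset.sum_add_distrib, ite_mul, zero_mul,
    Finset.sum_ite_eq', Finset.mem_univ, if_true]
  congr 1
  refine Finset.sum_congr rfl fun j _ => ?_
  rcases lt_or_ge (‖upperChart L x‖ ^ 2) ((2 * L + 1) ^ 2) with h | h
  · simp [deriv_radialCutoff_eq_zero h]
  -- The capsule lies in the ball of radius `2 * L + 1` about the upper centre: one unit from the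
  -- axis and at most `2 * L` along it.
  have hx : x ∉ capsule L := by
    intro hx
    obtain ⟨t, ht, hxt⟩ := (mem_capsule_iff hL).1 hx
    have h1 : ‖upperChart L x‖ < 2 * L + 1 := by
      have e : upperChart L x = (x - t • northPole) + (t - L) • northPole := by
        rw [upperChart]; module
      rw [e]
      refine (norm_add_le _ _).trans_lt ?_
      rw [norm_smul, norm_northPole, mul_one, Real.norm_eq_abs, abs_of_nonpos (by linarith [ht.2])]
      linarith [ht.1]
    nlinarith [norm_nonneg (upperChart L x)]
  obtain ⟨hux, hGx⟩ := hout x hx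
  have hzero (hx4 : x 4 ≤ L) : current (hemiMap p) (hemiGrad p) j (upperChart L x) = 0 :=
    current_eq_zero (norm_hemiMap hp_sphere _).le
      (hemiGrad_eq_zero (by rw [upperChart_last]; linarith)) j
  rcases le_or_gt (x 4) L with h4 | h4
  · rw [hzero h4]
    rcases le_or_gt (x 4) (-L) with h5 | h5
    · rw [axialCutoff_eq_zero hL h5]
      ring
    · rw [current_eq_zero (hu1 x).le fun i => ?_]
      · ring
      · rw [hGx, radExtGrad, hemiGrad_eq_zero (by rw [upperChart_last]; linarith),
          hemiGrad_eq_zero (by rw [lowerChart_last]; linarith), smul_zero, add_zero]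
  · have hl : lowerChart L x 4 ≤ 0 := by rw [lowerChart_last]; linarith
    have e1 : u x = hemiMap p (upperChart L x) := by
      rw [hux, radialExtension_eq hL, hemiMap_eq_of_nonpos hl, sub_self, add_zero]
    have e2 (i : Fin 5) : G i x = hemiGrad p i (upperChart L x) := by
      rw [hGx, radExtGrad, hemiGrad_eq_zero hl, smul_zero, add_zero]
    simp only [current, e1, e2, axialCutoff_eq_one hL h4.le, one_mul]

/-- The energy of a continuous map of the class grows linearly with the length of the capsule. -/
theorem ofReal_area_le_hessianEnergy (hL : 0 < L) (hp : ContDiff ℝ ∞ p)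
    (hp_sphere : ∀ y : Eucl 5, ‖y‖ = 1 → 0 ≤ y 4 → ‖p y‖ = 1)
    (hp_equator : ∀ y : Eucl 5, ‖y‖ = 1 → y 4 = 0 → p y = northPole)
    (hp_deriv : ∀ y : Eucl 5, ‖y‖ = 1 → y 4 = 0 → fderiv ℝ p y northPole = 0)
    (hp_degree : hemisphereDegree p = 1) {C : ℝ} (hC : ∀ t, |deriv Real.smoothTransition t| ≤ C)
    {v : Eucl 5 → Eucl 5} (hv : v ∈ capsuleMaps p L)
    (hvc : ContinuousOn v (closure (capsule L))) (hE : hessianEnergy (capsule L) v < ⊤) :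
    ENNReal.ofReal ((volume : Measure (Eucl 5)).toSphere.real univ) ≤
      ENNReal.ofReal (C / (2 * L)) * hessianEnergy (capsule L) v := by
  obtain ⟨u, G, hu, hu1, hG, hG4, hout, hen⟩ :=
    exists_continuous_extension hL hp hp_sphere hp_equator hp_deriv hv hvc hE
  set S := (volume : Measure (Eucl 5)).toSphere.real univ
  have hη := isTestFunction_fluxCutoff hL
  have hGm (i : Fin 5) : AEStronglyMeasurable (G i) :=
    (locallyIntegrableOn_univ.1 (hG i).locallyIntegrableOn_right).aestronglyMeasurable
  have hcur := locallyIntegrable_current hu hu1 hGm hG4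
  set A : Eucl 5 → ℝ := fun x =>
    deriv (axialCutoff L) (x 4) * radialCutoff L (‖upperChart L x‖ ^ 2) * current u G 4 x with hA
  set B : Eucl 5 → ℝ := fun y => ∑ j, 2 * y j * deriv (radialCutoff L) (‖y‖ ^ 2) *
    current (hemiMap p) (hemiGrad p) j y
  set T : Eucl 5 → ℝ := fun x => ∑ j, fderiv ℝ (fluxCutoff L) x (stdVec j) * current u G j x
  have hT (x : Eucl 5) : T x = A x + B (upperChart L x) :=
    sum_fderiv_fluxCutoff_mul_current hL hp_sphere hu1 hout x
  have hTj (j : Fin 5) :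
      Integrable fun x => fderiv ℝ (fluxCutoff L) x (stdVec j) * current u G j x :=
    (hcur j).integrable_smul_left_of_hasCompactSupport (hη.fderiv_apply _).continuous
      (hη.fderiv_apply _).hasCompactSupport
  have hTint : Integrable T := integrable_finsetSum _ fun j _ => hTj j
  have hT0 : ∫ x, T x = 0 := by
    rw [integral_finsetSum _ fun j _ => hTj j]
    exact sum_integral_current_eq_zero hu hu1 hG hG4 hη
  have hAint : Integrable A := by
    refine (hcur 4).integrable_smul_left_of_hasCompactSupport
      (g := fun x => deriv (axialCutoff L) (x 4) * radialCutoff L (‖upperChart L x‖ ^ 2)) ?_ ?_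
    · exact ((contDiff_axialCutoff.continuous_deriv (by simp)).comp
        (EuclideanSpace.proj (𝕜 := ℝ) (4 : Fin 5)).continuous).mul
        (contDiff_radialCutoff.continuous.comp (continuous_upperChart.norm.pow 2))
    · refine HasCompactSupport.intro
        (isCompact_closedBall (L • northPole) (2 * L + 2)) fun x hx => ?_
      rw [mem_closedBall_iff_norm, not_le] at hx
      rw [radialCutoff_eq_zero, mul_zero]
      rw [upperChart]
      nlinarith
  have hB : ∫ x, B (upperChart L x) = -S := by
    have h1 : ∫ x, B (upperChart L x) = ∫ y, B y := integral_sub_right_eq_self B _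
    rw [h1]
    exact integral_flux_hemiMap hp hp_sphere hp_degree contDiff_radialCutoff
      (R := (2 * L + 1) ^ 2 + 1) (by positivity) (radialCutoff_eq_one (by positivity))
      (fun s hs => radialCutoff_eq_zero hs)
  have hBint : Integrable fun x => B (upperChart L x) := by
    have e : (fun x => B (upperChart L x)) = fun x => T x - A x := by
      ext1 x
      rw [hT, add_sub_cancel_left]
    rw [e]
    exact hTint.sub hAint
  -- Conservation of flux: the radial part contributes `-S`, so the axial part, which involves the
  -- unknown map, has to contribute `S`.
  have hAS : ∫ x, A x = S := by
    have e : ∫ x, T x = (∫ x, A x) + ∫ x, B (upperChart L x) := by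
      rw [← integral_add hAint hBint]
      exact integral_congr_ae (Eventually.of_forall hT)
    rw [hT0, hB] at e
    linarith
  have hC0 : 0 ≤ C := (abs_nonneg _).trans (hC 0)
  -- The axial derivative lives at heights between `-L` and `L`. At these heights `u` is constant
  -- outside the capsule, so only the capsule contributes.
  have hAle (x : Eucl 5) : ‖A x‖ₑ ≤ (capsule L).indicator (fun x =>
      ENNReal.ofReal (C / (2 * L)) * ENNReal.ofReal ((∑ i, ‖G i x‖ ^ 2) ^ 2)) x := by
    by_cases hx : x ∈ capsule L
    · rw [indicator_of_mem hx, ← ENNReal.ofReal_mul (by positivity), ← ofReal_norm]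
      refine ENNReal.ofReal_le_ofReal ?_
      rw [Real.norm_eq_abs, hA, abs_mul, abs_mul]
      have h1 := abs_deriv_axialCutoff_le hL hC (x 4)
      have h2 : |radialCutoff L (‖upperChart L x‖ ^ 2)| ≤ 1 := by
        rw [radialCutoff, abs_of_nonneg (Real.smoothTransition.nonneg _)]
        exact Real.smoothTransition.le_one _
      have h3 : |current u G 4 x| ≤ (∑ i, ‖G i x‖ ^ 2) ^ 2 := by
        refine (abs_current_le_sum G 4 (hu1 x).le).trans ?_
        refine le_trans (le_of_eq ?_) (Finset.sum_sq_le_sq_sum_of_nonneg (s := Finset.univ)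
          (f := fun i => ‖G i x‖ ^ 2) (fun i _ => by positivity))
        exact Finset.sum_congr rfl fun i _ => by ring
      calc _ ≤ C / (2 * L) * 1 * (∑ i, ‖G i x‖ ^ 2) ^ 2 := by gcongr
        _ = _ := by ring
    · have : A x = 0 := by
        rcases lt_or_ge L |x 4| with h | h
        · simp [hA, deriv_axialCutoff_eq_zero hL h]
        · obtain ⟨h1, h2⟩ := abs_le.1 h
          simp only [hA]
          rw [current_eq_zero (hu1 x).le fun i => ?_, mul_zero]
          rw [(hout x hx).2, radExtGrad, hemiGrad_eq_zero (by rw [upperChart_last]; linarith),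
            hemiGrad_eq_zero (by rw [lowerChart_last]; linarith), smul_zero, add_zero]
      simp [this]
  calc ENNReal.ofReal S ≤ ‖∫ x, A x‖ₑ := by
        rw [hAS, ← ofReal_norm]
        exact ENNReal.ofReal_le_ofReal (le_abs_self _)
    _ ≤ ∫⁻ x, ‖A x‖ₑ := enorm_integral_le_lintegral_enorm _
    _ ≤ ∫⁻ x, (capsule L).indicator (fun x =>
          ENNReal.ofReal (C / (2 * L)) * ENNReal.ofReal ((∑ i, ‖G i x‖ ^ 2) ^ 2)) x :=
        lintegral_mono hAle
    _ = ENNReal.ofReal (C / (2 * L)) *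
          ∫⁻ x in capsule L, ENNReal.ofReal ((∑ i, ‖G i x‖ ^ 2) ^ 2) := by
        rw [lintegral_indicator (isOpen_capsule hL).measurableSet,
          lintegral_const_mul' _ _ ENNReal.ofReal_ne_top]
    _ ≤ _ := by gcongr

end EnergyLowerBound

/-! ### Comparison of the two infima -/

/-- Gap phenomenon. The map `p` describes `ψ⁺` on the closed upper unit hemisphere, centred at the
origin; its values elsewhere play no role, and a map of the closed hemisphere is smooth
exactly when it is the restriction of a smooth map of `ℝ⁵`. -/
theorem propositionA2
    (p : EuclideanSpace ℝ (Fin 5) → EuclideanSpace ℝ (Fin 5))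
    (hp_smooth : ContDiff ℝ ∞ p)
    (hp_sphere : ∀ y : EuclideanSpace ℝ (Fin 5), ‖y‖ = 1 → 0 ≤ y 4 → ‖p y‖ = 1)
    (hp_equator : ∀ y : EuclideanSpace ℝ (Fin 5), ‖y‖ = 1 → y 4 = 0 → p y = northPole)
    (hp_deriv : ∀ y : EuclideanSpace ℝ (Fin 5), ‖y‖ = 1 → y 4 = 0 →
      fderiv ℝ p y northPole = 0)
    (hp_degree : hemisphereDegree p = 1) :
    ∃ L₀ : ℝ, 0 < L₀ ∧ ∀ L : ℝ, L₀ ≤ L →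
      (⨅ u ∈ capsuleMaps p L, hessianEnergy (capsule L) u) <
        ⨅ v ∈ {v | v ∈ capsuleMaps p L ∧ ContinuousOn v (closure (capsule L))},
          hessianEnergy (capsule L) v := by
  obtain ⟨C, hC0, hC⟩ := exists_bound_deriv_smoothTransition
  set S := (volume : Measure (Eucl 5)).toSphere.real univ
  have hS : 0 < S := by
    refine lt_of_le_of_ne measureReal_nonneg fun h => ?_
    rw [hemisphereDegree] at hp_degree
    change S⁻¹ * _ = 1 at hp_degree
    rw [← h, inv_zero, zero_mul] at hp_degree
    exact zero_ne_one hp_degree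
  set E := 2 * ∫⁻ x in Metric.ball 0 1, ‖hemiLaplacian p x‖ₑ ^ 2
  have hEtop : E ≠ ⊤ :=
    ENNReal.mul_ne_top (by simp) (lintegral_hemiLaplacian_lt_top hp_smooth).ne
  have hE0 : 0 ≤ E.toReal := ENNReal.toReal_nonneg
  -- For such `L` one has `C * (E + 1) ≤ 2 * S * L`, and the lower bound says that `2 * S * L` is at
  -- most `C` times the energy of a continuous competitor. The extra 1 makes the inequality between
  -- the infima strict.
  refine ⟨C * (E.toReal + 1) / (2 * S), by positivity, fun L hL => ?_⟩
  have hL0 : 0 < L := lt_of_lt_of_le (by positivity) hL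
  have hlt : E < E + 1 := ENNReal.lt_add_right hEtop one_ne_zero
  refine (iInf₂_le_of_le _ (radialExtension_mem_capsuleMaps hL0 hp_smooth hp_sphere hp_equator
    hp_deriv) (hessianEnergy_radialExtension_le hL0 hp_smooth hp_equator hp_deriv)).trans_lt
    (hlt.trans_le (le_iInf₂ fun v hv => ?_))
  rcases eq_or_ne (hessianEnergy (capsule L) v) ⊤ with htop | htop
  · rw [htop]
    exact le_top
  have h1 := ofReal_area_le_hessianEnergy hL0 hp_smooth hp_sphere hp_equator hp_deriv hp_degree hC
    hv.1 hv.2 (lt_top_iff_ne_top.2 htop)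
  have h2 : E + 1 = ENNReal.ofReal (E.toReal + 1) := by
    rw [ENNReal.ofReal_add hE0 zero_le_one, ENNReal.ofReal_toReal hEtop, ENNReal.ofReal_one]
  rw [← ENNReal.ofReal_toReal htop, ← ENNReal.ofReal_mul (by positivity),
    ENNReal.ofReal_le_ofReal_iff (by positivity), div_mul_eq_mul_div, le_div_iff₀ (by positivity)]
    at h1
  rw [h2, ← ENNReal.ofReal_toReal htop]
  refine ENNReal.ofReal_le_ofReal ?_
  rw [div_le_iff₀ (by positivity)] at hL
  have h3 : C * (E.toReal + 1) ≤ C * (hessianEnergy (capsule L) v).toReal := by linarith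
  exact le_of_mul_le_mul_left h3 hC0
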